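/- Notation. Let $d\in\mathbb N$; $\nabla$ denotes the generalized gradient with respect to $x\in\mathbb R^d$, and $\Lambda(x):=\ln\max(|x|,1)$. $W^{1,1}_{loc}$ is the space of locally integrable functions on $\mathbb R^d$ whose generalized gradient is locally integrable, and $\|f\|_{W^{p,1}}:=\|f\|_{L^p(\mathbb R^d)}+\|\nabla f\|_{L^p(\mathbb R^d)}$. For $1\le p,q<\infty$, $\tau>0$, $L^{p,q}([0,\tau]\times\mathbb R^d)$ and $\mathbb H^{p,q}([0,\tau]\times\mathbb R^d)$ are the spaces of measurable functions $f$ on $[0,\tau]\times\mathbb R^d$ with $\int_0^\tau\|f(t,\cdot)\|_{L^p(\mathbb R^d)}^q\,dt<\infty$ and $\int_0^\tau\|f(t,\cdot)\|_{W^{p,1}}^q\,dt<\infty$, respectively. A measure $\nu$ on $\mathbb R^d$ has finite entropy if $\nu=\varrho_0\,dx$ with $\varrho_0\ln\varrho_0\in L^1(\mathbb R^d)$, where $0\ln 0:=0$. Setting. Let $(\mu_t)_{t\in[0,1)}$ be a (measurable) family of Borel probability measures on $\mathbb R^d$ and let $\mu:=\mu_t(dx)\,dt$ on $(0,1)\times\mathbb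 R^d$. Let $A=(a^{ij})$ and $b=(b^i)$ be a matrix-valued and a vector-valued mapping on $(0,1)\times\mathbb R^d$, with $a^{ij}$ Borel and $b^i$ $\mu$-measurable, and put $$Lu=\partial_tu+\sum_{i,j}a^{ij}\partial_{x_i}\partial_{x_j}u+\sum_i b^i\partial_{x_i}u .$$ Suppose that $L^*\mu=0$, i.e. $a^{ij},b^i$ are $\mu$-integrable on every compact subset of $(0,1)\times\mathbb R^d$ and $\int Lu\,d\mu=0$ for all $u\in C_0^\infty((0,1)\times\mathbb R^d)$, and that the initial condition $\lim_{t\to0}\int\zeta\,d\mu_t=\int\zeta\,d\mu_0$ holds for all $\zeta\in C_0^\infty(\mathbb R^d)$. Suppose also that (i) $A$ is uniformly bounded, $\langle A(t,x)\xi,\xi\rangle\ge\alpha|\xi|^2$ for all $t,x,\xi$ with some constant $\alpha>0$, and the functions $x\mapsto a^{ij}(t,x)$ are Lipschitzian with a constant $\lambda$ independent of $t$; (ii) $|b|\in L^2(\mu)$. **Theorem.** (a) If $\langle b(t,x),x\rangle\le C_1|x|^2\Lambda(x)+C_2$ for $\mu$-a.e. $(t,x)$ with some constants $C_1,C_2$,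 and $\Lambda\in L^2(\mu_0)$, then $\Lambda\in L^2(\mu)$. (b) Suppose that $\Lambda\in L^2(\mu)$ and that $\mu_0$ has finite entropy. Then there is a nonnegative measurable function $\varrho$ such that, for almost all $t\in(0,1)$, $\mu_t=\varrho(t,\cdot)\,dx$ and $\varrho(t,\cdot)\in W^{1,1}_{loc}$, and for each $\tau\in(0,1)$ $$\int_0^\tau\int_{\mathbb R^d}\frac{|\nabla\varrho(t,x)|^2}{\varrho(t,x)}\,dx\,dt<\infty ,\qquad(*)$$ where the integrand is $0$ wherever $\varrho=0$. Moreover, for each $\tau\in(0,1)$, $\sqrt\varrho\in\mathbb H^{2,2}([0,\tau]\times\mathbb R^d)$; $\varrho\in L^{d/(d-2),1}([0,\tau]\times\mathbb R^d)$ if $d>2$; and $\varrho\in L^{s,1}([0,\tau]\times\mathbb R^d)$ for all $s\in[1,\infty)$ if $d=2$. (c) In the situation of (b), if the integrals $\int\varrho(t,x)\Lambda(x)\,dx$ are bounded for almost all $t$ in some left neighbourhood of $1$, then $(*)$ holds also for $\tau=1$. This boundedness holds if $\langle b(t,x),x\rangle\le C_1|x|^2+C_2$ for $\mu$-a.e.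 $(t,x)$ with some constants $C_1,C_2$, and $\Lambda\in L^1(\mu_0)$. -/

import Mathlib

open MeasureTheory ProbabilityTheory Set Filter Topology
open scoped ENNReal NNReal ContDiff

namespace ParabolicMeasure

/-- The space `ℝ^d` with its Euclidean norm. -/
abbrev Space (d : ℕ) : Type := EuclideanSpace ℝ (Fin d)

/-- The measure `μ(dt dx) = μ_t(dx) dt` on `(0,1) × ℝ^d`, regarded as a measure on `ℝ × ℝ^d`
concentrated on `(0,1) × ℝ^d`. Values `κ t` with `t` outside `(0,1)` play no role in it. -/
noncomputable def spaceTime {d : ℕ} (κ : Kernel ℝ (Space d)) : Measure (ℝ × Space d) :=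
  Measure.compProd (volume.restrict (Ioo (0 : ℝ) 1)) κ

/-- The time derivative `∂_t u`. -/
noncomputable def dt {d : ℕ} (u : ℝ × Space d → ℝ) (z : ℝ × Space d) : ℝ :=
  fderiv ℝ u z (1, 0)

/-- The spatial partial derivative `∂_{x_i} u`. -/
noncomputable def dx {d : ℕ} (i : Fin d) (u : ℝ × Space d → ℝ) (z : ℝ × Space d) : ℝ :=
  fderiv ℝ u z (0, EuclideanSpace.single i 1)

/-- The operator `L u = ∂_t u + a^{ij} ∂_{x_i} ∂_{x_j} u + b^i ∂_{x_i} u`. -/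
noncomputable def opL {d : ℕ} (A : ℝ × Space d → Matrix (Fin d) (Fin d) ℝ)
    (b : ℝ × Space d → Space d) (u : ℝ × Space d → ℝ) (z : ℝ × Space d) : ℝ :=
  dt u z + ∑ i, ∑ j, A z i j * dx i (dx j u) z + ∑ i, b z i * dx i u z

/-- `μ = μ_t dt` solves `L^* μ = 0` on `(0,1) × ℝ^d`: the coefficients are `μ`-integrable on
compact subsets of `(0,1) × ℝ^d`, and `∫ L u dμ = 0` for all `u ∈ C_0^∞((0,1) × ℝ^d)`. -/
structure IsSolution {d : ℕ} (A : ℝ × Space d → Matrix (Fin d) (Fin d) ℝ)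
    (b : ℝ × Space d → Space d) (κ : Kernel ℝ (Space d)) : Prop where
  integrableOn_A : ∀ K : Set (ℝ × Space d), IsCompact K → K ⊆ Ioo (0 : ℝ) 1 ×ˢ univ →
    ∀ i j, IntegrableOn (fun z => A z i j) K (spaceTime κ)
  integrableOn_b : ∀ K : Set (ℝ × Space d), IsCompact K → K ⊆ Ioo (0 : ℝ) 1 ×ˢ univ →
    ∀ i, IntegrableOn (fun z => b z i) K (spaceTime κ)
  integral_eq_zero : ∀ u : ℝ × Space d → ℝ, ContDiff ℝ ∞ u → HasCompactSupport u →
    tsupport u ⊆ Ioo (0 : ℝ) 1 ×ˢ univ → ∫ z, opL A b u z ∂(spaceTime κ) = 0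

/-- The initial condition `μ_0 = ν`: `∫ ζ dμ_t → ∫ ζ dν` as `t → 0`, for `ζ ∈ C_0^∞(ℝ^d)`. -/
def HasInitialCondition {d : ℕ} (κ : Kernel ℝ (Space d)) (ν : Measure (Space d)) : Prop :=
  ∀ ζ : Space d → ℝ, ContDiff ℝ ∞ ζ → HasCompactSupport ζ →
    Tendsto (fun t => ∫ x, ζ x ∂(κ t)) (𝓝[>] (0 : ℝ)) (𝓝 (∫ x, ζ x ∂ν))

/-- `ν = ρ₀ dx` with `ρ₀ ln ρ₀ ∈ L¹(ℝ^d)`, where `0 ln 0 = 0` (as for `Real.log`). -/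
def HasFiniteEntropy {d : ℕ} (ν : Measure (Space d)) : Prop :=
  ∃ ρ₀ : Space d → ℝ, Measurable ρ₀ ∧ (∀ x, 0 ≤ ρ₀ x) ∧
    ν = volume.withDensity (fun x => ENNReal.ofReal (ρ₀ x)) ∧
    Integrable (fun x => ρ₀ x * Real.log (ρ₀ x)) volume

/-- `Λ(x) = ln max(|x|, 1)`. -/
noncomputable def logMax {d : ℕ} (x : Space d) : ℝ := Real.log (max ‖x‖ 1)

/-- `f` belongs to `W^{1,1}_loc(ℝ^d)` and `g` is its generalized gradient: both are locally
integrable and `∫ f ∂_i φ dx = - ∫ g_i φ dx` for all `φ ∈ C_0^∞(ℝ^d)`. -/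
structure HasWeakGradient {d : ℕ} (f : Space d → ℝ) (g : Space d → Space d) : Prop where
  locallyIntegrable : LocallyIntegrable f volume
  locallyIntegrable_grad : LocallyIntegrable g volume
  integral_eq : ∀ φ : Space d → ℝ, ContDiff ℝ ∞ φ → HasCompactSupport φ → ∀ i : Fin d,
    ∫ x, f x * fderiv ℝ φ x (EuclideanSpace.single i 1) = - ∫ x, g x i * φ x

/-- Membership in `L^{p,q}([0,τ] × ℝ^d)`, for `1 ≤ p, q < ∞`. -/
def MemMixedLp {d : ℕ} (p q τ : ℝ) (f : ℝ × Space d → ℝ) : Prop :=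
  AEStronglyMeasurable f ((volume.restrict (Icc 0 τ)).prod volume) ∧
  (∫⁻ t in Icc 0 τ, eLpNorm (fun x => f (t, x)) (ENNReal.ofReal p) volume ^ q) ^ (1 / q) < ⊤

/-- Membership in `ℍ^{p,q}([0,τ] × ℝ^d)`, for `1 ≤ p, q < ∞`: the functions `f(t, ·)` are in
`W^{p,1}(ℝ^d)` (integrability `p`, one derivative) for almost all `t ∈ [0,τ]`, and
`t ↦ ‖f(t, ·)‖_p + ‖∇f(t, ·)‖_p` has a finite `L^q[0,τ]`-norm. -/
def MemMixedSobolev {d : ℕ} (p q τ : ℝ) (f : ℝ × Space d → ℝ) : Prop :=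
  AEStronglyMeasurable f ((volume.restrict (Icc 0 τ)).prod volume) ∧
  ∃ g : ℝ × Space d → Space d,
    AEStronglyMeasurable g ((volume.restrict (Icc 0 τ)).prod volume) ∧
    (∀ᵐ t ∂(volume.restrict (Icc 0 τ)),
      HasWeakGradient (fun x => f (t, x)) (fun x => g (t, x))) ∧
    (∫⁻ t in Icc 0 τ, (eLpNorm (fun x => f (t, x)) (ENNReal.ofReal p) volume +
      eLpNorm (fun x => g (t, x)) (ENNReal.ofReal p) volume) ^ q) ^ (1 / q) < ⊤

/-- `∫_0^τ ∫ |∇ρ|² / ρ dx dt`, where `G` is the spatial gradient of `ρ` and the integrand is `0`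
where `ρ = 0` (which is the value of division by zero). -/
noncomputable def fisher {d : ℕ} (ρ : ℝ × Space d → ℝ) (G : ℝ × Space d → Space d)
    (τ : ℝ) : ℝ≥0∞ :=
  ∫⁻ t in Icc 0 τ, ∫⁻ x, ENNReal.ofReal (‖G (t, x)‖ ^ 2 / ρ (t, x))

/-- The integrals `∫ ρ(t, x) Λ(x) dx` stay bounded as `t → 1`. Since `ρ(t, ·)` is determined for
almost all `t` only, this refers to almost all `t` close to `1`. -/
def LogMomentsBounded {d : ℕ} (ρ : ℝ × Space d → ℝ) : Prop :=
  ∃ C : ℝ≥0, ∃ t₀ : ℝ, t₀ < 1 ∧ ∀ᵐ t ∂(volume.restrict (Ioo t₀ 1)),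
    ∫⁻ x, ENNReal.ofReal (ρ (t, x) * logMax x) ≤ C

end ParabolicMeasure

open ParabolicMeasure

/-! Part (a) is a moment estimate. The smooth function ℓ = `logBracket 1` = ln(1 + |x|²) is
comparable to Λ up to constants, and both ℓ and ℓ² have bounded first and second derivatives. The
operator applied to them is therefore O(1 + |b|), which is μ-integrable, and the moments of μ_t and
μ_0 control each other up to an additive constant (`exists_moment_bound`).

Part (b) is the dissipation of relative entropy, carried out on mollifications u = N * μ_t with N =
`moll r`, relative to h = `weight`. The kernel is a power of 1 + r²|x|² because its derivatives are
then dominated by the kernel itself: |∇N| ≤ C r N, and |x||∇N| ≤ C N with C free of r.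
Differentiating ∫ u ln(u/h) dx in time and integrating by parts produces -∫ u⟨A∇ln(u/h), ∇ln(u/h)⟩
plus terms linear in the gradient. Replacing A(y) by A(x) costs λ|x - y||∇N| ≤ CλN, uniformly in r,
and the drift is absorbed by Young's inequality (`frozenFlux_le`, `integral_logRatio_mul_le`).

The reference h has two purposes. It keeps the entropy bounded below, since u ln(u/h) + h ≥ u; and a
bound u ≥ c h gives ln(u/h) = O(1 + ℓ) at fixed r, so that the entropy rate is dominated by (1 +
ℓ)(1 + |b|), integrable because Λ and |b| are in L²(μ). The outcome, `exists_entropy_bound`, is a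
bound uniform in r of the entropy at almost every time and of the Fisher information over all of
(0,1).

As r → ∞ the entropy bound forces μ_t ≪ dx (`absolutelyContinuous_of_entropy_le`). The Fisher bound
gives |∫ ∂_iφ dμ| ≤ √C ‖φ‖ in L²(μ), and Riesz representation yields β ∈ L²(μ) with ∇ρ = ρβ
(`exists_logarithmic_gradient`), hence |∇ρ|²/ρ = ρ|β|². Integrability of ρ follows from Sobolev
inequalities for √u; in the plane the embedding of W^{1,1} in L² is iterated on powers of √u.

For (c), the bound of ∫|β|² dμ already extends up to time 1, and the logarithmic moments are bounded
on the whole interval. -/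

namespace ParabolicMeasure

/-- The partial derivative `∂_{x_i} f` of a function on `ℝ^d`. -/
noncomputable def pd {d : ℕ} (i : Fin d) (f : Space d → ℝ) (x : Space d) : ℝ :=
  fderiv ℝ f x (EuclideanSpace.single i 1)

/-- The function `ln (1 + r² |x|²)`. -/
noncomputable def logBracket {d : ℕ} (r : ℝ) (x : Space d) : ℝ := Real.log (1 + r ^ 2 * ‖x‖ ^ 2)

/-- The gradient of `logBracket r`. -/
noncomputable def gradLog {d : ℕ} (r : ℝ) (x : Space d) : Space d :=
  (2 * r ^ 2 / (1 + r ^ 2 * ‖x‖ ^ 2)) • x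

/-- The Hessian of `logBracket r`. -/
noncomputable def hessLog {d : ℕ} (r : ℝ) (i j : Fin d) (x : Space d) : ℝ :=
  2 * r ^ 2 / (1 + r ^ 2 * ‖x‖ ^ 2) * (if i = j then 1 else 0) - gradLog r x i * gradLog r x j

/-! ### The smooth logarithmic weight ln(1 + r²|x|²) and its derivatives -/

section LogBracket
variable {d : ℕ}

lemma bracket_pos (r : ℝ) (x : Space d) : 0 < 1 + r ^ 2 * ‖x‖ ^ 2 := by positivity

lemma contDiff_logBracket (r : ℝ) : ContDiff ℝ ∞ (logBracket r : Space d → ℝ) := by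
  unfold logBracket
  exact ContDiff.log (contDiff_const.add (contDiff_const.mul (contDiff_norm_sq ℝ)))
    fun x => (bracket_pos r x).ne'

lemma contDiff_gradLog (r : ℝ) : ContDiff ℝ ∞ (gradLog r : Space d → Space d) := by
  unfold gradLog
  exact (contDiff_const.div (contDiff_const.add (contDiff_const.mul (contDiff_norm_sq ℝ)))
    fun x => (bracket_pos r x).ne').smul contDiff_id

lemma contDiff_gradLog_apply (r : ℝ) (j : Fin d) : ContDiff ℝ ∞ (fun x => gradLog r x j) :=
  (contDiff_euclidean.1 (contDiff_gradLog r)) j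

lemma hasFDerivAt_bracket (r : ℝ) (x : Space d) :
    HasFDerivAt (fun x : Space d => 1 + r ^ 2 * ‖x‖ ^ 2) ((2 * r ^ 2) • innerSL ℝ x) x := by
  have h := ((hasStrictFDerivAt_norm_sq x).hasFDerivAt.const_mul (r ^ 2)).const_add 1
  refine h.congr_fderiv ?_
  ext y; simp; ring

lemma hasFDerivAt_logBracket (r : ℝ) (x : Space d) :
    HasFDerivAt (logBracket r) (innerSL ℝ (gradLog r x)) x := by
  have h := (hasFDerivAt_bracket r x).log (bracket_pos r x).ne'
  refine h.congr_fderiv ?_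
  ext y; simp [gradLog]; ring

lemma hasFDerivAt_gradLog_apply (r : ℝ) (j : Fin d) (x : Space d) :
    HasFDerivAt (fun x => gradLog r x j)
      ((2 * r ^ 2 / (1 + r ^ 2 * ‖x‖ ^ 2)) • EuclideanSpace.proj (𝕜 := ℝ) j
        - (gradLog r x j) • innerSL ℝ (gradLog r x)) x := by
  have hs := (bracket_pos r x).ne'
  have h1 := ((hasDerivAt_inv hs).comp_hasFDerivAt x (hasFDerivAt_bracket r x)).const_mul (2 * r ^ 2)
  have h2 : HasFDerivAt (fun x : Space d => x j) (EuclideanSpace.proj (𝕜 := ℝ) j) x :=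
    (EuclideanSpace.proj (𝕜 := ℝ) j : Space d →L[ℝ] ℝ).hasFDerivAt
  have h := h1.mul h2
  refine (h.congr_fderiv ?_).congr_of_eventuallyEq (Eventually.of_forall fun y => ?_)
  · ext y
    simp [gradLog]
    field_simp
    ring
  · simp [gradLog, div_eq_mul_inv]

lemma pd_logBracket (r : ℝ) (j : Fin d) (x : Space d) : pd j (logBracket r) x = gradLog r x j := by
  rw [pd, (hasFDerivAt_logBracket r x).fderiv]
  simp [EuclideanSpace.inner_single_right]

lemma pd_gradLog (r : ℝ) (i j : Fin d) (x : Space d) :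
    pd i (fun x => gradLog r x j) x = hessLog r i j x := by
  rw [pd, (hasFDerivAt_gradLog_apply r j x).fderiv]
  simp [EuclideanSpace.inner_single_right, hessLog, mul_comm, eq_comm]

lemma logBracket_nonneg (r : ℝ) (x : Space d) : 0 ≤ logBracket r x :=
  Real.log_nonneg (by nlinarith [sq_nonneg (r * ‖x‖)])

lemma norm_gradLog_eq (r : ℝ) (x : Space d) :
    ‖gradLog r x‖ = 2 * r ^ 2 * ‖x‖ / (1 + r ^ 2 * ‖x‖ ^ 2) := by
  rw [gradLog, norm_smul, Real.norm_of_nonneg (by positivity)]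
  ring

/-- This is 2r|x| ≤ 1 + r²|x|². The bound grows with r and is used only where r is fixed or equal to
1. -/
lemma norm_gradLog_le {r : ℝ} (hr : 0 ≤ r) (x : Space d) : ‖gradLog r x‖ ≤ r := by
  rw [norm_gradLog_eq, div_le_iff₀ (bracket_pos r x)]
  nlinarith [sq_nonneg (r * ‖x‖ - 1), mul_nonneg hr (sq_nonneg (r * ‖x‖ - 1))]

/-- Scale invariant, hence free of r; the uniform treatment of the Lipschitz coefficient rests on
it. -/
lemma norm_mul_norm_gradLog_le (r : ℝ) (x : Space d) : ‖x‖ * ‖gradLog r x‖ ≤ 2 := by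
  rw [norm_gradLog_eq, ← mul_div_assoc, div_le_iff₀ (bracket_pos r x)]
  nlinarith

lemma abs_apply_le_norm (x : Space d) (i : Fin d) : |x i| ≤ ‖x‖ := by
  simpa using PiLp.norm_apply_le x i

lemma abs_hessLog_le {r : ℝ} (hr : 0 ≤ r) (i j : Fin d) (x : Space d) :
    |hessLog r i j x| ≤ 3 * r ^ 2 := by
  have h1 : |2 * r ^ 2 / (1 + r ^ 2 * ‖x‖ ^ 2) * (if i = j then (1 : ℝ) else 0)| ≤ 2 * r ^ 2 := by
    rw [abs_mul, abs_of_nonneg (by positivity)]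
    have : 2 * r ^ 2 / (1 + r ^ 2 * ‖x‖ ^ 2) ≤ 2 * r ^ 2 :=
      div_le_self (by positivity) (by nlinarith [sq_nonneg (r * ‖x‖)])
    split_ifs <;> simp <;> nlinarith [sq_nonneg r]
  have h2 : |gradLog r x i * gradLog r x j| ≤ r ^ 2 := by
    rw [abs_mul, sq]
    exact mul_le_mul ((abs_apply_le_norm _ i).trans (norm_gradLog_le hr x))
      ((abs_apply_le_norm _ j).trans (norm_gradLog_le hr x)) (abs_nonneg _) hr
  calc _ ≤ _ := abs_sub _ _
    _ ≤ 3 * r ^ 2 := by linarith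

lemma logBracket_le_two_mul_sqrt (x : Space d) : logBracket 1 x ≤ 2 * √(1 + ‖x‖ ^ 2) := by
  have h : (0 : ℝ) < √(1 + ‖x‖ ^ 2) := by positivity
  have := Real.log_le_sub_one_of_pos h
  rw [Real.log_sqrt (by positivity)] at this
  simp only [logBracket]
  norm_num
  linarith

/-- The logarithm is at most 2√(1 + |x|²) while the gradient is at most 2/√(1 + |x|²). This and the
analogue for the Hessian let the square of the logarithm have bounded derivatives too. -/
lemma logBracket_mul_norm_gradLog_le (x : Space d) : logBracket 1 x * ‖gradLog 1 x‖ ≤ 4 := by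
  rw [norm_gradLog_eq, ← mul_div_assoc, div_le_iff₀ (bracket_pos 1 x)]
  have h1 := logBracket_le_two_mul_sqrt x
  have h0 : (0 : ℝ) ≤ √(1 + ‖x‖ ^ 2) := by positivity
  have h2 : ‖x‖ ≤ √(1 + ‖x‖ ^ 2) := Real.le_sqrt_of_sq_le (by linarith)
  have h3 : √(1 + ‖x‖ ^ 2) ^ 2 = 1 + ‖x‖ ^ 2 := Real.sq_sqrt (by positivity)
  have h4 := mul_le_mul h1 h2 (norm_nonneg _) (by positivity)
  norm_num
  nlinarith

lemma logBracket_mul_abs_hessLog_le (i j : Fin d) (x : Space d) :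
    logBracket 1 x * |hessLog 1 i j x| ≤ 6 := by
  have h1 : logBracket 1 x * |2 * 1 ^ 2 / (1 + 1 ^ 2 * ‖x‖ ^ 2) * (if i = j then (1 : ℝ) else 0)|
      ≤ 2 := by
    have hl : logBracket 1 x ≤ 1 + 1 ^ 2 * ‖x‖ ^ 2 := by
      have := Real.log_le_sub_one_of_pos (bracket_pos 1 x)
      simp only [logBracket]; linarith
    have : logBracket 1 x * (2 * 1 ^ 2 / (1 + 1 ^ 2 * ‖x‖ ^ 2)) ≤ 2 := by
      rw [← mul_div_assoc, div_le_iff₀ (bracket_pos 1 x)]; linarith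
    rw [abs_mul, abs_of_nonneg (by positivity)]
    split_ifs
    · simpa using this
    · simp
  have h2 : logBracket 1 x * |gradLog 1 x i * gradLog 1 x j| ≤ 4 := by
    have a := logBracket_mul_norm_gradLog_le x
    have b := norm_gradLog_le zero_le_one x
    have hi := abs_apply_le_norm (gradLog 1 x) i
    have hj := abs_apply_le_norm (gradLog 1 x) j
    have hl := logBracket_nonneg 1 x
    rw [abs_mul]
    calc _ ≤ logBracket 1 x * (‖gradLog 1 x‖ * 1) := by gcongr; exact hj.trans b
      _ ≤ 4 := by linarith
  have := mul_le_mul_of_nonneg_left (abs_sub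
    (2 * 1 ^ 2 / (1 + 1 ^ 2 * ‖x‖ ^ 2) * (if i = j then (1 : ℝ) else 0))
    (gradLog 1 x i * gradLog 1 x j)) (logBracket_nonneg 1 x)
  rw [hessLog]
  linarith

/-- Logarithm of 1 + |x|² ≤ 2(1 + |y|²)(1 + |x - y|²). It transfers logarithmic moments from a
measure to its mollification. -/
lemma logBracket_le_add (x y : Space d) :
    logBracket 1 x ≤ logBracket 1 y + logBracket 1 (x - y) + Real.log 2 := by
  simp only [logBracket]
  rw [← Real.log_mul (by positivity) (by positivity), ← Real.log_mul (by positivity) (by positivity)]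
  apply Real.log_le_log (by positivity)
  have h : ‖x‖ ≤ ‖y‖ + ‖x - y‖ := by simpa using norm_add_le y (x - y)
  have h2 : ‖x‖ ^ 2 ≤ (‖y‖ + ‖x - y‖) ^ 2 := by gcongr
  nlinarith [sq_nonneg (‖y‖ - ‖x - y‖), mul_nonneg (sq_nonneg ‖y‖) (sq_nonneg ‖x - y‖)]

lemma logMax_nonneg (x : Space d) : 0 ≤ logMax x := Real.log_nonneg (le_max_right _ _)

/-- With the reverse estimate below, Λ may be exchanged for the smooth weight in every moment
condition. -/
lemma logMax_le_logBracket (x : Space d) : logMax x ≤ logBracket 1 x := by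
  apply Real.log_le_log (by positivity)
  apply max_le <;> nlinarith [sq_nonneg (‖x‖ - 1 / 2)]

lemma logBracket_le_logMax (x : Space d) : logBracket 1 x ≤ 2 * logMax x + Real.log 2 := by
  have h : (2 : ℝ) * logMax x + Real.log 2 = Real.log ((max ‖x‖ 1) ^ 2 * 2) := by
    rw [Real.log_mul (by positivity) (by positivity), Real.log_pow]; rfl
  rw [h]
  apply Real.log_le_log (by positivity)
  have h1 : ‖x‖ ^ 2 ≤ (max ‖x‖ 1) ^ 2 := by gcongr; exact le_max_left _ _
  have h2 : (1 : ℝ) ^ 2 ≤ (max ‖x‖ 1) ^ 2 := by gcongr; exact le_max_right _ _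
  linarith

end LogBracket

/-! ### The mollifying kernel with polynomial tails -/

section Mollifier
variable {d : ℕ}

/-- Twice the decay rate of the mollifying kernel. -/
noncomputable def decay (d : ℕ) : ℝ := d + 2

/-- The weight `(1 + |x|²)^{-(d+2)}`. -/
noncomputable def weight {d : ℕ} (x : Space d) : ℝ := Real.exp (-(decay d * logBracket 1 x))

/-- The normalized probability density `c r^d (1 + r² |x|²)^{-(d+2)}`. -/
noncomputable def moll {d : ℕ} (r : ℝ) (x : Space d) : ℝ :=
  (∫ z : Space d, weight z)⁻¹ * r ^ d * Real.exp (-(decay d * logBracket r x))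

lemma decay_pos (d : ℕ) : 0 < decay d := by unfold decay; positivity

lemma weight_pos (x : Space d) : 0 < weight x := Real.exp_pos _

lemma log_weight (x : Space d) : Real.log (weight x) = -(decay d * logBracket 1 x) := Real.log_exp _

lemma continuous_logBracket (r : ℝ) : Continuous (logBracket r : Space d → ℝ) :=
  (contDiff_logBracket r).continuous

lemma continuous_weight : Continuous (weight : Space d → ℝ) :=
  Real.continuous_exp.comp ((continuous_const.mul (continuous_logBracket 1)).neg)

lemma weight_eq_rpow (x : Space d) : weight x = (1 + ‖x‖ ^ 2) ^ (-(2 * decay d) / 2) := by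
  rw [weight, logBracket, Real.rpow_def_of_pos (by positivity)]
  congr 1
  norm_num
  ring

lemma integrable_weight : Integrable (weight : Space d → ℝ) := by
  have := integrable_rpow_neg_one_add_norm_sq (E := Space d) (μ := volume) (r := 2 * decay d)
    (by simp [decay]; linarith)
  exact this.congr (Eventually.of_forall fun x => (weight_eq_rpow x).symm)

/-- Bounding the logarithm by 1 + |x|² costs two powers of |x|, and the remaining decay 2(d + 2) - 2
still exceeds d. -/
lemma integrable_logBracket_mul_weight :
    Integrable (fun x : Space d => logBracket 1 x * weight x) := by
  have := integrable_rpow_neg_one_add_norm_sq (E := Space d) (μ := volume) (r := 2 * decay d - 2)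
    (by simp [decay]; linarith)
  refine this.mono' ((continuous_logBracket 1).mul continuous_weight).aestronglyMeasurable
    (Eventually.of_forall fun x => ?_)
  rw [Real.norm_of_nonneg (mul_nonneg (logBracket_nonneg 1 x) (weight_pos x).le), weight_eq_rpow]
  have hl : logBracket 1 x ≤ (1 + ‖x‖ ^ 2) ^ (1 : ℝ) := by
    have := Real.log_le_sub_one_of_pos (bracket_pos 1 x)
    simp only [logBracket] at *; norm_num at *; linarith
  calc _ ≤ (1 + ‖x‖ ^ 2) ^ (1 : ℝ) * (1 + ‖x‖ ^ 2) ^ (-(2 * decay d) / 2) := by gcongr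
    _ = _ := by rw [← Real.rpow_add (by positivity)]; congr 1; ring

lemma integral_weight_pos : 0 < ∫ z : Space d, weight z := by
  rw [integral_pos_iff_support_of_nonneg (fun x => (weight_pos x).le) integrable_weight]
  have : Function.support (weight : Space d → ℝ) = univ := by
    ext x; simp [(weight_pos x).ne']
  simp [this, NeZero.pos]

lemma moll_pos {r : ℝ} (hr : 0 < r) (x : Space d) : 0 < moll r x := by
  have := integral_weight_pos (d := d)
  unfold moll
  positivity

lemma logBracket_smul (r : ℝ) (x : Space d) : logBracket 1 (r • x) = logBracket r x := by
  simp [logBracket, norm_smul, mul_pow]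

lemma moll_eq (r : ℝ) (x : Space d) :
    moll r x = (∫ z : Space d, weight z)⁻¹ * r ^ d * weight (r • x) := by
  rw [moll, weight, logBracket_smul]

lemma moll_neg (r : ℝ) (x : Space d) : moll r (-x) = moll r x := by simp [moll, logBracket]

lemma moll_le {r : ℝ} (hr : 0 < r) (x : Space d) :
    moll r x ≤ (∫ z : Space d, weight z)⁻¹ * r ^ d := by
  have := integral_weight_pos (d := d)
  unfold moll
  refine mul_le_of_le_one_right (by positivity) (Real.exp_le_one_iff.2 ?_)
  have := mul_nonneg (decay_pos d).le (logBracket_nonneg r x)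
  linarith

/-- Integration against the scaled kernel. -/
lemma integral_mul_moll {r : ℝ} (hr : 0 < r) (f : Space d → ℝ) :
    ∫ x, f x * moll r x = ∫ z, f (r⁻¹ • z) * moll 1 z := by
  have h := Measure.integral_comp_smul (volume : Measure (Space d))
    (fun z => f (r⁻¹ • z) * moll 1 z) r
  have e : ∀ x : Space d, f (r⁻¹ • r • x) * moll 1 (r • x) = (r ^ d)⁻¹ * (f x * moll r x) := by
    intro x
    rw [smul_smul, inv_mul_cancel₀ hr.ne', one_smul, moll_eq, moll_eq]
    simp
    field_simp
  simp only [e, finrank_euclideanSpace, Fintype.card_fin, smul_eq_mul] at h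
  rw [abs_of_pos (by positivity), integral_const_mul] at h
  exact mul_left_cancel₀ (by positivity) h

lemma integrable_mul_moll_iff {r : ℝ} (hr : 0 < r) (f : Space d → ℝ) :
    Integrable (fun x => f x * moll r x) ↔ Integrable (fun z => f (r⁻¹ • z) * moll 1 z) := by
  have h := integrable_comp_smul_iff (volume : Measure (Space d))
    (fun z => f (r⁻¹ • z) * moll 1 z) hr.ne'
  rw [← h]
  have e : (fun x : Space d => f (r⁻¹ • r • x) * moll 1 (r • x))
      = fun x => (r ^ d)⁻¹ * (f x * moll r x) := by
    ext x
    rw [smul_smul, inv_mul_cancel₀ hr.ne', one_smul, moll_eq, moll_eq]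
    simp
    field_simp
  rw [e, integrable_const_mul_iff (isUnit_iff_ne_zero.2 (by positivity))]

lemma moll_one (x : Space d) : moll 1 x = (∫ z : Space d, weight z)⁻¹ * weight x := by
  simp [moll_eq]

lemma integrable_moll {r : ℝ} (hr : 0 < r) : Integrable (moll r : Space d → ℝ) := by
  have := (integrable_mul_moll_iff (d := d) hr (fun _ => 1)).2
    (by simpa [moll_one] using integrable_weight.const_mul _)
  simpa using this

lemma integral_moll {r : ℝ} (hr : 0 < r) : ∫ x : Space d, moll r x = 1 := by
  have := integral_mul_moll (d := d) hr (fun _ => 1)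
  simp only [one_mul] at this
  rw [this]
  simp only [moll_one]
  rw [integral_const_mul, inv_mul_cancel₀ integral_weight_pos.ne']

lemma logBracket_inv_smul_le {r : ℝ} (hr : 1 ≤ r) (x : Space d) :
    logBracket 1 (r⁻¹ • x) ≤ logBracket 1 x := by
  rw [logBracket_smul]
  apply Real.log_le_log (by positivity)
  have : (r⁻¹) ^ 2 ≤ 1 := by
    rw [inv_pow]; exact inv_le_one_of_one_le₀ (one_le_pow₀ hr)
  nlinarith [mul_le_mul_of_nonneg_right this (sq_nonneg ‖x‖)]

lemma integrable_logBracket_mul_moll {r : ℝ} (hr : 1 ≤ r) :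
    Integrable (fun x : Space d => logBracket 1 x * moll r x) := by
  rw [integrable_mul_moll_iff (by linarith)]
  have h : Integrable (fun x : Space d => logBracket 1 x * moll 1 x) := by
    simp only [moll_one]
    exact (integrable_logBracket_mul_weight.const_mul (∫ z : Space d, weight z)⁻¹).congr
      (Eventually.of_forall fun x => by simp only; ring)
  refine h.mono' ?_ (Eventually.of_forall fun x => ?_)
  · refine (((continuous_logBracket 1).comp (continuous_const_smul r⁻¹)).mul
      ?_).aestronglyMeasurable
    simp only [funext moll_one]
    exact continuous_const.mul continuous_weight
  · rw [Real.norm_of_nonneg (mul_nonneg (logBracket_nonneg 1 _) (moll_pos one_pos x).le)]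
    exact mul_le_mul_of_nonneg_right (logBracket_inv_smul_le hr x) (moll_pos one_pos x).le

/-- The first logarithmic moment of `moll 1`, up to an additive constant. -/
noncomputable def mollMoment (d : ℕ) : ℝ :=
  ∫ x : Space d, logBracket 1 x * moll 1 x

lemma integral_logBracket_mul_moll_le {r : ℝ} (hr : 1 ≤ r) :
    ∫ x : Space d, logBracket 1 x * moll r x ≤ mollMoment d := by
  have hr0 : 0 < r := by linarith
  rw [integral_mul_moll hr0]
  refine integral_mono ((integrable_mul_moll_iff hr0 _).1 (integrable_logBracket_mul_moll hr))
    (integrable_logBracket_mul_moll le_rfl) fun x => ?_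
  exact mul_le_mul_of_nonneg_right (logBracket_inv_smul_le hr x) (moll_pos one_pos x).le

lemma contDiff_moll (r : ℝ) : ContDiff ℝ ∞ (moll r : Space d → ℝ) := by
  unfold moll
  exact contDiff_const.mul (contDiff_const.mul (contDiff_logBracket r)).neg.exp

lemma continuous_moll (r : ℝ) : Continuous (moll r : Space d → ℝ) := (contDiff_moll r).continuous

/-- The gradient of `moll r`. -/
noncomputable def gradMoll {d : ℕ} (r : ℝ) (x : Space d) : Space d :=
  -(decay d * moll r x) • gradLog r x

/-- The Hessian of `moll r`. -/
noncomputable def hessMoll {d : ℕ} (r : ℝ) (i j : Fin d) (x : Space d) : ℝ :=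
  (decay d ^ 2 * (gradLog r x i * gradLog r x j) - decay d * hessLog r i j x) * moll r x

lemma hasFDerivAt_moll (r : ℝ) (x : Space d) :
    HasFDerivAt (moll r) (innerSL ℝ (gradMoll r x)) x := by
  have h := ((((hasFDerivAt_logBracket r x).const_mul (decay d)).neg).exp).const_mul
    ((∫ z : Space d, weight z)⁻¹ * r ^ d)
  refine h.congr_fderiv ?_
  ext y
  simp [gradMoll, moll]
  ring

lemma pd_moll (r : ℝ) (j : Fin d) (x : Space d) : pd j (moll r) x = gradMoll r x j := by
  rw [pd, (hasFDerivAt_moll r x).fderiv]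
  simp [EuclideanSpace.inner_single_right]

lemma gradMoll_apply (r : ℝ) (j : Fin d) (x : Space d) :
    gradMoll r x j = -(decay d * moll r x) * gradLog r x j := by
  simp [gradMoll]

lemma hasFDerivAt_gradMoll_apply (r : ℝ) (j : Fin d) (x : Space d) :
    HasFDerivAt (fun x => gradMoll r x j)
      (-(decay d * moll r x) • ((2 * r ^ 2 / (1 + r ^ 2 * ‖x‖ ^ 2)) • EuclideanSpace.proj (𝕜 := ℝ) j
        - (gradLog r x j) • innerSL ℝ (gradLog r x)) +
        (gradLog r x j) • (-(decay d • innerSL ℝ (gradMoll r x)))) x := by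
  simp only [gradMoll_apply]
  exact (((hasFDerivAt_moll r x).const_mul (decay d)).neg).mul (hasFDerivAt_gradLog_apply r j x)

lemma pd_gradMoll (r : ℝ) (i j : Fin d) (x : Space d) :
    pd i (fun x => gradMoll r x j) x = hessMoll r i j x := by
  rw [pd, (hasFDerivAt_gradMoll_apply r j x).fderiv]
  by_cases h : i = j
  · subst h
    simp [EuclideanSpace.inner_single_right, hessMoll, hessLog, gradMoll_apply]
    ring
  · simp [EuclideanSpace.inner_single_right, hessMoll, hessLog, gradMoll_apply, h, Ne.symm h]
    ring

/-- Since the kernel is exp(-(d + 2) ln(1 + r²|x|²)) up to a constant and the exponent has bounded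
gradient, the derivative is dominated by the kernel itself. Neither a Gaussian nor a compactly
supported kernel has this property. -/
lemma norm_gradMoll_le {r : ℝ} (hr : 0 < r) (x : Space d) :
    ‖gradMoll r x‖ ≤ decay d * r * moll r x := by
  rw [gradMoll, norm_smul, norm_neg, Real.norm_of_nonneg (mul_nonneg (decay_pos d).le (moll_pos hr x).le)]
  have := mul_le_mul_of_nonneg_left (norm_gradLog_le hr.le x)
    (mul_nonneg (decay_pos d).le (moll_pos hr x).le)
  linarith

/-- No power of r appears. Paired with |a(y) - a(x)| ≤ λ|x - y|, this makes the error of freezing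
the coefficient uniform in the mollification. -/
lemma norm_mul_norm_gradMoll_le {r : ℝ} (hr : 0 < r) (x : Space d) :
    ‖x‖ * ‖gradMoll r x‖ ≤ 2 * decay d * moll r x := by
  rw [gradMoll, norm_smul, norm_neg, Real.norm_of_nonneg (mul_nonneg (decay_pos d).le (moll_pos hr x).le)]
  have := mul_le_mul_of_nonneg_left (norm_mul_norm_gradLog_le r x)
    (mul_nonneg (decay_pos d).le (moll_pos hr x).le)
  linarith

lemma abs_hessMoll_le {r : ℝ} (hr : 0 < r) (i j : Fin d) (x : Space d) :
    |hessMoll r i j x| ≤ (decay d ^ 2 + 3 * decay d) * r ^ 2 * moll r x := by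
  rw [hessMoll, abs_mul, abs_of_pos (moll_pos hr x)]
  refine mul_le_mul_of_nonneg_right ?_ (moll_pos hr x).le
  have h2 : |gradLog r x i * gradLog r x j| ≤ r ^ 2 := by
    rw [abs_mul, sq]
    exact mul_le_mul ((abs_apply_le_norm _ i).trans (norm_gradLog_le hr.le x))
      ((abs_apply_le_norm _ j).trans (norm_gradLog_le hr.le x)) (abs_nonneg _) hr.le
  have h3 := abs_hessLog_le hr.le i j x
  have hd := decay_pos d
  calc _ ≤ |decay d ^ 2 * (gradLog r x i * gradLog r x j)| + |decay d * hessLog r i j x| :=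
        abs_sub _ _
    _ = decay d ^ 2 * |gradLog r x i * gradLog r x j| + decay d * |hessLog r i j x| := by
        rw [abs_mul, abs_mul _ (hessLog _ _ _ _), abs_of_pos hd, abs_of_pos (pow_pos hd 2)]
    _ ≤ decay d ^ 2 * r ^ 2 + decay d * (3 * r ^ 2) := by gcongr
    _ = _ := by ring

lemma continuous_gradMoll (r : ℝ) : Continuous (gradMoll r : Space d → Space d) :=
  (continuous_const.mul (continuous_moll r)).neg.smul (contDiff_gradLog r).continuous

lemma continuous_hessMoll (r : ℝ) (i j : Fin d) : Continuous (hessMoll r i j : Space d → ℝ) := by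
  have h1 := (contDiff_gradLog_apply (d := d) r i).continuous
  have h2 := (contDiff_gradLog_apply (d := d) r j).continuous
  have h3 : Continuous (hessLog r i j : Space d → ℝ) := by
    unfold hessLog
    exact ((continuous_const.div (by fun_prop) fun x => (bracket_pos r x).ne').mul
      continuous_const).sub (h1.mul h2)
  exact ((continuous_const.mul (h1.mul h2)).sub (continuous_const.mul h3)).mul (continuous_moll r)

/-- For r ≥ 1 one has 1 + r²|x - y|² ≤ 2r²(1 + |x|²)(1 + |y|²). The resulting product lower bound
for the kernel survives integration in y and gives the mollified density a tail no thinner than the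
weight. -/
lemma weight_mul_weight_le {r : ℝ} (hr : 1 ≤ r) (x y : Space d) :
    weight x * weight y ≤
      Real.exp (decay d * Real.log (2 * r ^ 2)) * Real.exp (-(decay d * logBracket r (x - y))) := by
  have h : logBracket r (x - y) ≤ logBracket 1 x + logBracket 1 y + Real.log (2 * r ^ 2) := by
    simp only [logBracket]
    rw [← Real.log_mul (by positivity) (by positivity),
      ← Real.log_mul (by positivity) (by positivity)]
    apply Real.log_le_log (by positivity)
    have h1 : ‖x - y‖ ^ 2 ≤ (‖x‖ + ‖y‖) ^ 2 := by gcongr; exact norm_sub_le x y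
    have h2 : ‖x - y‖ ^ 2 ≤ 2 * (‖x‖ ^ 2 + ‖y‖ ^ 2) := by nlinarith [sq_nonneg (‖x‖ - ‖y‖)]
    have h3 : 1 ≤ r ^ 2 := one_le_pow₀ hr
    have h4 := mul_le_mul_of_nonneg_left h2 (sq_nonneg r)
    nlinarith [mul_nonneg (sq_nonneg r) (mul_nonneg (sq_nonneg ‖x‖) (sq_nonneg ‖y‖))]
  simp only [weight]
  rw [← Real.exp_add, ← Real.exp_add]
  apply Real.exp_le_exp.2
  have := mul_le_mul_of_nonneg_left h (decay_pos d).le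
  linarith

/-- The constant in the lower bound for the kernel. -/
noncomputable def mollLower (d : ℕ) (r : ℝ) : ℝ :=
  (∫ z : Space d, weight z)⁻¹ * r ^ d * (Real.exp (decay d * Real.log (2 * r ^ 2)))⁻¹

lemma mollLower_pos {r : ℝ} (hr : 0 < r) : 0 < mollLower d r := by
  have := integral_weight_pos (d := d)
  unfold mollLower
  positivity

lemma mollLower_mul_le {r : ℝ} (hr : 1 ≤ r) (x y : Space d) :
    mollLower d r * (weight x * weight y) ≤ moll r (x - y) := by
  have := integral_weight_pos (d := d)
  have h := weight_mul_weight_le hr x y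
  rw [mollLower, moll, mul_assoc]
  gcongr
  rw [inv_mul_le_iff₀ (by positivity)]
  exact h

end Mollifier


/-! ### Distributional derivatives on (0,1) and absolutely continuous versions -/

section DuBoisReymond

/-- The primitive of an integrable function is absolutely continuous with the expected derivative
almost everywhere, so integration by parts applies; the boundary terms vanish with χ. -/
lemma integral_mul_primitive {k χ : ℝ → ℝ} (hk : IntegrableOn k (Ioo (0 : ℝ) 1))
    (hχ : ContDiff ℝ ∞ χ) (h0 : χ 0 = 0) (h1 : χ 1 = 0) :
    ∫ t in Ioo (0 : ℝ) 1, χ t * k t =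
      -∫ t in Ioo (0 : ℝ) 1, deriv χ t * ∫ s in (0 : ℝ)..t, k s := by
  have hki : IntervalIntegrable k volume 0 1 := by
    rw [intervalIntegrable_iff_integrableOn_Ioo_of_le zero_le_one]; exact hk
  have hK := hki.absolutelyContinuousOnInterval_intervalIntegral (c := 0) (by simp)
  have hχ' : AbsolutelyContinuousOnInterval χ 0 1 :=
    (hχ.of_le (by exact_mod_cast le_top)).contDiffOn.absolutelyContinuousOnInterval
  have := AbsolutelyContinuousOnInterval.integral_mul_deriv_eq_deriv_mul hχ' hK
  rw [h0, h1] at this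
  simp only [zero_mul, sub_zero, zero_sub] at this
  have e : ∫ x in (0 : ℝ)..1, χ x * deriv (fun x => ∫ v in (0 : ℝ)..x, k v) x
      = ∫ x in (0 : ℝ)..1, χ x * k x := by
    apply intervalIntegral.integral_congr_ae
    filter_upwards [hki.ae_hasDerivAt_integral] with x hx hx'
    rw [(hx (uIoc_subset_uIcc hx') 0 (by simp)).deriv]
  rw [e] at this
  rw [intervalIntegral.integral_of_le zero_le_one, intervalIntegral.integral_of_le zero_le_one,
    integral_Ioc_eq_integral_Ioo, integral_Ioc_eq_integral_Ioo] at this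
  exact this

/-- A smooth function on `(0,1)` with compact support and vanishing integral has a primitive of
the same kind. -/
lemma exists_primitive_compactSupport {G : ℝ → ℝ} (hG : ContDiff ℝ ∞ G) {a b : ℝ} (ha : 0 < a)
    (hb : b < 1) (hs : ∀ t, t ∉ Icc a b → G t = 0) (hint : ∫ t, G t = 0) :
    ∃ χ : ℝ → ℝ, ContDiff ℝ ∞ χ ∧ HasCompactSupport χ ∧ tsupport χ ⊆ Ioo (0 : ℝ) 1 ∧
      deriv χ = G := by
  have hGi : ∀ x y, IntervalIntegrable G volume x y := fun x y =>
    hG.continuous.intervalIntegrable x y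
  have hd : ∀ t, HasDerivAt (fun t => ∫ s in (0 : ℝ)..t, G s) (G t) t := fun t =>
    intervalIntegral.integral_hasDerivAt_right (hGi _ _)
      (hG.continuous.stronglyMeasurableAtFilter _ _) hG.continuous.continuousAt
  have hder : deriv (fun t => ∫ s in (0 : ℝ)..t, G s) = G := funext fun t => (hd t).deriv
  -- To the left of `a` the integrand vanishes; to the right of `b` the primitive equals the total
  -- integral, which is zero.
  have hz : ∀ t, t ∉ Icc a b → ∫ s in (0 : ℝ)..t, G s = 0 := by
    intro t ht
    rcases lt_or_ge t a with h | h
    · rw [intervalIntegral.integral_congr (g := fun _ => 0)]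
      · simp
      · intro s hs'
        apply hs
        intro hmem
        have : s ≤ max 0 t := hs'.2
        have : max 0 t < a := max_lt ha h
        linarith [hmem.1]
    · have hbt : b < t := by
        by_contra hcon
        exact ht ⟨h, not_lt.1 hcon⟩
      rw [intervalIntegral.integral_eq_integral_of_support_subset, hint]
      intro s hs'
      by_contra hcon
      apply hs'
      apply hs
      intro hmem
      exact hcon ⟨by linarith [hmem.1], by linarith [hmem.2]⟩
  have hsub : tsupport (fun t => ∫ s in (0 : ℝ)..t, G s) ⊆ Icc a b := by
    apply closure_minimal _ isClosed_Icc
    intro t ht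
    by_contra hcon
    exact ht (hz t hcon)
  refine ⟨_, ?_, HasCompactSupport.of_support_subset_isCompact isCompact_Icc
    (subset_closure.trans hsub), hsub.trans fun t ht => ⟨by linarith [ht.1], by linarith [ht.2]⟩,
    hder⟩
  rw [contDiff_infty_iff_deriv, hder]
  exact ⟨fun t => (hd t).differentiableAt, hG⟩

/-- If the distributional derivative of `m` on `(0,1)` is the integrable function `k`, then `m` has
an absolutely continuous version with derivative `k`. -/
lemma ae_eq_const_add_primitive {m k : ℝ → ℝ} (hm : IntegrableOn m (Ioo (0 : ℝ) 1))
    (hk : IntegrableOn k (Ioo (0 : ℝ) 1))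
    (h : ∀ χ : ℝ → ℝ, ContDiff ℝ ∞ χ → HasCompactSupport χ → tsupport χ ⊆ Ioo (0 : ℝ) 1 →
      ∫ t in Ioo (0 : ℝ) 1, (deriv χ t * m t + χ t * k t) = 0) :
    ∃ c : ℝ, ∀ᵐ t ∂(volume.restrict (Ioo (0 : ℝ) 1)), m t = c + ∫ s in (0 : ℝ)..t, k s := by
  have hki : IntervalIntegrable k volume 0 1 := by
    rw [intervalIntegrable_iff_integrableOn_Ioo_of_le zero_le_one]; exact hk
  have hKc : ContinuousOn (fun t => ∫ s in (0 : ℝ)..t, k s) (Icc 0 1) := by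
    have := (hki.absolutelyContinuousOnInterval_intervalIntegral (c := 0) (by simp)).continuousOn
    rwa [uIcc_of_le zero_le_one] at this
  have hKi : IntegrableOn (fun t => ∫ s in (0 : ℝ)..t, k s) (Ioo (0 : ℝ) 1) :=
    (hKc.integrableOn_Icc).mono_set Ioo_subset_Icc_self
  -- The difference `w` has vanishing distributional derivative, so it has to be constant almost
  -- everywhere.
  set w : ℝ → ℝ := fun t => m t - ∫ s in (0 : ℝ)..t, k s with hw
  have hwi : IntegrableOn w (Ioo (0 : ℝ) 1) := hm.sub hKi
  have mulInt : ∀ (g f : ℝ → ℝ), Continuous g → HasCompactSupport g →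
      IntegrableOn f (Ioo (0 : ℝ) 1) → IntegrableOn (fun t => g t * f t) (Ioo (0 : ℝ) 1) := by
    intro g f hg hgs hf
    obtain ⟨C, hC⟩ := hgs.exists_bound_of_continuous hg
    exact Integrable.bdd_mul hf hg.aestronglyMeasurable (c := C) (Eventually.of_forall hC)
  have hbase : ∀ χ : ℝ → ℝ, ContDiff ℝ ∞ χ → HasCompactSupport χ → tsupport χ ⊆ Ioo (0 : ℝ) 1 →
      ∫ t in Ioo (0 : ℝ) 1, deriv χ t * w t = 0 := by
    intro χ hχ hχs hχt
    have hz : ∀ t, t ∉ Ioo (0 : ℝ) 1 → χ t = 0 := fun t ht =>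
      image_eq_zero_of_notMem_tsupport fun hcon => ht (hχt hcon)
    have hdc : Continuous (deriv χ) := hχ.continuous_deriv (by exact_mod_cast le_top)
    have e1 := h χ hχ hχs hχt
    have e2 := integral_mul_primitive hk hχ (hz 0 (by simp)) (hz 1 (by simp))
    rw [integral_add (mulInt _ _ hdc hχs.deriv hm) (mulInt _ _ hχ.continuous hχs hk), e2] at e1
    simp only [hw, mul_sub]
    rw [integral_sub (mulInt _ _ hdc hχs.deriv hm) (mulInt _ _ hdc hχs.deriv hKi)]
    linarith
  -- A bump of unit mass inside (0,1): the constant is the mean of `w` against it, and subtracting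
  -- multiples of it gives test functions of zero mean.
  let B : ContDiffBump (1 / 2 : ℝ) := ⟨1 / 8, 1 / 4, by norm_num, by norm_num⟩
  have hBsm : ContDiff ℝ ∞ (B.normed volume) := B.contDiff_normed
  have hBint : ∫ t, B.normed volume t = 1 := B.integral_normed
  have hBs : tsupport (B.normed volume) = Metric.closedBall (1 / 2 : ℝ) (1 / 4) :=
    B.tsupport_normed_eq
  have hBcs : HasCompactSupport (B.normed volume) := B.hasCompactSupport_normed
  set c := ∫ t in Ioo (0 : ℝ) 1, B.normed volume t * w t with hc
  refine ⟨c, ?_⟩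
  have key := IsOpen.ae_eq_zero_of_integral_contDiff_smul_eq_zero (μ := volume)
    (f := fun t => w t - c) (isOpen_Ioo (a := (0 : ℝ)) (b := 1)) ?_ ?_
  · rw [ae_restrict_iff' measurableSet_Ioo]
    filter_upwards [key] with t ht htm
    have := ht htm
    simp only [hw] at this
    linarith
  · exact (hwi.sub (integrableOn_const (by simp) (by simp))).locallyIntegrableOn
  · intro g hg hgs hgt
    have hKK : IsCompact (tsupport g ∪ Metric.closedBall (1 / 2 : ℝ) (1 / 4)) :=
      hgs.isCompact.union (isCompact_closedBall _ _)
    have hne : (tsupport g ∪ Metric.closedBall (1 / 2 : ℝ) (1 / 4)).Nonempty :=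
      ⟨1 / 2, Or.inr (by simp)⟩
    have hsub : (tsupport g ∪ Metric.closedBall (1 / 2 : ℝ) (1 / 4)) ⊆ Ioo 0 1 := by
      apply union_subset hgt
      rw [Real.closedBall_eq_Icc]
      intro t ht
      constructor <;> linarith [ht.1, ht.2]
    obtain ⟨a, ha⟩ := hKK.exists_isLeast hne
    obtain ⟨b, hb⟩ := hKK.exists_isGreatest hne
    -- The zero-mean part of `g` is the derivative of a test function, against which `w` integrates
    -- to zero.
    obtain ⟨χ, hχ, hχs, hχt, hχd⟩ := exists_primitive_compactSupport
      (G := fun t => g t - (∫ s, g s) * B.normed volume t) (hg.sub (contDiff_const.mul hBsm))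
      (hsub ha.1).1 (hsub hb.1).2 (by
        intro t ht
        have ht' : t ∉ tsupport g ∪ Metric.closedBall (1 / 2 : ℝ) (1 / 4) :=
          fun hcon => ht ⟨ha.2 hcon, hb.2 hcon⟩
        rw [image_eq_zero_of_notMem_tsupport fun hcon => ht' (Or.inl hcon),
          image_eq_zero_of_notMem_tsupport fun hcon => ht' (Or.inr (hBs ▸ hcon))]
        simp) (by
        rw [integral_sub (hg.continuous.integrable_of_hasCompactSupport hgs)
          ((hBsm.continuous.integrable_of_hasCompactSupport hBcs).const_mul _),
          integral_const_mul, hBint]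
        ring)
    have e := hbase χ hχ hχs hχt
    rw [hχd] at e
    have i1 := mulInt g w hg.continuous hgs hwi
    have i2 := mulInt _ w hBsm.continuous hBcs hwi
    have e' : ∫ t in Ioo (0 : ℝ) 1, g t * w t = (∫ s, g s) * c := by
      rw [hc, ← integral_const_mul, ← sub_eq_zero, ← integral_sub i1 (i2.const_mul _)]
      refine Eq.trans (integral_congr_ae (Eventually.of_forall fun t => ?_)) e
      simp only
      ring
    have hset : ∫ x, g x • (w x - c) = ∫ x in Ioo (0 : ℝ) 1, g x • (w x - c) := by
      rw [setIntegral_eq_integral_of_forall_compl_eq_zero]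
      intro x hx
      rw [image_eq_zero_of_notMem_tsupport fun hcon => hx (hgt hcon)]
      simp
    have hset2 : ∫ x, g x = ∫ x in Ioo (0 : ℝ) 1, g x := by
      rw [setIntegral_eq_integral_of_forall_compl_eq_zero]
      intro x hx
      rw [image_eq_zero_of_notMem_tsupport fun hcon => hx (hgt hcon)]
    rw [hset]
    simp only [smul_eq_mul, mul_sub]
    rw [integral_sub i1 ((hg.continuous.integrable_of_hasCompactSupport hgs).integrableOn.mul_const c),
      e', integral_mul_const, ← hset2]
    ring

end DuBoisReymond


/-! ### Calculus of partial derivatives -/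

section PartialDerivatives
variable {d : ℕ}

lemma contDiff_pd {f : Space d → ℝ} (hf : ContDiff ℝ ∞ f) (i : Fin d) : ContDiff ℝ ∞ (pd i f) :=
  (hf.fderiv_right (m := ∞) (by simp)).clm_apply contDiff_const

lemma HasCompactSupport.pd {f : Space d → ℝ} (hf : HasCompactSupport f) (i : Fin d) :
    HasCompactSupport (pd i f) :=
  hf.fderiv_apply ℝ _

lemma pd_mul {f g : Space d → ℝ} {x : Space d} (hf : DifferentiableAt ℝ f x)
    (hg : DifferentiableAt ℝ g x) (i : Fin d) :
    pd i (fun x => f x * g x) x = pd i f x * g x + f x * pd i g x := by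
  rw [pd, fderiv_fun_mul hf hg]
  simp [pd]
  ring

lemma pd_add {f g : Space d → ℝ} {x : Space d} (hf : DifferentiableAt ℝ f x)
    (hg : DifferentiableAt ℝ g x) (i : Fin d) :
    pd i (fun x => f x + g x) x = pd i f x + pd i g x := by
  rw [pd, fderiv_fun_add hf hg]
  simp [pd]

lemma pd_comp_smul {f : Space d → ℝ} (hf : Differentiable ℝ f) (c : ℝ) (i : Fin d)
    (x : Space d) : pd i (fun x => f (c • x)) x = c * pd i f (c • x) := by
  have h := (hf (c • x)).hasFDerivAt.comp x ((hasFDerivAt_id x).const_smul c)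
  have h' : HasFDerivAt (fun x => f (c • x)) _ x := h
  rw [pd, h'.fderiv]
  simp [pd]

lemma pd_const_mul {f : Space d → ℝ} {x : Space d} (hf : DifferentiableAt ℝ f x) (c : ℝ)
    (i : Fin d) : pd i (fun x => c * f x) x = c * pd i f x := by
  rw [pd, fderiv_const_mul hf]
  simp [pd]

lemma pd_comp {φ : ℝ → ℝ} {f : Space d → ℝ} {x : Space d} (hφ : DifferentiableAt ℝ φ (f x))
    (hf : DifferentiableAt ℝ f x) (i : Fin d) :
    pd i (fun x => φ (f x)) x = deriv φ (f x) * pd i f x := by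
  have h := hφ.hasDerivAt.comp_hasFDerivAt x hf.hasFDerivAt
  have h' : HasFDerivAt (fun x => φ (f x)) _ x := h
  rw [pd, h'.fderiv]
  simp [pd]

lemma dx_mul {χ : ℝ → ℝ} {ζ : Space d → ℝ} (hχ : Differentiable ℝ χ) (hζ : Differentiable ℝ ζ)
    (i : Fin d) (z : ℝ × Space d) :
    dx i (fun z => χ z.1 * ζ z.2) z = χ z.1 * pd i ζ z.2 := by
  have h1 : HasFDerivAt (fun z : ℝ × Space d => χ z.1) _ z :=
    (hχ z.1).hasFDerivAt.comp z hasFDerivAt_fst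
  have h2 : HasFDerivAt (fun z : ℝ × Space d => ζ z.2) _ z :=
    (hζ z.2).hasFDerivAt.comp z hasFDerivAt_snd
  rw [dx, (h1.fun_mul h2).fderiv]
  simp [pd]

lemma dt_mul {χ : ℝ → ℝ} {ζ : Space d → ℝ} (hχ : Differentiable ℝ χ) (hζ : Differentiable ℝ ζ)
    (z : ℝ × Space d) : dt (fun z => χ z.1 * ζ z.2) z = deriv χ z.1 * ζ z.2 := by
  have h1 : HasFDerivAt (fun z : ℝ × Space d => χ z.1) _ z :=
    (hχ z.1).hasFDerivAt.comp z hasFDerivAt_fst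
  have h2 : HasFDerivAt (fun z : ℝ × Space d => ζ z.2) _ z :=
    (hζ z.2).hasFDerivAt.comp z hasFDerivAt_snd
  rw [dt, (h1.fun_mul h2).fderiv]
  simp [mul_comm]

end PartialDerivatives

/-! ### The evolution of integrals of compactly supported functions -/

section Setting
variable {d : ℕ}

/-- The Lebesgue measure on `(0,1)`. -/
noncomputable abbrev timeMeasure : Measure ℝ := volume.restrict (Ioo (0 : ℝ) 1)

instance : IsProbabilityMeasure timeMeasure := ⟨by simp⟩

instance {κ : Kernel ℝ (Space d)} [IsMarkovKernel κ] : IsProbabilityMeasure (spaceTime κ) := by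
  unfold spaceTime; infer_instance

/-- The spatial part `a^{ij} ∂_i ∂_j ζ + b^i ∂_i ζ` of the operator `L`, applied to a function of `x`
alone. -/
noncomputable def gen (A : ℝ × Space d → Matrix (Fin d) (Fin d) ℝ)
    (b : ℝ × Space d → Space d) (ζ : Space d → ℝ) (z : ℝ × Space d) : ℝ :=
  ∑ i, ∑ j, A z i j * pd i (pd j ζ) z.2 + ∑ i, b z i * pd i ζ z.2

lemma opL_mul (A : ℝ × Space d → Matrix (Fin d) (Fin d) ℝ) (b : ℝ × Space d → Space d)
    {χ : ℝ → ℝ} {ζ : Space d → ℝ} (hχ : Differentiable ℝ χ) (hζ : ContDiff ℝ ∞ ζ)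
    (z : ℝ × Space d) :
    opL A b (fun z => χ z.1 * ζ z.2) z = deriv χ z.1 * ζ z.2 + χ z.1 * gen A b ζ z := by
  have hd : Differentiable ℝ ζ := hζ.differentiable (by simp)
  have h1 : ∀ j, dx j (fun z : ℝ × Space d => χ z.1 * ζ z.2) = fun z => χ z.1 * pd j ζ z.2 :=
    fun j => funext fun z => dx_mul hχ hd j z
  have h2 : ∀ i j, dx i (fun z : ℝ × Space d => χ z.1 * pd j ζ z.2) z
      = χ z.1 * pd i (pd j ζ) z.2 := fun i j =>
    dx_mul hχ ((contDiff_pd hζ j).differentiable (by simp)) i z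
  simp only [opL, dt_mul hχ hd, h1, h2, gen, mul_add, Finset.mul_sum, add_assoc]
  congr 2
  · refine Finset.sum_congr rfl fun i _ => Finset.sum_congr rfl fun j _ => by ring
  · refine Finset.sum_congr rfl fun i _ => by ring

/-- The standing assumptions that the time evolution uses: `A` is bounded by `M`, `b` is square
integrable, and the equation holds with its initial condition. -/
structure Evolution (A : ℝ × Space d → Matrix (Fin d) (Fin d) ℝ)
    (b : ℝ × Space d → Space d) (κ : Kernel ℝ (Space d)) (M : ℝ) : Prop where
  measurable_A : ∀ i j, Measurable (fun z => A z i j)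
  measurable_b : Measurable b
  abs_A_le : ∀ t ∈ Ioo (0 : ℝ) 1, ∀ x i j, |A (t, x) i j| ≤ M
  integrable_sq : Integrable (fun z => ‖b z‖ ^ 2) (spaceTime κ)
  integral_eq_zero : ∀ u : ℝ × Space d → ℝ, ContDiff ℝ ∞ u → HasCompactSupport u →
    tsupport u ⊆ Ioo (0 : ℝ) 1 ×ˢ univ → ∫ z, opL A b u z ∂(spaceTime κ) = 0
  initial : HasInitialCondition κ (κ 0)

/-- `ζ` is smooth, and its first and second derivatives are bounded by `C`. -/
structure HasBoundedDerivs (ζ : Space d → ℝ) (C : ℝ) : Prop where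
  contDiff : ContDiff ℝ ∞ ζ
  abs_pd_le : ∀ i x, |pd i ζ x| ≤ C
  abs_pd_pd_le : ∀ i j x, |pd i (pd j ζ) x| ≤ C

/-- The constant in the bound of `gen A b ζ`. -/
noncomputable def genBound (d : ℕ) (M C : ℝ) : ℝ := |C| * (d ^ 2 * |M| + d)

lemma genBound_nonneg (d : ℕ) (M C : ℝ) : 0 ≤ genBound d M C := by
  unfold genBound; positivity

lemma ae_spaceTime_mem (κ : Kernel ℝ (Space d)) :
    ∀ᵐ z ∂(spaceTime κ), z.1 ∈ Ioo (0 : ℝ) 1 :=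
  Measure.ae_compProd_of_ae_fst κ measurableSet_Ioo (ae_restrict_mem measurableSet_Ioo)

variable {A : ℝ × Space d → Matrix (Fin d) (Fin d) ℝ} {b : ℝ × Space d → Space d}
  {κ : Kernel ℝ (Space d)} {M C : ℝ} {ζ : Space d → ℝ}

/-- The growth is only linear in |b| and uniform over functions with a common derivative bound, so
one μ-integrable majorant serves all later limits. -/
lemma abs_gen_le (hE : Evolution A b κ M) (hζ : HasBoundedDerivs ζ C) {z : ℝ × Space d}
    (hz : z.1 ∈ Ioo (0 : ℝ) 1) : |gen A b ζ z| ≤ genBound d M C * (1 + ‖b z‖) := by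
  have h1 : |∑ i, ∑ j, A z i j * pd i (pd j ζ) z.2| ≤ |C| * (d ^ 2 * |M|) := by
    calc _ ≤ ∑ i : Fin d, ∑ j : Fin d, |M| * |C| := by
          refine (Finset.abs_sum_le_sum_abs _ _).trans (Finset.sum_le_sum fun i _ => ?_)
          refine (Finset.abs_sum_le_sum_abs _ _).trans (Finset.sum_le_sum fun j _ => ?_)
          rw [abs_mul]
          exact mul_le_mul ((hE.abs_A_le z.1 hz z.2 i j).trans (le_abs_self _))
            ((hζ.abs_pd_pd_le i j z.2).trans (le_abs_self _)) (abs_nonneg _) (abs_nonneg _)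
      _ = _ := by simp; ring
  have h2 : |∑ i, b z i * pd i ζ z.2| ≤ |C| * d * ‖b z‖ := by
    calc _ ≤ ∑ i : Fin d, ‖b z‖ * |C| := by
          refine (Finset.abs_sum_le_sum_abs _ _).trans (Finset.sum_le_sum fun i _ => ?_)
          rw [abs_mul]
          exact mul_le_mul (abs_apply_le_norm _ i)
            ((hζ.abs_pd_le i z.2).trans (le_abs_self _)) (abs_nonneg _) (norm_nonneg _)
      _ = _ := by simp; ring
  have h3 : 0 ≤ |C| * d := by positivity
  have h4 : 0 ≤ |C| * (d ^ 2 * |M|) * ‖b z‖ := by positivity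
  calc _ ≤ _ := abs_add_le _ _
    _ ≤ |C| * (d ^ 2 * |M|) + |C| * d * ‖b z‖ := add_le_add h1 h2
    _ ≤ _ := by unfold genBound; linarith

lemma measurable_gen (hE : Evolution A b κ M) (hζ : ContDiff ℝ ∞ ζ) : Measurable (gen A b ζ) := by
  unfold gen
  refine Measurable.add (Finset.measurable_fun_sum _ fun i _ => Finset.measurable_fun_sum _ fun j _ => ?_)
    (Finset.measurable_fun_sum _ fun i _ => ?_)
  · exact (hE.measurable_A i j).mul
      ((contDiff_pd (contDiff_pd hζ j) i).continuous.measurable.comp measurable_snd)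
  · exact (by have := hE.measurable_b; fun_prop : Measurable fun z => b z i).mul
      ((contDiff_pd hζ i).continuous.measurable.comp measurable_snd)

variable [IsMarkovKernel κ]

lemma Evolution.integrable_norm (hE : Evolution A b κ M) :
    Integrable (fun z => ‖b z‖) (spaceTime κ) := by
  refine ((integrable_const (1 : ℝ)).add hE.integrable_sq).mono'
    hE.measurable_b.norm.aestronglyMeasurable (Eventually.of_forall fun z => ?_)
  rw [norm_norm, Pi.add_apply]
  nlinarith [sq_nonneg (‖b z‖ - 1 / 2)]

lemma integrable_gen (hE : Evolution A b κ M) (hζ : HasBoundedDerivs ζ C) :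
    Integrable (gen A b ζ) (spaceTime κ) := by
  refine (((integrable_const (1 : ℝ)).add hE.integrable_norm).const_mul (genBound d M C)).mono'
    (measurable_gen hE hζ.contDiff).aestronglyMeasurable ?_
  filter_upwards [ae_spaceTime_mem κ] with z hz
  exact abs_gen_le hE hζ hz

lemma integrableOn_integral {f : ℝ × Space d → ℝ} (hf : Integrable f (spaceTime κ)) :
    IntegrableOn (fun t => ∫ y, f (t, y) ∂(κ t)) (Ioo (0 : ℝ) 1) :=
  MeasureTheory.Integrable.integral_compProd (κ := Kernel.const Unit timeMeasure)
    (η := Kernel.prodMkLeft Unit κ) (a := ()) hf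

/-- In this form an iterated time integral is a single integral against μ, to which dominated
convergence applies at once. -/
lemma intervalIntegral_eq_setIntegral {f : ℝ × Space d → ℝ} (hf : Integrable f (spaceTime κ))
    {t : ℝ} (ht : t ∈ Ioo (0 : ℝ) 1) :
    ∫ s in (0 : ℝ)..t, ∫ y, f (s, y) ∂(κ s) = ∫ z in Iic t ×ˢ univ, f z ∂(spaceTime κ) := by
  rw [spaceTime, Measure.setIntegral_compProd measurableSet_Iic MeasurableSet.univ
    (hf.integrableOn), intervalIntegral.integral_of_le ht.1.le, Measure.restrict_restrict measurableSet_Iic]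
  have : Iic t ∩ Ioo (0 : ℝ) 1 = Ioc 0 t := by
    ext s; simp only [mem_inter_iff, mem_Iic, mem_Ioo, mem_Ioc]
    constructor
    · rintro ⟨h1, h2, h3⟩; exact ⟨h2, h1⟩
    · rintro ⟨h1, h2⟩; exact ⟨h2, h1, by linarith [ht.2]⟩
  rw [this]
  simp

/-- A smooth compactly supported function has bounded derivatives. -/
lemma exists_hasBoundedDerivs (hζ : ContDiff ℝ ∞ ζ) (hs : HasCompactSupport ζ) :
    ∃ C, HasBoundedDerivs ζ C ∧ ∀ x, |ζ x| ≤ C := by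
  obtain ⟨C0, h0⟩ := hs.exists_bound_of_continuous hζ.continuous
  have h1 : ∀ i, ∃ C, ∀ x, |pd i ζ x| ≤ C := fun i =>
    (HasCompactSupport.pd hs i).exists_bound_of_continuous (contDiff_pd hζ i).continuous
  have h2 : ∀ i j, ∃ C, ∀ x, |pd i (pd j ζ) x| ≤ C := fun i j =>
    (HasCompactSupport.pd (HasCompactSupport.pd hs j) i).exists_bound_of_continuous
      (contDiff_pd (contDiff_pd hζ j) i).continuous
  choose C1 h1 using h1
  choose C2 h2 using h2
  have n0 : 0 ≤ C0 := (norm_nonneg _).trans (h0 0)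
  have n1 : ∀ i, 0 ≤ C1 i := fun i => (abs_nonneg _).trans (h1 i 0)
  have n2 : ∀ i j, 0 ≤ C2 i j := fun i j => (abs_nonneg _).trans (h2 i j 0)
  have s1 : 0 ≤ ∑ i, C1 i := Finset.sum_nonneg fun i _ => n1 i
  have s2 : 0 ≤ ∑ i, ∑ j, C2 i j := Finset.sum_nonneg fun i _ => Finset.sum_nonneg fun j _ => n2 i j
  refine ⟨C0 + ∑ i, C1 i + ∑ i, ∑ j, C2 i j, ⟨hζ, fun i x => ?_, fun i j x => ?_⟩, fun x => ?_⟩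
  · have := Finset.single_le_sum (f := C1) (fun i _ => n1 i) (Finset.mem_univ i)
    linarith [h1 i x]
  · have a := Finset.single_le_sum (f := fun i => ∑ j, C2 i j)
      (fun i _ => Finset.sum_nonneg fun j _ => n2 i j) (Finset.mem_univ i)
    have b := Finset.single_le_sum (f := C2 i) (fun j _ => n2 i j) (Finset.mem_univ j)
    beta_reduce at a
    linarith [h2 i j x]
  · have : |ζ x| ≤ C0 := h0 x
    linarith

lemma measurable_integral_kernel {f : Space d → ℝ} (hf : Measurable f) :
    StronglyMeasurable (fun t => ∫ x, f x ∂(κ t)) :=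
  StronglyMeasurable.integral_kernel_prod_right (f := fun _ x => f x)
    (hf.comp measurable_snd).stronglyMeasurable

/-- The time evolution of `∫ ζ dμ_t` for test functions. -/
lemma ae_integral_eq_of_hasCompactSupport (hE : Evolution A b κ M) (hζ : ContDiff ℝ ∞ ζ)
    (hs : HasCompactSupport ζ) :
    ∀ᵐ t ∂timeMeasure, ∫ x, ζ x ∂(κ t) =
      ∫ x, ζ x ∂(κ 0) + ∫ s in (0 : ℝ)..t, ∫ y, gen A b ζ (s, y) ∂(κ s) := by
  obtain ⟨C, hC, hC0⟩ := exists_hasBoundedDerivs hζ hs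
  have hgi := integrable_gen hE hC
  have hki := integrableOn_integral hgi
  have hζi : ∀ t, Integrable ζ (κ t) := fun t =>
    Integrable.of_bound hζ.continuous.aestronglyMeasurable C (Eventually.of_forall hC0)
  have hmi : IntegrableOn (fun t => ∫ x, ζ x ∂(κ t)) (Ioo (0 : ℝ) 1) := by
    refine Measure.integrableOn_of_bounded (M := C) (by simp)
      (measurable_integral_kernel hζ.continuous.measurable).aestronglyMeasurable
      (Eventually.of_forall fun t => ?_)
    refine (norm_integral_le_of_norm_le_const (Eventually.of_forall hC0)).trans ?_
    simp
  -- Testing the equation with products χ(t)ζ(x) identifies the distributional time derivative of t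
  -- ↦ ∫ ζ dμ_t.
  obtain ⟨c, hc⟩ := ae_eq_const_add_primitive hmi hki fun χ hχ hχs hχt => by
    have hu := hE.integral_eq_zero (fun z => χ z.1 * ζ z.2)
      ((hχ.comp contDiff_fst).mul (hζ.comp contDiff_snd)) ?_ ?_
    · simp only [opL_mul A b (hχ.differentiable (by simp)) hζ] at hu
      obtain ⟨C1, hC1⟩ := hχs.exists_bound_of_continuous hχ.continuous
      obtain ⟨C2, hC2⟩ := hχs.deriv.exists_bound_of_continuous
        (hχ.continuous_deriv (by exact_mod_cast le_top))
      have i1 : Integrable (fun z : ℝ × Space d => deriv χ z.1 * ζ z.2) (spaceTime κ) := by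
        refine Integrable.of_bound (C := C2 * C) ?_ (Eventually.of_forall fun z => ?_)
        · exact (((hχ.continuous_deriv (by exact_mod_cast le_top)).comp continuous_fst).mul
            (hζ.continuous.comp continuous_snd)).aestronglyMeasurable
        · rw [norm_mul]
          exact mul_le_mul (hC2 _) (hC0 _) (norm_nonneg _) ((norm_nonneg _).trans (hC2 0))
      have i2 : Integrable (fun z : ℝ × Space d => χ z.1 * gen A b ζ z) (spaceTime κ) :=
        hgi.bdd_mul (hχ.continuous.comp continuous_fst).aestronglyMeasurable
          (c := C1) (Eventually.of_forall fun z => hC1 _)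
      rw [spaceTime, Measure.integral_compProd (f := fun z : ℝ × Space d => deriv χ z.1 * ζ z.2 + χ z.1 * gen A b ζ z)
        (i1.add i2)] at hu
      have i3 : ∀ᵐ t ∂timeMeasure, Integrable (fun y => gen A b ζ (t, y)) (κ t) :=
        ((Measure.integrable_compProd_iff hgi.aestronglyMeasurable).1 hgi).1
      refine Eq.trans (integral_congr_ae ?_) hu
      filter_upwards [i3] with t ht
      have e := integral_add ((hζi t).const_mul (deriv χ t)) (ht.const_mul (χ t))
      rw [integral_const_mul, integral_const_mul] at e
      exact e.symm
    · refine HasCompactSupport.of_support_subset_isCompact (hχs.isCompact.prod hs.isCompact) ?_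
      intro z hz
      exact ⟨subset_tsupport _ fun h => hz (by simp [h]), subset_tsupport _ fun h => hz (by simp [h])⟩
    · refine (closure_minimal (t := tsupport χ ×ˢ univ) ?_
        ((isClosed_tsupport χ).prod isClosed_univ)).trans (prod_mono hχt le_rfl)
      intro z hz
      exact ⟨subset_tsupport _ fun h => hz (by simp [h]), mem_univ _⟩
  have hlim := hE.initial ζ hζ hs
  have hKi : IntervalIntegrable (fun s => ∫ y, gen A b ζ (s, y) ∂(κ s)) volume 0 1 := by
    rw [intervalIntegrable_iff_integrableOn_Ioo_of_le zero_le_one]; exact hki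
  have hKc := (hKi.absolutelyContinuousOnInterval_intervalIntegral (c := 0) (by simp)).continuousOn
  rw [uIcc_of_le zero_le_one] at hKc
  have hlim2 : Tendsto (fun t => c + ∫ s in (0 : ℝ)..t, ∫ y, gen A b ζ (s, y) ∂(κ s))
      (𝓝[>] 0) (𝓝 (c + 0)) := by
    refine Tendsto.add tendsto_const_nhds ?_
    have := (hKc 0 (by simp)).mono_left (nhdsWithin_mono (0 : ℝ) Ioc_subset_Icc_self)
    simp only [intervalIntegral.integral_same] at this
    rwa [nhdsWithin_Ioc_eq_nhdsGT zero_lt_one] at this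
  -- A set of full measure accumulates at 0. There both limits, that of ∫ ζ dμ_t from the initial
  -- condition and that of the continuous version, can be compared, which forces c = ∫ ζ dμ_0.
  have hfreq : ∃ᶠ t in 𝓝[>] (0 : ℝ), ∫ x, ζ x ∂(κ t) =
      c + ∫ s in (0 : ℝ)..t, ∫ y, gen A b ζ (s, y) ∂(κ s) := by
    intro hev
    rw [← nhdsWithin_Ioo_eq_nhdsGT zero_lt_one, eventually_nhdsWithin_iff,
      Metric.eventually_nhds_iff] at hev
    obtain ⟨ε, hε, h⟩ := hev
    rw [ae_restrict_iff' measurableSet_Ioo] at hc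
    have hpos : 0 < min ε 1 := by positivity
    have hv : volume (Ioo (0 : ℝ) (min ε 1)) = 0 := by
      refine measure_mono_null ?_ hc
      intro t ht hcon
      have h1 : t < ε := ht.2.trans_le (min_le_left _ _)
      have h2 : t < 1 := ht.2.trans_le (min_le_right _ _)
      exact h (y := t) (by rw [Real.dist_eq, sub_zero, abs_of_pos ht.1]; exact h1) ⟨ht.1, h2⟩
        (hcon ⟨ht.1, h2⟩)
    simp at hv
    exact absurd hv (not_le.2 hε)
  have hceq : ∫ x, ζ x ∂(κ 0) = c := by
    have h1 := (hlim.sub hlim2)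
    by_contra hne
    have h2 : ∀ᶠ t in 𝓝[>] (0 : ℝ), (∫ x, ζ x ∂(κ t)) -
        (c + ∫ s in (0 : ℝ)..t, ∫ y, gen A b ζ (s, y) ∂(κ s)) ≠ 0 :=
      h1.eventually_ne (by simpa [sub_eq_zero] using hne)
    exact hfreq (h2.mono fun t ht h => ht (by rw [h]; ring))
  rw [hceq]
  exact hc

end Setting


/-! ### Extension to functions with bounded derivatives; comparison of moments -/

section Extension
variable {d : ℕ} {A : ℝ × Space d → Matrix (Fin d) (Fin d) ℝ} {b : ℝ × Space d → Space d}
  {κ : Kernel ℝ (Space d)} {M C : ℝ} {ζ : Space d → ℝ}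

/-- Smooth compactly supported functions increasing to `1` with uniformly bounded derivatives. -/
lemma exists_cutoff (d : ℕ) : ∃ (K : ℝ) (η : ℕ → Space d → ℝ), 0 ≤ K ∧
    (∀ n, ContDiff ℝ ∞ (η n)) ∧ (∀ n, HasCompactSupport (η n)) ∧
    (∀ n x, |η n x| ≤ 1) ∧ (∀ n i x, |pd i (η n) x| ≤ K) ∧
    (∀ n i j x, |pd i (pd j (η n)) x| ≤ K) ∧
    (∀ x, Tendsto (fun n => η n x) atTop (𝓝 1)) ∧
    (∀ i x, Tendsto (fun n => pd i (η n) x) atTop (𝓝 0)) ∧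
    (∀ i j x, Tendsto (fun n => pd i (pd j (η n)) x) atTop (𝓝 0)) := by
  let B : ContDiffBump (0 : Space d) := ⟨1, 2, by norm_num, by norm_num⟩
  have hBs : ContDiff ℝ ∞ B := B.contDiff
  obtain ⟨K, hK, hK0⟩ := exists_hasBoundedDerivs hBs B.hasCompactSupport
  have hK1 : 0 ≤ K := (abs_nonneg _).trans (hK0 0)
  -- Dilating one fixed bump by 1/(n + 1) ≤ 1 multiplies each derivative by that factor, so
  -- derivatives stay bounded and tend to zero.
  set c : ℕ → ℝ := fun n => ((n : ℝ) + 1)⁻¹ with hc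
  have hcpos : ∀ n, 0 < c n := fun n => by simp only [hc]; positivity
  have hc1 : ∀ n, c n ≤ 1 := fun n => by
    simp only [hc]
    exact inv_le_one_of_one_le₀ (by linarith [Nat.cast_nonneg (α := ℝ) n])
  have hct : Tendsto c atTop (𝓝 0) := by
    simpa [hc, one_div] using tendsto_one_div_add_atTop_nhds_zero_nat (𝕜 := ℝ)
  have p1 : ∀ n i, pd i (fun x => B (c n • x)) = fun x => c n * pd i B (c n • x) := fun n i =>
    funext fun x => pd_comp_smul (hBs.differentiable (by simp)) _ _ _
  have p2 : ∀ n i j x, pd i (pd j (fun x => B (c n • x))) x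
      = c n * (c n * pd i (pd j B) (c n • x)) := fun n i j x => by
    have hd := (contDiff_pd hBs j).differentiable (by simp : (∞ : WithTop ℕ∞) ≠ 0)
    have hd2 : DifferentiableAt ℝ (fun x => pd j B (c n • x)) x :=
      (hd _).comp x (differentiableAt_id.const_smul (c n))
    rw [p1, pd_const_mul hd2, pd_comp_smul hd]
  have bd : ∀ n y, |y| ≤ K → |c n * y| ≤ K := fun n y hy => by
    rw [abs_mul, abs_of_pos (hcpos n)]
    nlinarith [abs_nonneg y, hc1 n, hcpos n]
  have tz : ∀ f : ℕ → ℝ, (∀ n, |f n| ≤ K) → Tendsto (fun n => c n * f n) atTop (𝓝 0) :=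
    fun f hf => hct.zero_mul_isBoundedUnder_le ⟨K, eventually_map.2 (Eventually.of_forall hf)⟩
  refine ⟨K, fun n x => B (c n • x), hK1, fun n => hBs.comp (contDiff_const_smul (c n)), fun n =>
    B.hasCompactSupport.comp_smul (hcpos n).ne', fun n x => ?_, fun n i x => ?_, fun n i j x => ?_,
    fun x => ?_, fun i x => ?_, fun i j x => ?_⟩
  · rw [abs_of_nonneg B.nonneg]; exact B.le_one
  · rw [p1]; exact bd n _ (hK.abs_pd_le i _)
  · rw [p2]; exact bd n _ (bd n _ (hK.abs_pd_pd_le i j _))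
  · have h1 : Tendsto (fun n => c n • x) atTop (𝓝 0) := by simpa using hct.smul_const x
    have h2 := (B.continuous.tendsto 0).comp h1
    rwa [B.one_of_mem_closedBall (by simp [B.rIn_pos.le])] at h2
  · simp only [p1]; exact tz _ fun n => hK.abs_pd_le i _
  · simp only [p2]; exact tz _ fun n => bd n _ (hK.abs_pd_pd_le i j _)

variable [IsMarkovKernel κ]

/-- The time evolution of `∫ ζ dμ_t` for bounded smooth functions with bounded derivatives. -/
lemma ae_integral_eq (hE : Evolution A b κ M) (hζ : HasBoundedDerivs ζ C)
    (hζ0 : ∀ x, |ζ x| ≤ C) :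
    ∀ᵐ t ∂timeMeasure, ∫ x, ζ x ∂(κ t) =
      ∫ x, ζ x ∂(κ 0) + ∫ s in (0 : ℝ)..t, ∫ y, gen A b ζ (s, y) ∂(κ s) := by
  obtain ⟨K, η, hK, hη, hηs, b0, b1, b2, l0, l1, l2⟩ := exists_cutoff d
  have hC : 0 ≤ C := (abs_nonneg _).trans (hζ0 0)
  have hd : Differentiable ℝ ζ := hζ.contDiff.differentiable (by simp)
  have hηd : ∀ n, Differentiable ℝ (η n) := fun n => (hη n).differentiable (by simp)
  have hd' : ∀ i, Differentiable ℝ (pd i ζ) := fun i =>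
    (contDiff_pd hζ.contDiff i).differentiable (by simp)
  have hηd' : ∀ n i, Differentiable ℝ (pd i (η n)) := fun n i =>
    (contDiff_pd (hη n) i).differentiable (by simp)
  have p1 : ∀ n j, pd j (fun x => ζ x * η n x) = fun x => pd j ζ x * η n x + ζ x * pd j (η n) x :=
    fun n j => funext fun x => pd_mul (hd x) (hηd n x) j
  have p2 : ∀ n i j x, pd i (pd j (fun x => ζ x * η n x)) x =
      (pd i (pd j ζ) x * η n x + pd j ζ x * pd i (η n) x) +
      (pd i ζ x * pd j (η n) x + ζ x * pd i (pd j (η n)) x) := fun n i j x => by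
    rw [p1, pd_add ((hd' j x).fun_mul (hηd n x)) ((hd x).fun_mul (hηd' n j x)),
      pd_mul (hd' j x) (hηd n x), pd_mul (hd x) (hηd' n j x)]
  have am : ∀ {u v a c : ℝ}, |u| ≤ a → |v| ≤ c → |u * v| ≤ a * c := fun hu hv => by
    rw [abs_mul]
    exact mul_le_mul hu hv (abs_nonneg _) ((abs_nonneg _).trans hu)
  -- A crude constant covering both Leibniz formulas: the second derivative of the product has one
  -- term of size C and three of size CK.
  set C' := 2 * (C * 1 + C * K) + 2 * (C * K) with hC'
  have hbd : ∀ n, HasBoundedDerivs (fun x => ζ x * η n x) C' := fun n => by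
    refine ⟨hζ.contDiff.mul (hη n), fun i x => ?_, fun i j x => ?_⟩
    · rw [p1]
      have := am (hζ.abs_pd_le i x) (b0 n x)
      have := am (hζ0 x) (b1 n i x)
      have : 0 ≤ C * K := by positivity
      refine (abs_add_le _ _).trans ?_
      linarith
    · rw [p2]
      have h1 := am (hζ.abs_pd_pd_le i j x) (b0 n x)
      have h2 := am (hζ.abs_pd_le j x) (b1 n i x)
      have h3 := am (hζ.abs_pd_le i x) (b1 n j x)
      have h4 := am (hζ0 x) (b2 n i j x)
      have : 0 ≤ C * K := by positivity
      refine (abs_add_le _ _).trans ((add_le_add (abs_add_le _ _) (abs_add_le _ _)).trans ?_)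
      linarith
  have hall : ∀ᵐ t ∂timeMeasure, ∀ n, ∫ x, ζ x * η n x ∂(κ t) = ∫ x, ζ x * η n x ∂(κ 0) +
      ∫ s in (0 : ℝ)..t, ∫ y, gen A b (fun x => ζ x * η n x) (s, y) ∂(κ s) :=
    ae_all_iff.2 fun n => ae_integral_eq_of_hasCompactSupport hE (hbd n).contDiff (hηs n).mul_left
  have lim0 : ∀ t, Tendsto (fun n => ∫ x, ζ x * η n x ∂(κ t)) atTop (𝓝 (∫ x, ζ x ∂(κ t))) := by
    intro t
    refine tendsto_integral_of_dominated_convergence (fun _ => C) (fun n =>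
      (hbd n).contDiff.continuous.aestronglyMeasurable) (integrable_const _)
      (fun n => Eventually.of_forall fun x => ?_) (Eventually.of_forall fun x => ?_)
    · simpa using am (hζ0 x) (b0 n x)
    · simpa using (l0 x).const_mul (ζ x)
  have limg : ∀ z, Tendsto (fun n => gen A b (fun x => ζ x * η n x) z) atTop (𝓝 (gen A b ζ z)) := by
    intro z
    unfold gen
    refine Tendsto.add (tendsto_finsetSum _ fun i _ => tendsto_finsetSum _ fun j _ => ?_)
      (tendsto_finsetSum _ fun i _ => ?_)
    · refine Tendsto.const_mul _ ?_
      simp only [p2]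
      have := (((l0 z.2).const_mul (pd i (pd j ζ) z.2)).add ((l1 i z.2).const_mul (pd j ζ z.2))).add
        (((l1 j z.2).const_mul (pd i ζ z.2)).add ((l2 i j z.2).const_mul (ζ z.2)))
      simpa using this
    · refine Tendsto.const_mul _ ?_
      simp only [p1]
      have := ((l0 z.2).const_mul (pd i ζ z.2)).add ((l1 i z.2).const_mul (ζ z.2))
      simpa using this
  filter_upwards [hall, ae_restrict_mem measurableSet_Ioo] with t ht htm
  refine tendsto_nhds_unique (lim0 t) ?_
  simp only [ht]
  refine (lim0 0).add ?_
  -- Rewritten as integrals against μ, the generators of all truncated functions share the majorant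
  -- `genBound d M C' * (1 + ‖b‖)`.
  simp only [intervalIntegral_eq_setIntegral (integrable_gen hE (hbd _)) htm,
    intervalIntegral_eq_setIntegral (integrable_gen hE hζ) htm]
  refine tendsto_integral_of_dominated_convergence (fun z => genBound d M C' * (1 + ‖b z‖))
    (fun n => (measurable_gen hE (hbd n).contDiff).aestronglyMeasurable)
    ((((integrable_const (1 : ℝ)).add hE.integrable_norm).const_mul _).integrableOn)
    (fun n => ?_) (Eventually.of_forall limg)
  filter_upwards [ae_restrict_of_ae (ae_spaceTime_mem κ)] with z hz
  exact abs_gen_le hE (hbd n) hz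

/-- Bounded truncations of a nonnegative function preserving bounds on derivatives. -/
lemma hasBoundedDerivs_truncation {g : Space d → ℝ} (hg : HasBoundedDerivs g C)
    (hg0 : ∀ x, 0 ≤ g x) (n : ℕ) :
    HasBoundedDerivs (fun x => (n + 1) * (1 - Real.exp (-((n + 1 : ℝ)⁻¹ * g x)))) (C + C * C) := by
  have hgd : Differentiable ℝ g := hg.contDiff.differentiable (by simp)
  have hgd' : ∀ i, Differentiable ℝ (pd i g) := fun i =>
    (contDiff_pd hg.contDiff i).differentiable (by simp)
  set a : ℝ := (n + 1 : ℝ)⁻¹ with ha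
  have ha0 : 0 < a := by positivity
  have ha1 : a ≤ 1 := inv_le_one_of_one_le₀ (by linarith [Nat.cast_nonneg (α := ℝ) n])
  have haa : ((n : ℝ) + 1) * a = 1 := mul_inv_cancel₀ (by positivity)
  -- The truncating function φ(s) = (1 - exp(-as))/a has φ' = exp(-as) ≤ 1 and |φ''| = a exp(-as) ≤
  -- 1 for s ≥ 0, so the derivative bounds of φ ∘ g do not depend on n.
  have hφ : ∀ s : ℝ, HasDerivAt (fun s => (n + 1 : ℝ) * (1 - Real.exp (-(a * s))))
      (Real.exp (-(a * s))) s := fun s => by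
    have := ((((((hasDerivAt_id s).const_mul a).neg).exp).const_sub 1).const_mul (n + 1 : ℝ))
    refine this.congr_deriv ?_
    simp only [id]
    linear_combination (Real.exp (-(a * s))) * haa
  have hψ : ∀ s : ℝ, HasDerivAt (fun s => Real.exp (-(a * s))) (-(a * Real.exp (-(a * s)))) s :=
    fun s => by
    have := (((hasDerivAt_id s).const_mul a).fun_neg).exp
    refine this.congr_deriv ?_
    simp only [id]; ring
  have p1 : ∀ j, pd j (fun x => (n + 1 : ℝ) * (1 - Real.exp (-(a * g x)))) =
      fun x => Real.exp (-(a * g x)) * pd j g x := fun j => funext fun x => by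
    have := pd_comp (hφ (g x)).differentiableAt (hgd x) j
    rw [(hφ (g x)).deriv] at this
    exact this
  have p2 : ∀ i j x, pd i (pd j (fun x => (n + 1 : ℝ) * (1 - Real.exp (-(a * g x))))) x =
      -(a * Real.exp (-(a * g x))) * pd i g x * pd j g x
        + Real.exp (-(a * g x)) * pd i (pd j g) x := fun i j x => by
    have := pd_comp (hψ (g x)).differentiableAt (hgd x) i
    rw [(hψ (g x)).deriv] at this
    have hd2 : DifferentiableAt ℝ (fun x => Real.exp (-(a * g x))) x :=
      (hψ (g x)).differentiableAt.comp x (hgd x)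
    rw [p1, pd_mul hd2 (hgd' j x), this]
  have he0 : ∀ x, 0 < Real.exp (-(a * g x)) := fun x => Real.exp_pos _
  have he1 : ∀ x, Real.exp (-(a * g x)) ≤ 1 := fun x =>
    Real.exp_le_one_iff.2 (by have := mul_nonneg ha0.le (hg0 x); linarith)
  refine ⟨?_, fun i x => ?_, fun i j x => ?_⟩
  · exact contDiff_const.mul (contDiff_const.sub (contDiff_const.mul hg.contDiff).neg.exp)
  · have h := hg.abs_pd_le i x
    rw [p1, abs_mul, abs_of_pos (he0 x)]
    nlinarith [abs_nonneg (pd i g x), he0 x, he1 x, mul_self_nonneg C]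
  · have h1 := hg.abs_pd_le i x
    have h2 := hg.abs_pd_le j x
    have h3 := hg.abs_pd_pd_le i j x
    have hC : 0 ≤ C := (abs_nonneg _).trans h1
    rw [p2]
    refine (abs_add_le _ _).trans ?_
    have e1 : |-(a * Real.exp (-(a * g x))) * pd i g x * pd j g x| ≤ 1 * C * C := by
      rw [abs_mul, abs_mul, abs_neg, abs_of_pos (by have := he0 x; positivity)]
      gcongr
      exact mul_le_one₀ ha1 (he0 x).le (he1 x)
    have e2 : |Real.exp (-(a * g x)) * pd i (pd j g) x| ≤ 1 * C := by
      rw [abs_mul, abs_of_pos (he0 x)]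
      gcongr
      exact he1 x
    linarith

/-- Moments of `μ_t` and `μ_0` with respect to a function with bounded derivatives differ by a
bounded amount. -/
lemma exists_moment_bound (hE : Evolution A b κ M) {g : Space d → ℝ} (hg : HasBoundedDerivs g C)
    (hg0 : ∀ x, 0 ≤ g x) :
    ∃ D : ℝ≥0, ∀ᵐ t ∂timeMeasure,
      ∫⁻ x, ENNReal.ofReal (g x) ∂(κ t) ≤ ∫⁻ x, ENNReal.ofReal (g x) ∂(κ 0) + D ∧
      ∫⁻ x, ENNReal.ofReal (g x) ∂(κ 0) ≤ ∫⁻ x, ENNReal.ofReal (g x) ∂(κ t) + D := by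
  set g' : ℕ → Space d → ℝ := fun n x => (n + 1) * (1 - Real.exp (-((n + 1 : ℝ)⁻¹ * g x))) with hg'
  have hB : ∀ n, HasBoundedDerivs (g' n) (C + C * C) := fun n => hasBoundedDerivs_truncation hg hg0 n
  have hle : ∀ n x, g' n x ≤ g x := fun n x => by
    have h1 := Real.add_one_le_exp (-((n + 1 : ℝ)⁻¹ * g x))
    have h2 : ((n : ℝ) + 1) * (1 - Real.exp (-((n + 1 : ℝ)⁻¹ * g x))) ≤
        (n + 1) * ((n + 1 : ℝ)⁻¹ * g x) := by gcongr; linarith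
    refine h2.trans_eq ?_
    field_simp
  have hnn : ∀ n x, 0 ≤ g' n x := fun n x => by
    have h1 : Real.exp (-((n + 1 : ℝ)⁻¹ * g x)) ≤ 1 := by
      rw [Real.exp_le_one_iff]
      have : 0 ≤ (n + 1 : ℝ)⁻¹ * g x := mul_nonneg (by positivity) (hg0 x)
      linarith
    exact mul_nonneg (by positivity) (by linarith)
  have hub : ∀ n x, g' n x ≤ n + 1 := fun n x => by
    have := Real.exp_pos (-((n + 1 : ℝ)⁻¹ * g x))
    have h2 : ((n : ℝ) + 1) * (1 - Real.exp (-((n + 1 : ℝ)⁻¹ * g x))) ≤ (n + 1) * 1 := by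
      gcongr; linarith
    linarith
  have hlim : ∀ x, Tendsto (fun n => g' n x) atTop (𝓝 (g x)) := by
    intro x
    -- Convergence with a rate, from exp(-y) ≤ 1 - y + y² for y = g(x)/(n + 1) ≥ 0.
    have hlow : ∀ n : ℕ, g x - (n + 1 : ℝ)⁻¹ * g x ^ 2 ≤ g' n x := fun n => by
      have hy : 0 ≤ (n + 1 : ℝ)⁻¹ * g x := mul_nonneg (by positivity) (hg0 x)
      set y := (n + 1 : ℝ)⁻¹ * g x with hyd
      have h1 : Real.exp (-y) ≤ 1 - y + y ^ 2 := by
        have h2 := Real.add_one_le_exp y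
        rw [Real.exp_neg, inv_le_iff_one_le_mul₀ (Real.exp_pos _)]
        nlinarith [mul_nonneg hy (mul_nonneg hy hy), sq_nonneg (y - 1 / 2)]
      have h3 : (n + 1 : ℝ) * y = g x := by rw [hyd]; field_simp
      have h4 : (n + 1 : ℝ)⁻¹ * g x ^ 2 = (n + 1) * y ^ 2 := by rw [hyd]; field_simp
      have h5 : ((n : ℝ) + 1) * (y - y ^ 2) ≤ (n + 1) * (1 - Real.exp (-y)) := by
        exact mul_le_mul_of_nonneg_left (by linarith) (by positivity)
      calc _ = ((n : ℝ) + 1) * (y - y ^ 2) := by rw [h4]; linarith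
        _ ≤ _ := h5
    have hl : Tendsto (fun n : ℕ => g x - (n + 1 : ℝ)⁻¹ * g x ^ 2) atTop (𝓝 (g x)) := by
      have := (tendsto_one_div_add_atTop_nhds_zero_nat (𝕜 := ℝ)).mul_const (g x ^ 2)
      have := this.const_sub (g x)
      simpa [one_div] using this
    exact tendsto_of_tendsto_of_tendsto_of_le_of_le hl tendsto_const_nhds hlow fun n => hle n x
  have hev : ∀ᵐ t ∂timeMeasure, ∀ n : ℕ, ∫ x, g' n x ∂(κ t) =
      ∫ x, g' n x ∂(κ 0) + ∫ s in (0 : ℝ)..t, ∫ y, gen A b (g' n) (s, y) ∂(κ s) := by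
    refine ae_all_iff.2 fun n => ?_
    refine ae_integral_eq (C := |C + C * C| + (n + 1)) hE ⟨(hB n).contDiff, fun i x => ?_,
      fun i j x => ?_⟩ fun x => ?_
    · linarith [(hB n).abs_pd_le i x, le_abs_self (C + C * C), Nat.cast_nonneg (α := ℝ) n]
    · linarith [(hB n).abs_pd_pd_le i j x, le_abs_self (C + C * C), Nat.cast_nonneg (α := ℝ) n]
    · rw [abs_of_nonneg (hnn n x)]
      linarith [hub n x, abs_nonneg (C + C * C)]
  -- The truncations share a derivative bound, so this bound of the time integral of the generator
  -- is the same for all n.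
  set D : ℝ := ∫ z, genBound d M (C + C * C) * (1 + ‖b z‖) ∂(spaceTime κ) with hD
  have hDi : Integrable (fun z => genBound d M (C + C * C) * (1 + ‖b z‖)) (spaceTime κ) :=
    ((integrable_const (1 : ℝ)).add hE.integrable_norm).const_mul _
  have hnnD : ∀ z, 0 ≤ genBound d M (C + C * C) * (1 + ‖b z‖) := fun z =>
    mul_nonneg (genBound_nonneg _ _ _) (by positivity)
  have hgb : ∀ t ∈ Ioo (0 : ℝ) 1, ∀ n : ℕ,
      |∫ s in (0 : ℝ)..t, ∫ y, gen A b (g' n) (s, y) ∂(κ s)| ≤ D := by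
    intro t ht n
    rw [intervalIntegral_eq_setIntegral (integrable_gen hE (hB n)) ht]
    calc _ ≤ ∫ z in Iic t ×ˢ univ, genBound d M (C + C * C) * (1 + ‖b z‖) ∂(spaceTime κ) := by
          rw [← Real.norm_eq_abs]
          refine norm_integral_le_of_norm_le hDi.integrableOn ?_
          filter_upwards [ae_restrict_of_ae (ae_spaceTime_mem κ)] with z hz
          exact abs_gen_le hE (hB n) hz
      _ ≤ D := setIntegral_le_integral hDi (Eventually.of_forall hnnD)
  -- Fatou recovers g from its truncations on the left-hand side, and `hle` handles the right-hand
  -- side; both comparisons thus hold even when a moment is infinite.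
  have hfat : ∀ t, ∫⁻ x, ENNReal.ofReal (g x) ∂(κ t) ≤
      liminf (fun n => ∫⁻ x, ENNReal.ofReal (g' n x) ∂(κ t)) atTop := by
    intro t
    refine le_trans (le_of_eq ?_) (lintegral_liminf_le fun n =>
      (hB n).contDiff.continuous.measurable.ennreal_ofReal)
    refine lintegral_congr fun x => ?_
    exact ((ENNReal.continuous_ofReal.tendsto _).comp (hlim x)).liminf_eq.symm
  have hg'i : ∀ n t, Integrable (g' n) (κ t) := fun n t =>
    Integrable.of_bound (hB n).contDiff.continuous.aestronglyMeasurable (n + 1)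
      (Eventually.of_forall fun x => by
        rw [Real.norm_of_nonneg (hnn n x)]; exact hub n x)
  have hconv : ∀ n t, ∫⁻ x, ENNReal.ofReal (g' n x) ∂(κ t) = ENNReal.ofReal (∫ x, g' n x ∂(κ t)) :=
    fun n t => (ofReal_integral_eq_lintegral_ofReal (hg'i n t) (Eventually.of_forall (hnn n))).symm
  have hcomp : ∀ n s t, ∫ x, g' n x ∂(κ s) ≤ ∫ x, g' n x ∂(κ t) + D →
      ∫⁻ x, ENNReal.ofReal (g' n x) ∂(κ s) ≤ ∫⁻ x, ENNReal.ofReal (g x) ∂(κ t) + D.toNNReal := by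
    intro n s t h
    rw [hconv]
    calc _ ≤ ENNReal.ofReal (∫ x, g' n x ∂(κ t) + D) := ENNReal.ofReal_le_ofReal h
      _ ≤ ENNReal.ofReal (∫ x, g' n x ∂(κ t)) + ENNReal.ofReal D := ENNReal.ofReal_add_le
      _ ≤ _ := by
        rw [← hconv]
        gcongr
        · exact hle n _
        · exact le_rfl
  refine ⟨D.toNNReal, ?_⟩
  filter_upwards [hev, ae_restrict_mem measurableSet_Ioo] with t ht htm
  have hb' : ∀ n, |∫ s in (0 : ℝ)..t, ∫ y, gen A b (g' n) (s, y) ∂(κ s)| ≤ D := hgb t htm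
  constructor
  · refine (hfat t).trans (liminf_le_of_le (by isBoundedDefault) fun c hc => ?_)
    obtain ⟨n, hn⟩ := hc.exists
    refine hn.trans (hcomp n t 0 ?_)
    rw [ht n]
    linarith [(abs_le.1 (hb' n)).2]
  · refine (hfat 0).trans (liminf_le_of_le (by isBoundedDefault) fun c hc => ?_)
    obtain ⟨n, hn⟩ := hc.exists
    refine hn.trans (hcomp n 0 t ?_)
    rw [ht n]
    linarith [(abs_le.1 (hb' n)).1]

lemma hasBoundedDerivs_logBracket : HasBoundedDerivs (logBracket 1 : Space d → ℝ) 3 where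
  contDiff := contDiff_logBracket 1
  abs_pd_le i x := by
    rw [pd_logBracket]
    linarith [abs_apply_le_norm (gradLog 1 x) i, norm_gradLog_le zero_le_one x]
  abs_pd_pd_le i j x := by
    have : pd j (logBracket 1 : Space d → ℝ) = fun x => gradLog 1 x j :=
      funext fun x => pd_logBracket 1 j x
    rw [this, pd_gradLog]
    simpa using abs_hessLog_le zero_le_one i j x

/-- The Hessian of ℓ² is 2(∇ℓ ⊗ ∇ℓ + ℓ D²ℓ), with entries at most 2(1 + 6). This is what propagates
the second logarithmic moment from time 0. -/
lemma hasBoundedDerivs_logBracket_sq :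
    HasBoundedDerivs (fun x : Space d => logBracket 1 x ^ 2) 14 := by
  have hl : Differentiable ℝ (logBracket 1 : Space d → ℝ) :=
    (contDiff_logBracket 1).differentiable (by simp)
  have hgd : ∀ j, Differentiable ℝ (fun x : Space d => gradLog 1 x j) := fun j =>
    (contDiff_gradLog_apply 1 j).differentiable (by simp)
  have p1 : ∀ j, pd j (fun x : Space d => logBracket 1 x ^ 2) =
      fun x => 2 * (logBracket 1 x * gradLog 1 x j) := fun j => funext fun x => by
    have := pd_mul (hl x) (hl x) j
    simp only [sq, this, pd_logBracket]; ring
  refine ⟨(contDiff_logBracket 1).pow 2, fun i x => ?_, fun i j x => ?_⟩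
  · have h1 := logBracket_mul_norm_gradLog_le x
    have h2 := mul_le_mul_of_nonneg_left (abs_apply_le_norm (gradLog 1 x) i) (logBracket_nonneg 1 x)
    rw [p1, abs_mul, abs_mul, abs_of_nonneg (logBracket_nonneg 1 x), abs_two]
    linarith
  · have h1 := logBracket_mul_abs_hessLog_le i j x
    have h2 : |gradLog 1 x i * gradLog 1 x j| ≤ 1 * 1 := by
      rw [abs_mul]
      exact mul_le_mul ((abs_apply_le_norm _ i).trans (norm_gradLog_le zero_le_one x))
        ((abs_apply_le_norm _ j).trans (norm_gradLog_le zero_le_one x)) (abs_nonneg _) zero_le_one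
    rw [p1, pd_const_mul ((hl x).fun_mul (hgd j x)), pd_mul (hl x) (hgd j x), pd_logBracket, pd_gradLog,
      abs_mul, abs_two]
    have := abs_add_le (gradLog 1 x i * gradLog 1 x j) (logBracket 1 x * hessLog 1 i j x)
    rw [abs_mul (logBracket 1 x), abs_of_nonneg (logBracket_nonneg 1 x)] at this
    linarith

end Extension


/-! ### Mollified measures: positivity, gradients and logarithmic growth -/

section Mollification
variable {d : ℕ}

/-- The density of the mollified measure. -/
noncomputable def mollify (r : ℝ) (ν : Measure (Space d)) (x : Space d) : ℝ :=
  ∫ y, moll r (x - y) ∂ν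

/-- The gradient of `mollify r ν`. -/
noncomputable def mollifyGrad (r : ℝ) (ν : Measure (Space d)) (x : Space d) : Space d :=
  ∫ y, gradMoll r (x - y) ∂ν

/-- The logarithmic gradient of `mollify r ν`. -/
noncomputable def mollifyLogGrad (r : ℝ) (ν : Measure (Space d)) (x : Space d) : Space d :=
  (mollify r ν x)⁻¹ • mollifyGrad r ν x

/-- The logarithm of `mollify r ν / weight`. -/
noncomputable def logRatio (r : ℝ) (ν : Measure (Space d)) (x : Space d) : ℝ :=
  Real.log (mollify r ν x) + decay d * logBracket 1 x

/-- The gradient of `logRatio r ν`. -/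
noncomputable def logRatioGrad (r : ℝ) (ν : Measure (Space d)) (x : Space d) : Space d :=
  mollifyLogGrad r ν x + decay d • gradLog 1 x

/-- The maximum of `moll r`. -/
noncomputable def mollMax (d : ℕ) (r : ℝ) : ℝ := (∫ z : Space d, weight z)⁻¹ * r ^ d

variable {r : ℝ} {ν : Measure (Space d)}

lemma mollMax_pos (hr : 0 < r) : 0 < mollMax d r := by
  have := integral_weight_pos (d := d)
  unfold mollMax
  positivity

lemma continuous_moll_sub (r : ℝ) (x : Space d) : Continuous (fun y => moll r (x - y)) :=
  (continuous_moll r).comp (continuous_const.sub continuous_id)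

lemma continuous_gradMoll_sub (r : ℝ) (x : Space d) : Continuous (fun y => gradMoll r (x - y)) :=
  (continuous_gradMoll r).comp (continuous_const.sub continuous_id)

lemma norm_gradMoll_le_const (hr : 0 < r) (x : Space d) :
    ‖gradMoll r x‖ ≤ decay d * r * mollMax d r :=
  (norm_gradMoll_le hr x).trans
    (mul_le_mul_of_nonneg_left (moll_le hr x) (mul_nonneg (decay_pos d).le hr.le))

variable [IsProbabilityMeasure ν]

lemma integrable_moll_sub (hr : 0 < r) (x : Space d) : Integrable (fun y => moll r (x - y)) ν :=
  Integrable.of_bound (continuous_moll_sub r x).aestronglyMeasurable (mollMax d r)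
    (Eventually.of_forall fun y => by
      rw [Real.norm_of_nonneg (moll_pos hr _).le]; exact moll_le hr _)

lemma integrable_gradMoll_sub (hr : 0 < r) (x : Space d) :
    Integrable (fun y => gradMoll r (x - y)) ν :=
  Integrable.of_bound (continuous_gradMoll_sub r x).aestronglyMeasurable
    (decay d * r * mollMax d r) (Eventually.of_forall fun _ => norm_gradMoll_le_const hr _)

lemma mollify_pos (hr : 0 < r) (x : Space d) : 0 < mollify r ν x := by
  rw [mollify, integral_pos_iff_support_of_nonneg (fun y => (moll_pos hr _).le)
    (integrable_moll_sub hr x)]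
  have : Function.support (fun y => moll r (x - y)) = univ := by
    ext y; simp [(moll_pos hr (x - y)).ne']
  simp [this]

lemma mollify_le (hr : 0 < r) (x : Space d) : mollify r ν x ≤ mollMax d r := by
  have := integral_mono (integrable_moll_sub (ν := ν) hr x) (integrable_const (mollMax d r))
    fun y => moll_le hr (x - y)
  simpa [mollify] using this

lemma norm_mollifyGrad_le (hr : 0 < r) (x : Space d) :
    ‖mollifyGrad r ν x‖ ≤ decay d * r * mollify r ν x := by
  rw [mollify, ← integral_const_mul]
  exact norm_integral_le_of_norm_le ((integrable_moll_sub hr x).const_mul _)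
    (Eventually.of_forall fun y => norm_gradMoll_le hr _)

/-- Inherited from the kernel by integrating |∇N| ≤ (d + 2) r N. The bound degenerates as r grows;
it only guarantees that integrals at fixed r converge. -/
lemma norm_mollifyLogGrad_le (hr : 0 < r) (x : Space d) : ‖mollifyLogGrad r ν x‖ ≤ decay d * r := by
  have h := mollify_pos (ν := ν) hr x
  rw [mollifyLogGrad, norm_smul, norm_inv, Real.norm_of_nonneg h.le, inv_mul_le_iff₀ h]
  linarith [norm_mollifyGrad_le (ν := ν) hr x]

lemma norm_logRatioGrad_le (hr : 0 < r) (x : Space d) :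
    ‖logRatioGrad r ν x‖ ≤ decay d * r + decay d := by
  refine (norm_add_le _ _).trans (add_le_add (norm_mollifyLogGrad_le hr x) ?_)
  rw [norm_smul, Real.norm_of_nonneg (decay_pos d).le]
  exact mul_le_of_le_one_right (decay_pos d).le (norm_gradLog_le zero_le_one x)

lemma mollifyGrad_apply (hr : 0 < r) (x : Space d) (i : Fin d) :
    mollifyGrad r ν x i = ∫ y, gradMoll r (x - y) i ∂ν :=
  ((EuclideanSpace.proj (𝕜 := ℝ) i : Space d →L[ℝ] ℝ).integral_comp_comm
    (integrable_gradMoll_sub hr x)).symm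

lemma hasFDerivAt_comp_sub {f : Space d → ℝ} {f' : Space d →L[ℝ] ℝ} {x y : Space d}
    (h : HasFDerivAt f f' (x - y)) : HasFDerivAt (fun x => f (x - y)) f' x := by
  have h2 := h.comp x (hasFDerivAt_sub_const y)
  rwa [ContinuousLinearMap.comp_id] at h2

lemma continuous_innerSL_gradMoll (r : ℝ) :
    Continuous (fun z : Space d => innerSL ℝ (gradMoll r z)) :=
  (innerSL ℝ).continuous.comp (continuous_gradMoll r)

lemma hasFDerivAt_mollify (hr : 0 < r) (x : Space d) :
    HasFDerivAt (mollify r ν) (innerSL ℝ (mollifyGrad r ν x)) x := by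
  have h := hasFDerivAt_integral_of_dominated_of_fderiv_le (μ := ν) (𝕜 := ℝ)
    (F := fun x y => moll r (x - y)) (F' := fun x y => innerSL ℝ (gradMoll r (x - y)))
    (x₀ := x) (bound := fun _ => decay d * r * mollMax d r) univ_mem
    (Eventually.of_forall fun x => (continuous_moll_sub r x).aestronglyMeasurable)
    (integrable_moll_sub hr x)
    ((continuous_innerSL_gradMoll r).comp (continuous_const.sub continuous_id)).aestronglyMeasurable
    (Eventually.of_forall fun y x _ => by
      rw [innerSL_apply_norm]; exact norm_gradMoll_le_const hr _)
    (integrable_const _)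
    (Eventually.of_forall fun y x _ => by
      exact hasFDerivAt_comp_sub (hasFDerivAt_moll r (x - y)))
  refine h.congr_fderiv ?_
  ext v
  rw [ContinuousLinearMap.integral_apply]
  · simp only [innerSL_apply_apply]
    rw [mollifyGrad, real_inner_comm, ← integral_inner (integrable_gradMoll_sub hr x)]
    simp only [real_inner_comm]
  · refine Integrable.of_bound ((continuous_innerSL_gradMoll r).comp
      (continuous_const.sub continuous_id)).aestronglyMeasurable (decay d * r * mollMax d r)
      (Eventually.of_forall fun y => ?_)
    rw [innerSL_apply_norm]; exact norm_gradMoll_le_const hr _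

lemma continuous_mollify (hr : 0 < r) : Continuous (mollify r ν) :=
  continuous_iff_continuousAt.2 fun x => (hasFDerivAt_mollify hr x).continuousAt

lemma continuous_mollifyGrad (hr : 0 < r) : Continuous (mollifyGrad r ν) :=
  continuous_of_dominated (bound := fun _ => decay d * r * mollMax d r)
    (fun x => (continuous_gradMoll_sub r x).aestronglyMeasurable)
    (fun _ => Eventually.of_forall fun _ => norm_gradMoll_le_const hr _) (integrable_const _)
    (Eventually.of_forall fun _ => (continuous_gradMoll r).comp (continuous_id.sub continuous_const))

lemma contDiff_mollify (hr : 0 < r) : ContDiff ℝ 1 (mollify r ν) := by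
  rw [contDiff_one_iff_fderiv]
  refine ⟨fun x => (hasFDerivAt_mollify hr x).differentiableAt, ?_⟩
  rw [show fderiv ℝ (mollify r ν) = fun x => innerSL ℝ (mollifyGrad r ν x) from
    funext fun x => (hasFDerivAt_mollify hr x).fderiv]
  exact (innerSL ℝ).continuous.comp (continuous_mollifyGrad hr)

lemma continuous_mollifyLogGrad (hr : 0 < r) : Continuous (mollifyLogGrad r ν) :=
  ((continuous_mollify hr).inv₀ fun x => (mollify_pos hr x).ne').smul (continuous_mollifyGrad hr)

lemma continuous_logRatioGrad (hr : 0 < r) : Continuous (logRatioGrad r ν) :=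
  (continuous_mollifyLogGrad hr).add ((contDiff_gradLog 1).continuous.const_smul (decay d))

lemma hasFDerivAt_logRatio (hr : 0 < r) (x : Space d) :
    HasFDerivAt (logRatio r ν) (innerSL ℝ (logRatioGrad r ν x)) x := by
  have h := ((hasFDerivAt_mollify (ν := ν) hr x).log (mollify_pos hr x).ne').add
    ((hasFDerivAt_logBracket 1 x).const_mul (decay d))
  refine h.congr_fderiv ?_
  ext v
  simp [logRatioGrad, mollifyLogGrad]

lemma continuous_logRatio (hr : 0 < r) : Continuous (logRatio r ν) :=
  continuous_iff_continuousAt.2 fun x => (hasFDerivAt_logRatio hr x).continuousAt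

/-- Jensen's inequality for the exponential, since the weight is exp(-(d + 2)ℓ). It is obtained by
integrating the tangent line at the value L, the bound of the mean of ℓ. -/
lemma exp_le_integral_weight (hl : Integrable (logBracket 1) ν) {L : ℝ}
    (hL : ∫ y, logBracket 1 y ∂ν ≤ L) : Real.exp (-(decay d * L)) ≤ ∫ y, weight y ∂ν := by
  have hwi : Integrable weight ν := Integrable.of_bound continuous_weight.aestronglyMeasurable 1
    (Eventually.of_forall fun y => by
      rw [Real.norm_of_nonneg (weight_pos y).le, weight, Real.exp_le_one_iff]
      have := mul_nonneg (decay_pos d).le (logBracket_nonneg 1 y)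
      linarith)
  have hpt : ∀ y : Space d, Real.exp (-(decay d * L)) * (1 + decay d * L - decay d * logBracket 1 y)
      ≤ weight y := fun y => by
    have h1 := Real.add_one_le_exp (decay d * L - decay d * logBracket 1 y)
    have h2 : weight y = Real.exp (-(decay d * L)) *
        Real.exp (decay d * L - decay d * logBracket 1 y) := by
      rw [weight, ← Real.exp_add]; congr 1; ring
    rw [h2]
    exact mul_le_mul_of_nonneg_left (by linarith) (Real.exp_pos _).le
  have h3 := integral_mono (((integrable_const (1 + decay d * L)).sub
    (hl.const_mul (decay d))).const_mul (Real.exp (-(decay d * L)))) hwi hpt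
  refine le_trans ?_ h3
  rw [integral_const_mul]
  simp only [Pi.sub_apply]
  rw [integral_sub (integrable_const _) (hl.const_mul _), integral_const_mul]
  have h4 := mul_le_mul_of_nonneg_left hL (decay_pos d).le
  have h5 := Real.exp_pos (-(decay d * L))
  simp only [integral_const, probReal_univ, one_smul]
  nlinarith

/-- The product lower bound of the kernel is integrated in y, and Jensen's inequality bounds ∫
`weight` dν from below by the logarithmic moment. -/
lemma mollify_ge (hr : 1 ≤ r) (hl : Integrable (logBracket 1) ν) {L : ℝ}
    (hL : ∫ y, logBracket 1 y ∂ν ≤ L) (x : Space d) :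
    mollLower d r * Real.exp (-(decay d * L)) * weight x ≤ mollify r ν x := by
  have hr0 : 0 < r := by linarith
  have hwi : Integrable weight ν := Integrable.of_bound continuous_weight.aestronglyMeasurable 1
    (Eventually.of_forall fun y => by
      rw [Real.norm_of_nonneg (weight_pos y).le, weight, Real.exp_le_one_iff]
      have := mul_nonneg (decay_pos d).le (logBracket_nonneg 1 y)
      linarith)
  have h := integral_mono (hwi.const_mul (mollLower d r * weight x))
    (integrable_moll_sub (ν := ν) hr0 x)
    fun y => by simpa [mul_assoc] using mollLower_mul_le hr x y
  rw [integral_const_mul] at h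
  refine le_trans ?_ h
  have h1 := exp_le_integral_weight hl hL
  have h2 := mollLower_pos (d := d) hr0
  have h3 := weight_pos x
  calc _ = mollLower d r * weight x * Real.exp (-(decay d * L)) := by ring
    _ ≤ _ := mul_le_mul_of_nonneg_left h1 (by positivity)

/-- The constant in the bound of `logRatio r ν`. -/
noncomputable def logRatioBound (d : ℕ) (r L : ℝ) : ℝ :=
  |Real.log (mollLower d r)| + |decay d * L| + |Real.log (mollMax d r)| + decay d

lemma logRatioBound_nonneg (d : ℕ) (r L : ℝ) : 0 ≤ logRatioBound d r L := by
  have := decay_pos d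
  unfold logRatioBound; positivity

lemma abs_log_div_weight_le {u : ℝ} {r L : ℝ} {x : Space d} (hr : 0 < r)
    (h1 : mollLower d r * Real.exp (-(decay d * L)) * weight x ≤ u) (h2 : u ≤ mollMax d r) :
    |Real.log u + decay d * logBracket 1 x| ≤ logRatioBound d r L * (1 + logBracket 1 x) := by
  have hw := weight_pos x
  have hm := mollLower_pos (d := d) hr
  have hu : 0 < u := lt_of_lt_of_le (by positivity) h1
  have e1 := Real.log_le_log (by positivity) h1
  rw [Real.log_mul (by positivity) (by positivity), Real.log_mul (by positivity) (by positivity),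
    Real.log_exp, log_weight] at e1
  have e2 := Real.log_le_log hu h2
  have hl := logBracket_nonneg 1 x
  have hd := decay_pos d
  have a1 := neg_abs_le (Real.log (mollLower d r))
  have a2 := le_abs_self (Real.log (mollMax d r))
  have a3 := le_abs_self (decay d * L)
  have a4 := abs_nonneg (Real.log (mollLower d r))
  have a5 := abs_nonneg (Real.log (mollMax d r))
  have a6 := abs_nonneg (decay d * L)
  have a7 : 0 ≤ logRatioBound d r L * logBracket 1 x := mul_nonneg (logRatioBound_nonneg _ _ _) hl
  have a8 : decay d * logBracket 1 x ≤ logRatioBound d r L * logBracket 1 x := by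
    refine mul_le_mul_of_nonneg_right ?_ hl
    unfold logRatioBound; linarith
  rw [abs_le]
  constructor
  · have : |Real.log (mollLower d r)| + |decay d * L| ≤ logRatioBound d r L := by
      unfold logRatioBound; linarith
    linarith
  · have : |Real.log (mollMax d r)| ≤ logRatioBound d r L := by
      unfold logRatioBound; linarith
    linarith

/-- Since c h ≤ u ≤ C, the ratio ln(u/h) grows no faster than ℓ, which is why logarithmic moments
suffice to make the entropy and its rate integrable. -/
lemma abs_logRatio_le (hr : 1 ≤ r) (hl : Integrable (logBracket 1) ν) {L : ℝ}
    (hL : ∫ y, logBracket 1 y ∂ν ≤ L) (x : Space d) :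
    |logRatio r ν x| ≤ logRatioBound d r L * (1 + logBracket 1 x) :=
  abs_log_div_weight_le (by linarith) (mollify_ge hr hl hL x) (mollify_le (by linarith) x)

end Mollification

/-! ### Integration of the kernel against a measure in both variables -/

section Product
variable {d : ℕ} {r : ℝ} {ν : Measure (Space d)}

/-- Follows from `logBracket_le_add`; the constant is free of r because shrinking the kernel, r ≥ 1,
can only reduce its logarithmic moment. -/
lemma integrable_one_add_logBracket_mul_moll_sub (hr : 1 ≤ r) (y : Space d) :
    Integrable (fun x => (1 + logBracket 1 x) * moll r (x - y)) ∧
    ∫ x, (1 + logBracket 1 x) * moll r (x - y) ≤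
      1 + Real.log 2 + mollMoment d + logBracket 1 y := by
  have hr0 : 0 < r := by linarith
  have i1 : Integrable (fun x : Space d => moll r (x - y)) := (integrable_moll hr0).comp_sub_right y
  have i2 : Integrable (fun x : Space d => logBracket 1 (x - y) * moll r (x - y)) :=
    (integrable_logBracket_mul_moll hr).comp_sub_right y
  have i3 := (i1.const_mul (1 + Real.log 2 + logBracket 1 y)).add i2
  have hle : ∀ x : Space d, (1 + logBracket 1 x) * moll r (x - y) ≤
      (1 + Real.log 2 + logBracket 1 y) * moll r (x - y) + logBracket 1 (x - y) * moll r (x - y) :=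
    fun x => by
      rw [← add_mul]
      exact mul_le_mul_of_nonneg_right (by linarith [logBracket_le_add x y]) (moll_pos hr0 _).le
  have hnn : ∀ x : Space d, 0 ≤ (1 + logBracket 1 x) * moll r (x - y) := fun x =>
    mul_nonneg (by linarith [logBracket_nonneg 1 x]) (moll_pos hr0 _).le
  have hi : Integrable (fun x => (1 + logBracket 1 x) * moll r (x - y)) := by
    refine i3.mono' ?_ (Eventually.of_forall fun x => ?_)
    · exact ((continuous_const.add (continuous_logBracket 1)).mul
        ((continuous_moll r).comp (continuous_id.sub continuous_const))).aestronglyMeasurable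
    · rw [Real.norm_of_nonneg (hnn x)]; exact hle x
  refine ⟨hi, (integral_mono hi i3 hle).trans ?_⟩
  simp only [Pi.add_apply]
  rw [integral_add (i1.const_mul _) i2, integral_const_mul,
    integral_sub_right_eq_self (fun x : Space d => moll r x) y, integral_moll hr0,
    integral_sub_right_eq_self (fun x : Space d => logBracket 1 x * moll r x) y]
  linarith [integral_logBracket_mul_moll_le (d := d) hr]

/-- The mollified measure, as a measure on pairs, integrates functions of logarithmic growth. -/
lemma integrable_prod_moll [SFinite ν] (hr : 1 ≤ r) {w : Space d → ℝ} (hw : Measurable w)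
    (hw0 : ∀ y, 0 ≤ w y) (hwi : Integrable w ν) (hlw : Integrable (fun y => logBracket 1 y * w y) ν) :
    Integrable (fun p : Space d × Space d => (1 + logBracket 1 p.1) * w p.2 * moll r (p.1 - p.2))
      (volume.prod ν) := by
  have hr0 : 0 < r := by linarith
  have hm : Measurable (fun p : Space d × Space d =>
      (1 + logBracket 1 p.1) * w p.2 * moll r (p.1 - p.2)) :=
    ((measurable_const.add ((continuous_logBracket 1).measurable.comp measurable_fst)).mul
      (hw.comp measurable_snd)).mul
      ((continuous_moll r).measurable.comp (measurable_fst.sub measurable_snd))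
  rw [integrable_prod_iff' hm.aestronglyMeasurable]
  have e : ∀ x y : Space d, (1 + logBracket 1 x) * w y * moll r (x - y) =
      w y * ((1 + logBracket 1 x) * moll r (x - y)) := fun x y => by ring
  constructor
  · refine Eventually.of_forall fun y => ?_
    simp only [e]
    exact (integrable_one_add_logBracket_mul_moll_sub hr y).1.const_mul _
  · have hnn : ∀ x y : Space d, 0 ≤ w y * ((1 + logBracket 1 x) * moll r (x - y)) := fun x y =>
      mul_nonneg (hw0 y) (mul_nonneg (by linarith [logBracket_nonneg 1 x]) (moll_pos hr0 _).le)
    refine ((hwi.const_mul (1 + Real.log 2 + mollMoment d)).add hlw).mono' ?_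
      (Eventually.of_forall fun y => ?_)
    · exact (hm.norm.stronglyMeasurable.integral_prod_left').aestronglyMeasurable
    · simp only [e, Real.norm_of_nonneg (hnn _ _), integral_const_mul]
      rw [Real.norm_of_nonneg (mul_nonneg (hw0 y) (integral_nonneg fun x =>
        mul_nonneg (by linarith [logBracket_nonneg 1 x]) (moll_pos hr0 _).le))]
      have := mul_le_mul_of_nonneg_left (integrable_one_add_logBracket_mul_moll_sub hr y).2 (hw0 y)
      simp only [Pi.add_apply]
      linarith

lemma integrable_prod_moll_of_integrable [SFinite ν] (hr : 0 < r) {w : Space d → ℝ}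
    (hw : Measurable w) (hw0 : ∀ y, 0 ≤ w y) (hwi : Integrable w ν) :
    Integrable (fun p : Space d × Space d => w p.2 * moll r (p.1 - p.2)) (volume.prod ν) := by
  have hm : Measurable (fun p : Space d × Space d => w p.2 * moll r (p.1 - p.2)) :=
    (hw.comp measurable_snd).mul
      ((continuous_moll r).measurable.comp (measurable_fst.sub measurable_snd))
  rw [integrable_prod_iff' hm.aestronglyMeasurable]
  refine ⟨Eventually.of_forall fun y => ((integrable_moll hr).comp_sub_right y).const_mul (w y), ?_⟩
  refine hwi.congr (Eventually.of_forall fun y => ?_)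
  simp only [Real.norm_of_nonneg (mul_nonneg (hw0 y) (moll_pos hr _).le), integral_const_mul]
  rw [integral_sub_right_eq_self (fun x : Space d => moll r x) y, integral_moll hr, mul_one]

lemma integral_prod_moll [SFinite ν] (hr : 0 < r) {w : Space d → ℝ}
    (hw : Measurable w) (hw0 : ∀ y, 0 ≤ w y) (hwi : Integrable w ν) :
    ∫ p : Space d × Space d, w p.2 * moll r (p.1 - p.2) ∂(volume.prod ν) = ∫ y, w y ∂ν := by
  rw [integral_prod_symm _ (integrable_prod_moll_of_integrable hr hw hw0 hwi)]
  refine integral_congr_ae (Eventually.of_forall fun y => ?_)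
  simp only [integral_const_mul]
  rw [integral_sub_right_eq_self (fun x : Space d => moll r x) y, integral_moll hr, mul_one]

end Product


/-! ### Pointwise dissipation estimate and integration by parts -/

section Dissipation
variable {d : ℕ} {r : ℝ} {ν : Measure (Space d)}

/-- The operator `a^{ij}(y) ∂_{y_i} ∂_{y_j} + b^i(y) ∂_{y_i}` applied to `y ↦ moll r (x - y)`. -/
noncomputable def genMoll (r : ℝ) (a : Space d → Matrix (Fin d) (Fin d) ℝ) (β : Space d → Space d)
    (x y : Space d) : ℝ :=
  ∑ i, ∑ j, a y i j * hessMoll r i j (x - y) - ∑ i, β y i * gradMoll r (x - y) i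

lemma continuous_gradMoll_apply (r : ℝ) (i : Fin d) :
    Continuous (fun z : Space d => gradMoll r z i) :=
  (EuclideanSpace.proj (𝕜 := ℝ) i : Space d →L[ℝ] ℝ).continuous.comp (continuous_gradMoll r)

variable {a : Space d → Matrix (Fin d) (Fin d) ℝ} {β : Space d → Space d} {M α lam L : ℝ}

/-- The constant in the bound of `genMoll`. -/
noncomputable def genMollBound (d : ℕ) (M r : ℝ) : ℝ :=
  d ^ 2 * |M| * ((decay d ^ 2 + 3 * decay d) * r ^ 2) + d * (decay d * r)

lemma genMollBound_nonneg (hr : 0 < r) : 0 ≤ genMollBound d M r := by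
  have := decay_pos d
  unfold genMollBound; positivity

lemma abs_sum_sum_le {f : Fin d → Fin d → ℝ} {c : ℝ} (h : ∀ i j, |f i j| ≤ c) :
    |∑ i, ∑ j, f i j| ≤ d ^ 2 * c := by
  calc _ ≤ ∑ i : Fin d, ∑ j : Fin d, c := by
        refine (Finset.abs_sum_le_sum_abs _ _).trans (Finset.sum_le_sum fun i _ => ?_)
        exact (Finset.abs_sum_le_sum_abs _ _).trans (Finset.sum_le_sum fun j _ => h i j)
    _ = _ := by simp; ring

lemma abs_sum_le {f : Fin d → ℝ} {c : ℝ} (h : ∀ i, |f i| ≤ c) : |∑ i, f i| ≤ d * c := by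
  calc _ ≤ ∑ i : Fin d, c :=
        (Finset.abs_sum_le_sum_abs _ _).trans (Finset.sum_le_sum fun i _ => h i)
    _ = _ := by simp

lemma abs_genMoll_le (hr : 0 < r) (ha : ∀ x i j, |a x i j| ≤ M) (x y : Space d) :
    |genMoll r a β x y| ≤ genMollBound d M r * ((1 + ‖β y‖) * moll r (x - y)) := by
  have hN := moll_pos hr (x - y)
  have hd := decay_pos d
  have h1 : |∑ i, ∑ j, a y i j * hessMoll r i j (x - y)| ≤
      d ^ 2 * (|M| * ((decay d ^ 2 + 3 * decay d) * r ^ 2 * moll r (x - y))) :=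
    abs_sum_sum_le fun i j => by
      rw [abs_mul]
      exact mul_le_mul ((ha y i j).trans (le_abs_self _)) (abs_hessMoll_le hr i j _) (abs_nonneg _)
        (abs_nonneg _)
  have h2 : |∑ i, β y i * gradMoll r (x - y) i| ≤ d * (‖β y‖ * (decay d * r * moll r (x - y))) :=
    abs_sum_le fun i => by
      rw [abs_mul]
      exact mul_le_mul (abs_apply_le_norm _ i)
        ((abs_apply_le_norm _ i).trans (norm_gradMoll_le hr _)) (abs_nonneg _) (norm_nonneg _)
  have h3 : 0 ≤ d ^ 2 * |M| * ((decay d ^ 2 + 3 * decay d) * r ^ 2) * (‖β y‖ * moll r (x - y)) := by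
    positivity
  have h4 : 0 ≤ d * (decay d * r) * moll r (x - y) := by positivity
  calc _ ≤ _ := abs_sub _ _
    _ ≤ _ := add_le_add h1 h2
    _ ≤ _ := by unfold genMollBound; linarith

lemma measurable_genMoll (ha : ∀ i j, Measurable (fun x => a x i j)) (hβ : Measurable β) :
    Measurable (fun p : Space d × Space d => genMoll r a β p.1 p.2) := by
  unfold genMoll
  have hβi : ∀ i, Measurable (fun y => β y i) := fun i => by fun_prop
  refine Measurable.sub (Finset.measurable_fun_sum _ fun i _ => Finset.measurable_fun_sum _ fun j _ => ?_)
    (Finset.measurable_fun_sum _ fun i _ => ?_)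
  · exact ((ha i j).comp measurable_snd).mul
      ((continuous_hessMoll r i j).measurable.comp (measurable_fst.sub measurable_snd))
  · exact ((hβi i).comp measurable_snd).mul
      ((continuous_gradMoll_apply r i).measurable.comp (measurable_fst.sub measurable_snd))

/-- The result of integrating `(logRatio + 1) * genMoll` by parts. -/
noncomputable def fluxMoll (r : ℝ) (ν : Measure (Space d)) (a : Space d → Matrix (Fin d) (Fin d) ℝ)
    (β : Space d → Space d) (x y : Space d) : ℝ :=
  ∑ i, β y i * (logRatioGrad r ν x i * moll r (x - y)) -
    ∑ i, ∑ j, a y i j * (logRatioGrad r ν x i * gradMoll r (x - y) j)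

/-- `fluxMoll` with the coefficient frozen at `x` in the second order part, up to a term that is
small because `a` is Lipschitz. -/
noncomputable def frozenFlux (r : ℝ) (ν : Measure (Space d))
    (a : Space d → Matrix (Fin d) (Fin d) ℝ) (β : Space d → Space d) (x y : Space d) : ℝ :=
  ∑ i, β y i * (logRatioGrad r ν x i * moll r (x - y)) -
    ∑ i, ∑ j, (a y i j - a x i j) * (logRatioGrad r ν x i * gradMoll r (x - y) j) -
    ∑ i, ∑ j, a x i j * (logRatioGrad r ν x i * (moll r (x - y) * mollifyLogGrad r ν x j))

/-- The growth constant of the dissipation estimate. -/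
noncomputable def dissipationConst (d : ℕ) (M lam : ℝ) : ℝ :=
  d ^ 2 * (decay d * (|M| + 2 * lam))

/-- Ellipticity at x supplies -α|g|² with g = ∇ln(u/h). Everything else is linear in |g|: the drift,
the Lipschitz error, and the gap between ∇ln u and g, which is (d + 2)∇ℓ. Young's inequality absorbs
these into half of the coercive term, with constants free of r. -/
lemma frozenFlux_le (hr : 1 ≤ r) (hα : 0 < α) (hlam : 0 ≤ lam) (haM : ∀ x i j, |a x i j| ≤ M)
    (hell : ∀ x, ∀ ξ : Space d, α * ‖ξ‖ ^ 2 ≤ ∑ i, ∑ j, a x i j * ξ i * ξ j)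
    (hlip : ∀ i j x y, |a x i j - a y i j| ≤ lam * ‖x - y‖) (x y : Space d) :
    frozenFlux r ν a β x y ≤ moll r (x - y) * (-(α / 2) * ‖logRatioGrad r ν x‖ ^ 2 +
      α⁻¹ * (dissipationConst d M lam ^ 2 + ‖β y‖ ^ 2)) := by
  have hr0 : 0 < r := by linarith
  have hd := decay_pos d
  set g := logRatioGrad r ν x with hg
  set N := moll r (x - y) with hN
  have hN0 : 0 < N := moll_pos hr0 _
  have hlg : ∀ j, mollifyLogGrad r ν x j = g j - decay d * gradLog 1 x j := fun j => by
    simp [hg, logRatioGrad]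
  have t1 : ∑ i, β y i * (g i * N) ≤ N * (‖g‖ * ‖β y‖) := by
    have h1 : ∑ i, β y i * (g i * N) = N * inner ℝ g (β y) := by
      simp only [PiLp.inner_apply, Finset.mul_sum]
      refine Finset.sum_congr rfl fun i _ => ?_
      simp; ring
    rw [h1]
    exact mul_le_mul_of_nonneg_left (real_inner_le_norm _ _) hN0.le
  -- The Lipschitz factor |x - y| is spent on the gradient of the kernel through the r-free bound of
  -- |z||∇N(z)|.
  have t2 : -∑ i, ∑ j, (a y i j - a x i j) * (g i * gradMoll r (x - y) j) ≤
      d ^ 2 * (‖g‖ * (lam * (2 * decay d * N))) := by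
    refine (neg_le_abs _).trans (abs_sum_sum_le fun i j => ?_)
    rw [abs_mul, abs_mul]
    have h1 := hlip i j y x
    rw [norm_sub_rev] at h1
    have h2 := abs_apply_le_norm (gradMoll r (x - y)) j
    have h3 := norm_mul_norm_gradMoll_le hr0 (x - y)
    calc _ ≤ (lam * ‖x - y‖) * (‖g‖ * ‖gradMoll r (x - y)‖) :=
          mul_le_mul h1 (mul_le_mul (abs_apply_le_norm g i) h2 (abs_nonneg _) (norm_nonneg _))
            (by positivity) (by positivity)
      _ = ‖g‖ * (lam * (‖x - y‖ * ‖gradMoll r (x - y)‖)) := by ring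
      _ ≤ _ := by gcongr
  -- Writing ∇ln u = g - (d + 2)∇ℓ splits the frozen part into the coercive quadratic form in g and
  -- a remainder linear in |g|.
  have t3 : -∑ i, ∑ j, a x i j * (g i * (N * mollifyLogGrad r ν x j)) ≤
      N * (-α * ‖g‖ ^ 2 + d ^ 2 * (|M| * (‖g‖ * decay d))) := by
    have h1 : ∑ i, ∑ j, a x i j * (g i * (N * mollifyLogGrad r ν x j)) =
        N * (∑ i, ∑ j, a x i j * g i * g j -
          ∑ i, ∑ j, a x i j * (g i * (decay d * gradLog 1 x j))) := by
      simp only [hlg, Finset.mul_sum, ← Finset.sum_sub_distrib]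
      refine Finset.sum_congr rfl fun i _ => Finset.sum_congr rfl fun j _ => ?_
      ring
    have h2 : ∑ i, ∑ j, a x i j * (g i * (decay d * gradLog 1 x j)) ≤
        d ^ 2 * (|M| * (‖g‖ * decay d)) := by
      refine (le_abs_self _).trans (abs_sum_sum_le fun i j => ?_)
      rw [abs_mul, abs_mul, abs_mul, abs_of_pos hd]
      have h3 := (abs_apply_le_norm _ j).trans (norm_gradLog_le zero_le_one x)
      refine mul_le_mul ((haM x i j).trans (le_abs_self _)) ?_ (by positivity) (abs_nonneg _)
      exact mul_le_mul (abs_apply_le_norm g i) (by nlinarith) (by positivity) (norm_nonneg _)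
    have h3 := hell x g
    rw [h1, ← mul_neg]
    exact mul_le_mul_of_nonneg_left (by linarith) hN0.le
  have hsum : frozenFlux r ν a β x y ≤ N * (-α * ‖g‖ ^ 2 + dissipationConst d M lam * ‖g‖
      + ‖g‖ * ‖β y‖) := by
    have : frozenFlux r ν a β x y = ∑ i, β y i * (g i * N) +
        -∑ i, ∑ j, (a y i j - a x i j) * (g i * gradMoll r (x - y) j) +
        -∑ i, ∑ j, a x i j * (g i * (N * mollifyLogGrad r ν x j)) := by
      simp only [frozenFlux]; ring
    rw [this]
    refine (add_le_add (add_le_add t1 t2) t3).trans (le_of_eq ?_)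
    unfold dissipationConst
    ring
  refine hsum.trans (mul_le_mul_of_nonneg_left ?_ hN0.le)
  set K := dissipationConst d M lam
  set s := ‖g‖
  -- Each of the two linear terms uses a quarter of α.
  have e1 : K * s ≤ α / 4 * s ^ 2 + α⁻¹ * K ^ 2 := by
    have := sq_nonneg (α / 2 * s - K)
    have h4 : α * (α / 4 * s ^ 2 + α⁻¹ * K ^ 2 - K * s) = (α / 2 * s - K) ^ 2 := by
      field_simp; ring
    nlinarith
  have e2 : s * ‖β y‖ ≤ α / 4 * s ^ 2 + α⁻¹ * ‖β y‖ ^ 2 := by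
    have := sq_nonneg (α / 2 * s - ‖β y‖)
    have h4 : α * (α / 4 * s ^ 2 + α⁻¹ * ‖β y‖ ^ 2 - s * ‖β y‖) = (α / 2 * s - ‖β y‖) ^ 2 := by
      field_simp; ring
    nlinarith
  linarith

lemma integrable_mul_of_le_moll (hr : 1 ≤ r) (y : Space d) {f g : Space d → ℝ} {c k : ℝ}
    (hf : Continuous f) (hg : Continuous g) (hc : 0 ≤ c)
    (hfb : ∀ x, |f x| ≤ c * (1 + logBracket 1 x)) (hgb : ∀ x, |g x| ≤ k * moll r x) :
    Integrable (fun x => f x * g (x - y)) := by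
  refine ((integrable_one_add_logBracket_mul_moll_sub hr y).1.const_mul (c * k)).mono'
    (hf.mul (hg.comp (continuous_id.sub continuous_const))).aestronglyMeasurable
    (Eventually.of_forall fun x => ?_)
  rw [norm_mul]
  calc _ ≤ (c * (1 + logBracket 1 x)) * (k * moll r (x - y)) :=
        mul_le_mul (hfb x) (hgb _) (abs_nonneg _)
          (mul_nonneg hc (by linarith [logBracket_nonneg 1 x]))
    _ = _ := by ring

variable [IsProbabilityMeasure ν]

lemma abs_logRatio_add_one_le (hr : 1 ≤ r) (hl : Integrable (logBracket 1) ν) (x : Space d) :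
    |logRatio r ν x + 1| ≤
      (logRatioBound d r (∫ y, logBracket 1 y ∂ν) + 1) * (1 + logBracket 1 x) := by
  have := logBracket_nonneg 1 x
  have h2 := abs_add_le (logRatio r ν x) 1
  rw [abs_one] at h2
  linarith [abs_logRatio_le hr hl le_rfl x]

/-- Integration by parts in `x` against a function of `x - y` controlled by the kernel. -/
lemma integral_logRatio_mul_fderiv (hr : 1 ≤ r) (hl : Integrable (logBracket 1) ν)
    (i : Fin d) (y : Space d) {g g' : Space d → ℝ} {G : Space d → Space d →L[ℝ] ℝ} {k k' : ℝ}
    (hG : ∀ z, HasFDerivAt g (G z) z) (hGi : ∀ z, G z (EuclideanSpace.single i 1) = g' z)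
    (hgc : Continuous g) (hgc' : Continuous g') (hgb : ∀ z, |g z| ≤ k * moll r z)
    (hgb' : ∀ z, |g' z| ≤ k' * moll r z) :
    ∫ x, (logRatio r ν x + 1) * g' (x - y) = -∫ x, logRatioGrad r ν x i * g (x - y) := by
  have hr0 : 0 < r := by linarith
  have hq1 := abs_logRatio_add_one_le hr hl
  set Cq := logRatioBound d r (∫ y, logBracket 1 y ∂ν) with hCq
  have hCq0 : 0 ≤ Cq := logRatioBound_nonneg _ _ _
  have hbase := (integrable_one_add_logBracket_mul_moll_sub hr y).1
  have hfd : ∀ x, HasFDerivAt (fun x => logRatio r ν x + 1) (innerSL ℝ (logRatioGrad r ν x)) x :=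
    fun x => (hasFDerivAt_logRatio hr0 x).add_const 1
  have hgd : ∀ x, HasFDerivAt (fun x => g (x - y)) (G (x - y)) x := fun x =>
    hasFDerivAt_comp_sub (hG (x - y))
  have hgpd : ∀ x, fderiv ℝ (fun x => g (x - y)) x (EuclideanSpace.single i 1) = g' (x - y) :=
    fun x => by rw [(hgd x).fderiv, hGi]
  have hfpd : ∀ x, fderiv ℝ (fun x => logRatio r ν x + 1) x (EuclideanSpace.single i 1)
      = logRatioGrad r ν x i := fun x => by
    rw [(hfd x).fderiv]; simp [EuclideanSpace.inner_single_right]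
  have cN : Continuous fun x : Space d => x - y := continuous_id.sub continuous_const
  have cq : Continuous fun x => logRatio r ν x + 1 := (continuous_logRatio hr0).add continuous_const
  have cg : Continuous fun x => logRatioGrad r ν x i :=
    (EuclideanSpace.proj (𝕜 := ℝ) i : Space d →L[ℝ] ℝ).continuous.comp (continuous_logRatioGrad hr0)
  have bound : ∀ {f g : Space d → ℝ} {c k : ℝ}, Continuous f → Continuous g → 0 ≤ c →
      (∀ x, |f x| ≤ c * (1 + logBracket 1 x)) → (∀ x, |g x| ≤ k * moll r x) →
      Integrable (fun x => f x * g (x - y)) := fun hf hg hc hfb hgb =>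
    integrable_mul_of_le_moll hr y hf hg hc hfb hgb
  have e := integral_mul_fderiv_eq_neg_fderiv_mul_of_integrable (μ := (volume : Measure (Space d)))
    (f := fun x => logRatio r ν x + 1) (g := fun x => g (x - y))
    (v := EuclideanSpace.single i 1) ?_ ?_ ?_ (fun x _ => (hfd x).differentiableAt)
    (fun x _ => (hgd x).differentiableAt)
  · simpa only [hgpd, hfpd] using e
  · simp only [hfpd]
    refine bound (c := decay d * r + decay d) cg hgc
      (by have := decay_pos d; positivity) (fun x => ?_) hgb
    have h1 := (abs_apply_le_norm _ i).trans (norm_logRatioGrad_le (ν := ν) hr0 x)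
    have h2 : 0 ≤ decay d * r + decay d := by have := decay_pos d; positivity
    nlinarith [logBracket_nonneg 1 x, mul_nonneg h2 (logBracket_nonneg 1 x)]
  · simp only [hgpd]
    exact bound cq hgc' (by linarith) hq1 hgb'
  · exact bound cq hgc (by linarith) hq1 hgb

/-- The integration by parts is in x, with y a parameter, so that the coefficient a(y) is never
differentiated. -/
lemma integral_logRatio_mul_hessMoll (hr : 1 ≤ r) (hl : Integrable (logBracket 1) ν)
    (i j : Fin d) (y : Space d) :
    ∫ x, (logRatio r ν x + 1) * hessMoll r i j (x - y) =
      -∫ x, logRatioGrad r ν x i * gradMoll r (x - y) j :=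
  have hr0 : 0 < r := by linarith
  integral_logRatio_mul_fderiv hr hl i y (hasFDerivAt_gradMoll_apply r j)
    (fun z => by rw [← pd_gradMoll, pd, (hasFDerivAt_gradMoll_apply r j z).fderiv])
    (continuous_gradMoll_apply r j) (continuous_hessMoll r i j)
    (fun z => (abs_apply_le_norm _ j).trans (norm_gradMoll_le hr0 z)) (abs_hessMoll_le hr0 i j)

lemma integral_logRatio_mul_gradMoll (hr : 1 ≤ r) (hl : Integrable (logBracket 1) ν)
    (i : Fin d) (y : Space d) :
    ∫ x, (logRatio r ν x + 1) * gradMoll r (x - y) i =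
      -∫ x, logRatioGrad r ν x i * moll r (x - y) :=
  have hr0 : 0 < r := by linarith
  integral_logRatio_mul_fderiv hr hl i y (hasFDerivAt_moll r)
    (fun z => by simp [EuclideanSpace.inner_single_right])
    (continuous_moll r) (continuous_gradMoll_apply r i)
    (fun z => by rw [abs_of_pos (moll_pos hr0 z), one_mul])
    (fun z => (abs_apply_le_norm _ i).trans (norm_gradMoll_le hr0 z))

lemma integrable_logRatio_mul_genMoll (hr : 1 ≤ r) (ha : ∀ i j, Measurable (fun x => a x i j))
    (haM : ∀ x i j, |a x i j| ≤ M) (hβ : Measurable β) (hβi : Integrable (fun y => ‖β y‖) ν)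
    (hl : Integrable (logBracket 1) ν) (hlβ : Integrable (fun y => logBracket 1 y * ‖β y‖) ν) :
    Integrable (fun p : Space d × Space d => (logRatio r ν p.1 + 1) * genMoll r a β p.1 p.2)
      (volume.prod ν) := by
  have hr0 : 0 < r := by linarith
  have hq1 := abs_logRatio_add_one_le hr hl
  set Cq := logRatioBound d r (∫ y, logBracket 1 y ∂ν) with hCq
  have hCq0 : 0 ≤ Cq := logRatioBound_nonneg _ _ _
  have hbase := integrable_prod_moll (ν := ν) hr (w := fun y => 1 + ‖β y‖)
    (measurable_const.add hβ.norm) (fun y => by positivity) ((integrable_const 1).add hβi)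
    ((hl.add hlβ).congr (Eventually.of_forall fun y => by simp only [Pi.add_apply]; ring))
  refine (hbase.const_mul ((Cq + 1) * genMollBound d M r)).mono' ?_
    (Eventually.of_forall fun p => ?_)
  · exact ((((continuous_logRatio hr0).measurable.comp measurable_fst).add measurable_const).mul
      (measurable_genMoll ha hβ)).aestronglyMeasurable
  · rw [norm_mul]
    calc _ ≤ ((Cq + 1) * (1 + logBracket 1 p.1)) *
          (genMollBound d M r * ((1 + ‖β p.2‖) * moll r (p.1 - p.2))) :=
          mul_le_mul (hq1 _) (abs_genMoll_le hr0 haM _ _) (abs_nonneg _)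
            (mul_nonneg (by linarith) (by linarith [logBracket_nonneg 1 p.1]))
      _ = _ := by ring

end Dissipation


/-! ### The integrated dissipation estimate -/

section Dissipation
variable {d : ℕ} {r : ℝ} {ν : Measure (Space d)} [IsProbabilityMeasure ν]
  {a : Space d → Matrix (Fin d) (Fin d) ℝ} {β : Space d → Space d} {M α lam : ℝ}

lemma integral_sum_sum_sub_sum {X : Type*} [MeasurableSpace X] {m : Measure X}
    {f : Fin d → Fin d → X → ℝ} {g : Fin d → X → ℝ} (hf : ∀ i j, Integrable (f i j) m)
    (hg : ∀ i, Integrable (g i) m) (c : Fin d → Fin d → ℝ) (e : Fin d → ℝ) :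
    ∫ x, (∑ i, ∑ j, c i j * f i j x - ∑ i, e i * g i x) ∂m =
      ∑ i, ∑ j, c i j * ∫ x, f i j x ∂m - ∑ i, e i * ∫ x, g i x ∂m := by
  have h1 : ∀ i j, Integrable (fun x => c i j * f i j x) m := fun i j => (hf i j).const_mul _
  have h2 : ∀ i, Integrable (fun x => e i * g i x) m := fun i => (hg i).const_mul _
  rw [integral_sub (integrable_finsetSum _ fun i _ => integrable_finsetSum _ fun j _ => h1 i j)
      (integrable_finsetSum _ fun i _ => h2 i),
    integral_finsetSum _ fun i _ => integrable_finsetSum _ fun j _ => h1 i j,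
    integral_finsetSum _ fun i _ => h2 i]
  simp only [integral_finsetSum _ fun j _ => h1 _ j, integral_const_mul]

lemma integral_logRatio_mul_genMoll (hr : 1 ≤ r) (hl : Integrable (logBracket 1) ν) (y : Space d) :
    ∫ x, (logRatio r ν x + 1) * genMoll r a β x y = ∫ x, fluxMoll r ν a β x y := by
  have hr0 : 0 < r := by linarith
  have hd := decay_pos d
  have hCq0 := logRatioBound_nonneg d r (∫ y, logBracket 1 y ∂ν)
  have hq1 := abs_logRatio_add_one_le hr hl
  have cq : Continuous fun x => logRatio r ν x + 1 := (continuous_logRatio hr0).add continuous_const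
  have cg : ∀ i, Continuous fun x => logRatioGrad r ν x i := fun i =>
    (EuclideanSpace.proj (𝕜 := ℝ) i : Space d →L[ℝ] ℝ).continuous.comp (continuous_logRatioGrad hr0)
  have hgb : ∀ i x, |logRatioGrad r ν x i| ≤ (decay d * r + decay d) * (1 + logBracket 1 x) :=
    fun i x => by
      have h1 := (abs_apply_le_norm _ i).trans (norm_logRatioGrad_le (ν := ν) hr0 x)
      have h2 : 0 ≤ decay d * r + decay d := by positivity
      nlinarith [logBracket_nonneg 1 x, mul_nonneg h2 (logBracket_nonneg 1 x)]
  have hgm : ∀ (j : Fin d) x, |gradMoll r x j| ≤ decay d * r * moll r x := fun j x =>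
    (abs_apply_le_norm _ j).trans (norm_gradMoll_le hr0 x)
  have hmm : ∀ x : Space d, |moll r x| ≤ 1 * moll r x := fun x => by
    rw [abs_of_pos (moll_pos hr0 x), one_mul]
  have iH : ∀ i j, Integrable (fun x => (logRatio r ν x + 1) * hessMoll r i j (x - y)) := fun i j =>
    integrable_mul_of_le_moll hr y cq (continuous_hessMoll r i j) (by linarith) hq1
      (abs_hessMoll_le hr0 i j)
  have iG : ∀ i, Integrable (fun x => (logRatio r ν x + 1) * gradMoll r (x - y) i) := fun i =>
    integrable_mul_of_le_moll hr y cq (continuous_gradMoll_apply r i) (by linarith) hq1 (hgm i)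
  have iGG : ∀ i j, Integrable (fun x => logRatioGrad r ν x i * gradMoll r (x - y) j) := fun i j =>
    integrable_mul_of_le_moll hr y (cg i) (continuous_gradMoll_apply r j) (by positivity) (hgb i)
      (hgm j)
  have iGM : ∀ i, Integrable (fun x => logRatioGrad r ν x i * moll r (x - y)) := fun i =>
    integrable_mul_of_le_moll hr y (cg i) (continuous_moll r) (by positivity) (hgb i) hmm
  have e1 : ∀ x, (logRatio r ν x + 1) * genMoll r a β x y =
      ∑ i, ∑ j, a y i j * ((logRatio r ν x + 1) * hessMoll r i j (x - y)) -
      ∑ i, β y i * ((logRatio r ν x + 1) * gradMoll r (x - y) i) := fun x => by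
    simp only [genMoll, mul_sub, Finset.mul_sum]
    congr 1
    · exact Finset.sum_congr rfl fun i _ => Finset.sum_congr rfl fun j _ => by ring
    · exact Finset.sum_congr rfl fun i _ => by ring
  simp only [e1, fluxMoll]
  have l1 := integral_sum_sum_sub_sum iH iG (fun i j => a y i j) (fun i => β y i)
  have l2 := integral_sum_sum_sub_sum iGG iGM (fun i j => a y i j) (fun i => β y i)
  rw [l1, ← neg_inj, ← integral_neg]
  simp only [neg_sub]
  rw [l2]
  simp only [integral_logRatio_mul_hessMoll hr hl, integral_logRatio_mul_gradMoll hr hl, mul_neg,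
    Finset.sum_neg_distrib]
  ring

lemma integrable_mollify_mul_sq (hr : 0 < r) :
    Integrable (fun p : Space d × Space d => ‖logRatioGrad r ν p.1‖ ^ 2 * moll r (p.1 - p.2))
      (volume.prod ν) := by
  have hbase := integrable_prod_moll_of_integrable (ν := ν) hr (w := fun _ => 1) measurable_const
    (fun _ => zero_le_one) (integrable_const 1)
  simp only [one_mul] at hbase
  refine hbase.bdd_mul (c := (decay d * r + decay d) ^ 2)
    ((continuous_logRatioGrad hr).norm.pow 2 |>.comp continuous_fst).aestronglyMeasurable
    (Eventually.of_forall fun p => ?_)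
  rw [norm_pow, norm_norm]
  exact pow_le_pow_left₀ (norm_nonneg _) (norm_logRatioGrad_le hr _) 2

lemma integral_prod_sq_mul_moll (hr : 0 < r) :
    Integrable (fun x => mollify r ν x * ‖logRatioGrad r ν x‖ ^ 2) ∧
    ∫ p : Space d × Space d, ‖logRatioGrad r ν p.1‖ ^ 2 * moll r (p.1 - p.2) ∂(volume.prod ν) =
      ∫ x, mollify r ν x * ‖logRatioGrad r ν x‖ ^ 2 := by
  have hi := integrable_mollify_mul_sq (ν := ν) (d := d) hr
  have e : ∀ x, ∫ y, ‖logRatioGrad r ν x‖ ^ 2 * moll r (x - y) ∂ν =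
      mollify r ν x * ‖logRatioGrad r ν x‖ ^ 2 := fun x => by
    rw [integral_const_mul, mollify, mul_comm]
  refine ⟨hi.integral_prod_left.congr (Eventually.of_forall e), ?_⟩
  rw [integral_prod _ hi]
  exact integral_congr_ae (Eventually.of_forall e)

/-- The dissipation of the relative entropy along the mollified equation. -/
theorem integral_logRatio_mul_le (hr : 1 ≤ r) (hα : 0 < α) (hlam : 0 ≤ lam)
    (ha : ∀ i j, Measurable (fun x => a x i j)) (haM : ∀ x i j, |a x i j| ≤ M)
    (hell : ∀ x, ∀ ξ : Space d, α * ‖ξ‖ ^ 2 ≤ ∑ i, ∑ j, a x i j * ξ i * ξ j)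
    (hlip : ∀ i j x y, |a x i j - a y i j| ≤ lam * ‖x - y‖)
    (hβ : Measurable β) (hβ1 : Integrable (fun y => ‖β y‖) ν)
    (hβi : Integrable (fun y => ‖β y‖ ^ 2) ν) (hl : Integrable (logBracket 1) ν)
    (hlβ : Integrable (fun y => logBracket 1 y * ‖β y‖) ν) :
    ∫ x, (logRatio r ν x + 1) * ∫ y, genMoll r a β x y ∂ν ≤
      -(α / 2) * (∫ x, mollify r ν x * ‖logRatioGrad r ν x‖ ^ 2) +
        α⁻¹ * (dissipationConst d M lam ^ 2 + ∫ y, ‖β y‖ ^ 2 ∂ν) := by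
  have hr0 : 0 < r := by linarith
  have hd := decay_pos d
  set B := decay d * r + decay d with hB
  have hB0 : 0 ≤ B := by positivity
  have hgB : ∀ x i, |logRatioGrad r ν x i| ≤ B := fun x i =>
    (abs_apply_le_norm _ i).trans (norm_logRatioGrad_le (ν := ν) hr0 x)
  have hβm : ∀ i, Measurable (fun y => β y i) := fun i => by fun_prop
  have mg : ∀ i, Measurable fun x => logRatioGrad r ν x i := fun i =>
    ((EuclideanSpace.proj (𝕜 := ℝ) i : Space d →L[ℝ] ℝ).continuous.comp
      (continuous_logRatioGrad hr0)).measurable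
  have mlg : ∀ i, Measurable fun x => mollifyLogGrad r ν x i := fun i =>
    ((EuclideanSpace.proj (𝕜 := ℝ) i : Space d →L[ℝ] ℝ).continuous.comp
      (continuous_mollifyLogGrad hr0)).measurable
  have mN : Measurable fun p : Space d × Space d => moll r (p.1 - p.2) :=
    (continuous_moll r).measurable.comp (measurable_fst.sub measurable_snd)
  have mG : ∀ j, Measurable fun p : Space d × Space d => gradMoll r (p.1 - p.2) j := fun j =>
    (continuous_gradMoll_apply r j).measurable.comp (measurable_fst.sub measurable_snd)
  have i1 := integrable_prod_moll_of_integrable (ν := ν) hr0 (w := fun _ => 1) measurable_const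
    (fun _ => zero_le_one) (integrable_const 1)
  have i2 := integrable_prod_moll_of_integrable (ν := ν) hr0 (w := fun y => ‖β y‖) hβ.norm
    (fun _ => norm_nonneg _) hβ1
  have iD : ∀ i j, Integrable (fun p : Space d × Space d => a p.1 i j * (logRatioGrad r ν p.1 i *
      (moll r (p.1 - p.2) * mollifyLogGrad r ν p.1 j - gradMoll r (p.1 - p.2) j)))
      (volume.prod ν) := fun i j => by
    refine (i1.const_mul (|M| * (B * (2 * (decay d * r))))).mono' ?_
      (Eventually.of_forall fun p => ?_)
    · exact (((ha i j).comp measurable_fst).mul (((mg i).comp measurable_fst).mul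
        ((mN.mul ((mlg j).comp measurable_fst)).sub (mG j)))).aestronglyMeasurable
    · have hN := moll_pos hr0 (p.1 - p.2)
      rw [norm_mul, norm_mul]
      have h1 : ‖moll r (p.1 - p.2) * mollifyLogGrad r ν p.1 j - gradMoll r (p.1 - p.2) j‖ ≤
          2 * (decay d * r) * moll r (p.1 - p.2) := by
        refine (norm_sub_le _ _).trans ?_
        have h2 := (abs_apply_le_norm _ j).trans (norm_gradMoll_le hr0 (p.1 - p.2))
        have h3 := (abs_apply_le_norm _ j).trans (norm_mollifyLogGrad_le (ν := ν) hr0 p.1)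
        rw [norm_mul, Real.norm_of_nonneg hN.le, Real.norm_eq_abs, Real.norm_eq_abs]
        have h4 := mul_le_mul_of_nonneg_left h3 hN.le
        linarith
      calc _ ≤ |M| * (B * (2 * (decay d * r) * moll r (p.1 - p.2))) :=
            mul_le_mul ((haM _ i j).trans (le_abs_self _)) (mul_le_mul (hgB _ i) h1 (norm_nonneg _)
              hB0) (by positivity) (abs_nonneg _)
        _ = _ := by ring
  have iF : Integrable (fun p : Space d × Space d => fluxMoll r ν a β p.1 p.2) (volume.prod ν) := by
    refine Integrable.sub (integrable_finsetSum _ fun i _ => ?_)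
      (integrable_finsetSum _ fun i _ => integrable_finsetSum _ fun j _ => ?_)
    · refine (i2.const_mul B).mono' ?_ (Eventually.of_forall fun p => ?_)
      · exact (((hβm i).comp measurable_snd).mul
          (((mg i).comp measurable_fst).mul mN)).aestronglyMeasurable
      · rw [norm_mul, norm_mul, Real.norm_of_nonneg (moll_pos hr0 _).le]
        have hN := moll_pos hr0 (p.1 - p.2)
        calc _ ≤ ‖β p.2‖ * (B * moll r (p.1 - p.2)) :=
              mul_le_mul (abs_apply_le_norm _ i) (mul_le_mul_of_nonneg_right (hgB _ i) hN.le)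
                (by positivity) (norm_nonneg _)
          _ = _ := by ring
    · refine (i1.const_mul (|M| * (B * (decay d * r)))).mono' ?_ (Eventually.of_forall fun p => ?_)
      · exact (((ha i j).comp measurable_snd).mul
          (((mg i).comp measurable_fst).mul (mG j))).aestronglyMeasurable
      · rw [norm_mul, norm_mul]
        have h2 := (abs_apply_le_norm _ j).trans (norm_gradMoll_le hr0 (p.1 - p.2))
        calc _ ≤ |M| * (B * (decay d * r * moll r (p.1 - p.2))) :=
              mul_le_mul ((haM _ i j).trans (le_abs_self _)) (mul_le_mul (hgB _ i) h2 (abs_nonneg _)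
                hB0) (by positivity) (abs_nonneg _)
          _ = _ := by ring
  -- A null correction: for fixed x, ∫ (N ∇ln u - ∇N)(x - y) dν(y) = u∇ln u - ∇u = 0, and the
  -- factors depend on x alone. Subtracting it replaces ∇N by N ∇ln u in the part of the flux frozen
  -- at x, where ellipticity can act.
  set D : Space d × Space d → ℝ := fun p => ∑ i, ∑ j, a p.1 i j * (logRatioGrad r ν p.1 i *
      (moll r (p.1 - p.2) * mollifyLogGrad r ν p.1 j - gradMoll r (p.1 - p.2) j)) with hD
  have iDD : Integrable D (volume.prod ν) :=
    integrable_finsetSum _ fun i _ => integrable_finsetSum _ fun j _ => iD i j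
  have hD0 : ∫ p, D p ∂(volume.prod ν) = 0 := by
    rw [integral_prod _ iDD]
    refine integral_eq_zero_of_ae (Eventually.of_forall fun x => ?_)
    have iM := integrable_moll_sub (ν := ν) hr0 x
    have iGj : ∀ j, Integrable (fun y => gradMoll r (x - y) j) ν := fun j =>
      (EuclideanSpace.proj (𝕜 := ℝ) j : Space d →L[ℝ] ℝ).integrable_comp
        (integrable_gradMoll_sub hr0 x)
    have hz : ∀ i j, ∫ y, a x i j * (logRatioGrad r ν x i *
        (moll r (x - y) * mollifyLogGrad r ν x j - gradMoll r (x - y) j)) ∂ν = 0 := fun i j => by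
      rw [integral_const_mul, integral_const_mul, integral_sub (iM.mul_const _) (iGj j),
        integral_mul_const, ← mollifyGrad_apply hr0]
      have hU := (mollify_pos (ν := ν) hr0 x).ne'
      simp only [mollifyLogGrad, PiLp.smul_apply, smul_eq_mul]
      rw [show ∫ y, moll r (x - y) ∂ν = mollify r ν x from rfl, mul_inv_cancel_left₀ hU]
      ring
    have iz : ∀ i j, Integrable (fun y => a x i j * (logRatioGrad r ν x i *
        (moll r (x - y) * mollifyLogGrad r ν x j - gradMoll r (x - y) j))) ν := fun i j =>
      (((iM.mul_const _).sub (iGj j)).const_mul _).const_mul _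
    simp only [hD, Pi.zero_apply]
    rw [integral_finsetSum _ fun i _ => integrable_finsetSum _ fun j _ => iz i j]
    refine Finset.sum_eq_zero fun i _ => ?_
    rw [integral_finsetSum _ fun j _ => iz i j]
    exact Finset.sum_eq_zero fun j _ => hz i j
  have hfz : ∀ p : Space d × Space d, frozenFlux r ν a β p.1 p.2 =
      fluxMoll r ν a β p.1 p.2 - D p := fun p => by
    simp only [frozenFlux, fluxMoll, hD]
    rw [sub_sub, sub_sub]
    congr 1
    simp only [← Finset.sum_add_distrib]
    refine Finset.sum_congr rfl fun i _ => Finset.sum_congr rfl fun j _ => ?_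
    ring
  have iQ := integrable_logRatio_mul_genMoll hr ha haM hβ hβ1 hl hlβ
  -- Fubini puts the x-integral inside, integration by parts is done for each y, and the null term
  -- `D` turns the flux into its frozen form.
  have e1 : ∫ x, (logRatio r ν x + 1) * ∫ y, genMoll r a β x y ∂ν =
      ∫ p : Space d × Space d, frozenFlux r ν a β p.1 p.2 ∂(volume.prod ν) := by
    simp only [hfz]
    rw [integral_sub iF iDD, hD0, sub_zero, integral_prod_symm _ iF]
    simp only [← integral_const_mul]
    rw [← integral_prod (fun p : Space d × Space d => (logRatio r ν p.1 + 1) * genMoll r a β p.1 p.2)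
      iQ, integral_prod_symm _ iQ]
    exact integral_congr_ae (Eventually.of_forall fun y => integral_logRatio_mul_genMoll hr hl y)
  have iS := integrable_mollify_mul_sq (ν := ν) (d := d) hr0
  have hwm : Measurable fun y => dissipationConst d M lam ^ 2 + ‖β y‖ ^ 2 :=
    measurable_const.add (hβ.norm.pow_const 2)
  have hwi : Integrable (fun y => dissipationConst d M lam ^ 2 + ‖β y‖ ^ 2) ν :=
    (integrable_const _).add hβi
  have iW := integrable_prod_moll_of_integrable (ν := ν) hr0 hwm (fun y => by positivity) hwi
  have e2 : ∫ p : Space d × Space d, (-(α / 2) * (‖logRatioGrad r ν p.1‖ ^ 2 * moll r (p.1 - p.2)) +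
      α⁻¹ * ((dissipationConst d M lam ^ 2 + ‖β p.2‖ ^ 2) * moll r (p.1 - p.2))) ∂(volume.prod ν) =
      -(α / 2) * (∫ x, mollify r ν x * ‖logRatioGrad r ν x‖ ^ 2) +
        α⁻¹ * (dissipationConst d M lam ^ 2 + ∫ y, ‖β y‖ ^ 2 ∂ν) := by
    rw [integral_add (iS.const_mul _) (iW.const_mul _), integral_const_mul, integral_const_mul,
      (integral_prod_sq_mul_moll hr0).2, integral_prod_moll hr0 hwm (fun y => by positivity) hwi,
      integral_add (integrable_const _) hβi]
    simp
  rw [e1, ← e2]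
  refine integral_mono ((iF.sub iDD).congr (Eventually.of_forall fun p => (hfz p).symm))
    ((iS.const_mul _).add (iW.const_mul _)) fun p => ?_
  refine (frozenFlux_le hr hα hlam haM hell hlip p.1 p.2).trans (le_of_eq ?_)
  ring

end Dissipation


/-! ### The chain rule for absolutely continuous functions of time -/

section ChainRule

lemma absolutelyContinuousOnInterval_comp {u Φ : ℝ → ℝ} {a b : ℝ} {S : Set ℝ} {K : ℝ≥0}
    (hΦ : LipschitzOnWith K Φ S) (hu : AbsolutelyContinuousOnInterval u a b)
    (hS : ∀ t ∈ uIcc a b, u t ∈ S) : AbsolutelyContinuousOnInterval (fun t => Φ (u t)) a b := by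
  unfold AbsolutelyContinuousOnInterval at hu ⊢
  refine squeeze_zero' (Eventually.of_forall fun _ => Finset.sum_nonneg fun i _ => dist_nonneg) ?_
    (by simpa using hu.const_mul (K : ℝ))
  rw [eventually_inf_principal]
  refine Eventually.of_forall fun E hE => ?_
  rw [Finset.mul_sum]
  exact Finset.sum_le_sum fun i hi =>
    hΦ.dist_le_mul _ (hS _ (hE.1 i hi).1) _ (hS _ (hE.1 i hi).2)

/-- The density at a point is only absolutely continuous in time. A Lipschitz function of it is
again absolutely continuous, so the fundamental theorem holds with the chain rule almost everywhere.
-/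
lemma comp_primitive_eq {f Φ φ : ℝ → ℝ} {u₀ T : ℝ} {S : Set ℝ} {K : ℝ≥0}
    (hf : IntervalIntegrable f volume 0 T) (hΦ : ∀ v ∈ S, HasDerivAt Φ (φ v) v)
    (hlip : LipschitzOnWith K Φ S) (hS : ∀ t ∈ uIcc 0 T, u₀ + ∫ s in (0 : ℝ)..t, f s ∈ S) :
    Φ (u₀ + ∫ s in (0 : ℝ)..T, f s) =
      Φ u₀ + ∫ t in (0 : ℝ)..T, φ (u₀ + ∫ s in (0 : ℝ)..t, f s) * f t := by
  have hac : AbsolutelyContinuousOnInterval (fun t => u₀ + ∫ s in (0 : ℝ)..t, f s) 0 T := by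
    have h1 : AbsolutelyContinuousOnInterval (fun _ : ℝ => u₀) 0 T :=
      (LipschitzWith.const u₀).lipschitzOnWith.absolutelyContinuousOnInterval
    exact h1.add (hf.absolutelyContinuousOnInterval_intervalIntegral left_mem_uIcc)
  have h := (absolutelyContinuousOnInterval_comp hlip hac hS).integral_deriv_eq_sub
  simp only [intervalIntegral.integral_same, add_zero] at h
  rw [← sub_eq_iff_eq_add', ← h]
  refine intervalIntegral.integral_congr_ae ?_
  filter_upwards [hf.ae_hasDerivAt_integral] with t ht htm
  have ht' := uIoc_subset_uIcc htm
  exact ((hΦ _ (hS t ht')).comp t ((ht ht' 0 left_mem_uIcc).const_add u₀)).deriv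

/-- Continuity upgrades the bound to every time; the point is to reach the endpoints 0 and 1. -/
lemma le_of_ae_le {g : ℝ → ℝ} {c : ℝ} (hg : ContinuousOn g (Icc 0 1))
    (h : ∀ᵐ t ∂timeMeasure, g t ≤ c) : ∀ t ∈ Icc (0 : ℝ) 1, g t ≤ c := by
  intro t ht
  have h1 : (fun t => max (g t) c) =ᵐ[volume.restrict (Icc (0 : ℝ) 1)] fun _ => c := by
    rw [← restrict_Ioo_eq_restrict_Icc]
    filter_upwards [h] with t ht
    exact max_eq_right ht
  have h2 := Measure.eqOn_Icc_of_ae_eq volume zero_ne_one h1 (hg.sup continuousOn_const)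
    continuousOn_const ht
  exact max_eq_right_iff.1 h2

lemma hasDerivAt_mul_log_add {v c : ℝ} (hv : 0 < v) :
    HasDerivAt (fun v => v * (Real.log v + c)) (Real.log v + c + 1) v := by
  have := (hasDerivAt_id v).mul ((Real.hasDerivAt_log hv.ne').add_const c)
  refine this.congr_deriv ?_
  simp only [id]
  field_simp

/-- On [m, K] with m > 0 the function v(ln v + c) is Lipschitz, and the continuous version of u
stays in [m, K] at all times. With c = (d + 2)ℓ(x) it is the density u ln(u/h) at the point x. -/
lemma ae_mul_log_eq {f u : ℝ → ℝ} {u₀ m K c : ℝ} (hf : IntegrableOn f (Ioo (0 : ℝ) 1))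
    (hm : 0 < m) (hu : ∀ᵐ t ∂timeMeasure, u t = u₀ + ∫ s in (0 : ℝ)..t, f s)
    (hmK : ∀ᵐ t ∂timeMeasure, m ≤ u t ∧ u t ≤ K) :
    ∀ᵐ t ∂timeMeasure, u t * (Real.log (u t) + c) =
      u₀ * (Real.log u₀ + c) + ∫ s in (0 : ℝ)..t, (Real.log (u s) + c + 1) * f s := by
  have hfi : IntervalIntegrable f volume 0 1 :=
    (intervalIntegrable_iff_integrableOn_Ioo_of_le zero_le_one).2 hf
  have hcont : ContinuousOn (fun t => u₀ + ∫ s in (0 : ℝ)..t, f s) (Icc 0 1) := by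
    have h1 := intervalIntegral.continuousOn_primitive_interval' hfi left_mem_uIcc
    rw [uIcc_of_le zero_le_one] at h1
    exact continuousOn_const.add h1
  have hK : ∀ t ∈ Icc (0 : ℝ) 1, u₀ + ∫ s in (0 : ℝ)..t, f s ≤ K := le_of_ae_le hcont <| by
    filter_upwards [hu, hmK] with t h1 h2
    rw [← h1]; exact h2.2
  have hm' : ∀ t ∈ Icc (0 : ℝ) 1, -(u₀ + ∫ s in (0 : ℝ)..t, f s) ≤ -m := le_of_ae_le hcont.neg <| by
    filter_upwards [hu, hmK] with t h1 h2
    rw [← h1]; exact neg_le_neg h2.1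
  have hder : ∀ v ∈ Icc m K, HasDerivAt (fun v => v * (Real.log v + c)) (Real.log v + c + 1) v :=
    fun v hv => hasDerivAt_mul_log_add (hm.trans_le hv.1)
  have hlip : ∃ L, LipschitzOnWith L (fun v => v * (Real.log v + c)) (Icc m K) := by
    refine ContDiffOn.exists_lipschitzOnWith (n := 1) ?_ (by decide) (convex_Icc _ _) isCompact_Icc
    exact contDiffOn_id.mul ((contDiffOn_id.log fun v hv => (hm.trans_le hv.1).ne').add
      contDiffOn_const)
  obtain ⟨L, hL⟩ := hlip
  filter_upwards [hu, ae_restrict_mem measurableSet_Ioo] with t ht htm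
  have hsub : uIcc 0 t ⊆ Icc (0 : ℝ) 1 := by
    rw [uIcc_of_le htm.1.le]; exact Icc_subset_Icc_right htm.2.le
  have h := comp_primitive_eq (hfi.mono_set (by rwa [uIcc_of_le zero_le_one])) hder hL
    (u₀ := u₀) (T := t) fun s hs => ⟨by linarith [hm' s (hsub hs)], hK s (hsub hs)⟩
  rw [← ht] at h
  rw [h]
  congr 1
  refine intervalIntegral.integral_congr_ae ?_
  have hu' := (ae_restrict_iff' measurableSet_Ioo).1 hu
  filter_upwards [hu'] with s hs hst
  rw [uIoc_of_le htm.1.le] at hst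
  rw [hs ⟨hst.1, hst.2.trans_lt htm.2⟩]

end ChainRule

/-! ### The evolution equation of the mollified density -/

section MollifiedEvolution
variable {d : ℕ} {A : ℝ × Space d → Matrix (Fin d) (Fin d) ℝ} {b : ℝ × Space d → Space d}
  {κ : Kernel ℝ (Space d)} {M r : ℝ}

lemma pd_comp_sub_left {f : Space d → ℝ} (hf : Differentiable ℝ f) (x : Space d) (i : Fin d)
    (y : Space d) : pd i (fun y => f (x - y)) y = -pd i f (x - y) := by
  have h : HasFDerivAt (fun y => f (x - y)) ((fderiv ℝ f (x - y)).comp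
      (-ContinuousLinearMap.id ℝ (Space d))) y :=
    (hf (x - y)).hasFDerivAt.comp y ((hasFDerivAt_id y).const_sub x)
  simp [pd, h.fderiv]

lemma pd_moll_sub (r : ℝ) (x : Space d) (i : Fin d) (y : Space d) :
    pd i (fun y => moll r (x - y)) y = -gradMoll r (x - y) i := by
  rw [pd_comp_sub_left ((contDiff_moll r).differentiable (by simp)), pd_moll]

lemma pd_pd_moll_sub (r : ℝ) (x : Space d) (i j : Fin d) (y : Space d) :
    pd i (pd j (fun y => moll r (x - y))) y = hessMoll r i j (x - y) := by
  have h1 : pd j (fun y => moll r (x - y)) = fun y => (fun z => (-1) * gradMoll r z j) (x - y) := by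
    ext y; rw [pd_moll_sub]; ring
  have hd : Differentiable ℝ (fun z : Space d => gradMoll r z j) := fun z =>
    (hasFDerivAt_gradMoll_apply r j z).differentiableAt
  rw [h1, pd_comp_sub_left (hd.const_mul (-1)), pd_const_mul hd.differentiableAt, pd_gradMoll]
  ring

/-- One y-derivative of N(x - y) changes sign and two do not, which accounts for the minus sign
before the drift in `genMoll`. -/
lemma gen_moll_sub (r : ℝ) (x : Space d) (s : ℝ) (y : Space d) :
    gen A b (fun y => moll r (x - y)) (s, y) =
      genMoll r (fun y => A (s, y)) (fun y => b (s, y)) x y := by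
  simp only [gen, genMoll, pd_pd_moll_sub, pd_moll_sub, mul_neg, Finset.sum_neg_distrib]
  rfl

lemma exists_hasBoundedDerivs_moll (hr : 0 < r) (x : Space d) :
    ∃ C, HasBoundedDerivs (fun y => moll r (x - y)) C ∧ ∀ y, |moll r (x - y)| ≤ C := by
  have hd := decay_pos d
  have hM := mollMax_pos (d := d) hr
  have hle : ∀ y : Space d, moll r (x - y) ≤ mollMax d r := fun y => moll_le hr _
  refine ⟨(decay d * r + (decay d ^ 2 + 3 * decay d) * r ^ 2 + 1) * mollMax d r, ⟨?_, ?_, ?_⟩, ?_⟩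
  · exact (contDiff_moll r).comp (contDiff_const.sub contDiff_id)
  · intro i y
    rw [pd_moll_sub, abs_neg]
    refine ((abs_apply_le_norm _ i).trans (norm_gradMoll_le_const hr _)).trans ?_
    refine mul_le_mul_of_nonneg_right ?_ hM.le
    have : 0 ≤ (decay d ^ 2 + 3 * decay d) * r ^ 2 := by positivity
    linarith
  · intro i j y
    rw [pd_pd_moll_sub]
    refine (abs_hessMoll_le hr i j _).trans ?_
    refine (mul_le_mul_of_nonneg_left (hle y) (by positivity)).trans ?_
    refine mul_le_mul_of_nonneg_right ?_ hM.le
    have : 0 ≤ decay d * r := by positivity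
    linarith
  · intro y
    rw [abs_of_pos (moll_pos hr _)]
    refine (hle y).trans (le_mul_of_one_le_left hM.le ?_)
    have : 0 ≤ (decay d ^ 2 + 3 * decay d) * r ^ 2 + decay d * r := by positivity
    linarith

/-- The right-hand side of the evolution equation of the mollified density. -/
noncomputable def mollifyRate (A : ℝ × Space d → Matrix (Fin d) (Fin d) ℝ)
    (b : ℝ × Space d → Space d) (κ : Kernel ℝ (Space d)) (r : ℝ) (p : ℝ × Space d) : ℝ :=
  ∫ y, genMoll r (fun y => A (p.1, y)) (fun y => b (p.1, y)) p.2 y ∂(κ p.1)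

variable [IsMarkovKernel κ]

lemma integrableOn_mollifyRate (hE : Evolution A b κ M) (hr : 0 < r) (x : Space d) :
    IntegrableOn (fun t => mollifyRate A b κ r (t, x)) (Ioo (0 : ℝ) 1) := by
  obtain ⟨C, hC, -⟩ := exists_hasBoundedDerivs_moll hr x
  have h := integrableOn_integral (integrable_gen hE hC)
  simp only [gen_moll_sub] at h
  exact h

lemma ae_mollify_eq (hE : Evolution A b κ M) (hr : 0 < r) (x : Space d) :
    ∀ᵐ t ∂timeMeasure, mollify r (κ t) x =
      mollify r (κ 0) x + ∫ s in (0 : ℝ)..t, mollifyRate A b κ r (s, x) := by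
  obtain ⟨C, hC, hC0⟩ := exists_hasBoundedDerivs_moll hr x
  have h := ae_integral_eq hE hC hC0
  simp only [gen_moll_sub] at h
  exact h

lemma measurable_mollify (r : ℝ) :
    Measurable (fun p : ℝ × Space d => mollify r (κ p.1) p.2) := by
  have h : StronglyMeasurable (fun q : (ℝ × Space d) × Space d => moll r (q.1.2 - q.2)) :=
    ((continuous_moll r).comp (by fun_prop)).stronglyMeasurable
  exact (h.integral_kernel_prod_right' (κ := κ.comap Prod.fst measurable_fst)).measurable

lemma measurable_mollifyGrad (r : ℝ) :
    Measurable (fun p : ℝ × Space d => mollifyGrad r (κ p.1) p.2) := by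
  have h : StronglyMeasurable (fun q : (ℝ × Space d) × Space d => gradMoll r (q.1.2 - q.2)) :=
    ((continuous_gradMoll r).comp (by fun_prop)).stronglyMeasurable
  exact (h.integral_kernel_prod_right' (κ := κ.comap Prod.fst measurable_fst)).measurable

lemma measurable_logRatio (r : ℝ) :
    Measurable (fun p : ℝ × Space d => logRatio r (κ p.1) p.2) :=
  (measurable_mollify r).log.add
    (((continuous_logBracket 1).measurable.comp measurable_snd).const_mul _)

lemma measurable_mollifyRate (hE : Evolution A b κ M) :
    Measurable (mollifyRate A b κ r) := by
  have h : StronglyMeasurable (fun q : (ℝ × Space d) × Space d =>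
      genMoll r (fun y => A (q.1.1, y)) (fun y => b (q.1.1, y)) q.1.2 q.2) := by
    refine Measurable.stronglyMeasurable ?_
    have hb : ∀ i, Measurable (fun y => b y i) := fun i => by
      have := hE.measurable_b
      fun_prop
    have hm : Measurable fun q : (ℝ × Space d) × Space d => (q.1.1, q.2) := by fun_prop
    unfold genMoll
    refine Measurable.sub (Finset.measurable_fun_sum _ fun i _ =>
      Finset.measurable_fun_sum _ fun j _ => ?_) (Finset.measurable_fun_sum _ fun i _ => ?_)
    · exact ((hE.measurable_A i j).comp hm).mul
        ((continuous_hessMoll r i j).comp (by fun_prop)).measurable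
    · exact ((hb i).comp hm).mul
        ((continuous_gradMoll_apply r i).comp (by fun_prop)).measurable
  exact (h.integral_kernel_prod_right' (κ := κ.comap Prod.fst measurable_fst)).measurable

end MollifiedEvolution


/-! ### Entropy of a mollified measure at a fixed time -/

section StaticEntropy
variable {d : ℕ} {r : ℝ} {ν : Measure (Space d)} [IsProbabilityMeasure ν]

/-- The constant in the bound of the logarithmic moment of a translated mollifying kernel. -/
noncomputable def momentConst (d : ℕ) : ℝ := 1 + Real.log 2 + mollMoment d

lemma integral_logBracket_mul_mollify_le (hr : 1 ≤ r) {w : Space d → ℝ} (hw : Measurable w)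
    (hw0 : ∀ y, 0 ≤ w y) (hwi : Integrable w ν)
    (hlw : Integrable (fun y => logBracket 1 y * w y) ν) :
    Integrable (fun x => (1 + logBracket 1 x) * ∫ y, w y * moll r (x - y) ∂ν) ∧
    ∫ x, (1 + logBracket 1 x) * ∫ y, w y * moll r (x - y) ∂ν ≤
      ∫ y, (momentConst d + logBracket 1 y) * w y ∂ν := by
  have hi := integrable_prod_moll hr hw hw0 hwi hlw
  have e : ∀ x, ∫ y, (1 + logBracket 1 x) * w y * moll r (x - y) ∂ν =
      (1 + logBracket 1 x) * ∫ y, w y * moll r (x - y) ∂ν := fun x => by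
    simp only [mul_assoc, integral_const_mul]
  have h1 := hi.integral_prod_left
  simp only [e] at h1
  refine ⟨h1, ?_⟩
  have h2 := integral_prod _ hi
  simp only [e] at h2
  rw [← h2, integral_prod_symm _ hi]
  refine integral_mono hi.integral_prod_right ?_ fun y => ?_
  · refine ((hwi.const_mul (momentConst d)).add hlw).congr (Eventually.of_forall fun y => ?_)
    simp only [Pi.add_apply]; ring
  · have e3 : ∀ x, (1 + logBracket 1 x) * w y * moll r (x - y) =
        w y * ((1 + logBracket 1 x) * moll r (x - y)) := fun x => by ring
    simp only [e3, integral_const_mul]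
    rw [mul_comm]
    exact mul_le_mul_of_nonneg_right (integrable_one_add_logBracket_mul_moll_sub hr y).2 (hw0 y)

lemma integrable_mollify_mul_logRatio (hr : 1 ≤ r) (hl : Integrable (logBracket 1) ν) :
    Integrable (fun x => (1 + logBracket 1 x) * mollify r ν x) ∧
    ∫ x, (1 + logBracket 1 x) * mollify r ν x ≤ momentConst d + ∫ y, logBracket 1 y ∂ν ∧
    Integrable (fun x => mollify r ν x * logRatio r ν x) := by
  have hr0 : 0 < r := by linarith
  have h := integral_logBracket_mul_mollify_le (ν := ν) hr (w := fun _ => 1) measurable_const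
    (fun _ => zero_le_one) (integrable_const 1) (by simpa using hl)
  simp only [one_mul, mul_one] at h
  rw [integral_add (integrable_const _) hl] at h
  simp only [integral_const, probReal_univ, smul_eq_mul, one_mul] at h
  refine ⟨h.1, h.2, (h.1.const_mul (logRatioBound d r (∫ y, logBracket 1 y ∂ν))).mono'
    ((continuous_mollify hr0).mul (continuous_logRatio hr0)).aestronglyMeasurable
    (Eventually.of_forall fun x => ?_)⟩
  rw [norm_mul, Real.norm_of_nonneg (mollify_pos hr0 x).le]
  have h3 := mul_le_mul_of_nonneg_left (abs_logRatio_le hr hl le_rfl x) (mollify_pos (ν := ν) hr0 x).le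
  refine h3.trans (le_of_eq ?_)
  change _ = _ * (_ * mollify r ν x)
  ring

/-- Jensen's inequality for `u ↦ u log u`. -/
lemma mollify_mul_log_le (hr : 0 < r) {p : Space d → ℝ} (hp : Measurable p) (hp0 : ∀ x, 0 ≤ p x)
    (hν : ν = volume.withDensity fun x => ENNReal.ofReal (p x))
    (hlog : Integrable fun x => p x * Real.log (p x)) (x : Space d) :
    mollify r ν x * Real.log (mollify r ν x) ≤ ∫ y, |p y * Real.log (p y)| * moll r (x - y) := by
  have hU := mollify_pos (ν := ν) hr x
  have hip : Integrable p := by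
    refine ⟨hp.aestronglyMeasurable, ?_⟩
    have h1 : ν univ = 1 := measure_univ
    rw [hν, withDensity_apply _ MeasurableSet.univ, Measure.restrict_univ] at h1
    rw [hasFiniteIntegral_iff_ofReal (Eventually.of_forall hp0), h1]
    exact ENNReal.one_lt_top
  have hbd : ∀ y : Space d, ‖moll r (x - y)‖ ≤ mollMax d r := fun y => by
    rw [Real.norm_of_nonneg (moll_pos hr _).le]; exact moll_le hr _
  have hm : AEStronglyMeasurable (fun y => moll r (x - y)) := (continuous_moll_sub r x).aestronglyMeasurable
  have i1 : Integrable (fun y => |p y * Real.log (p y)| * moll r (x - y)) :=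
    hlog.abs.mul_bdd (c := mollMax d r) hm (Eventually.of_forall hbd)
  have i2 : Integrable (fun y => p y * moll r (x - y)) :=
    hip.mul_bdd (c := mollMax d r) hm (Eventually.of_forall hbd)
  have i3 : Integrable (fun y => moll r (x - y)) := (integrable_moll hr).comp_sub_left x
  set u := mollify r ν x with hu
  have hue : u = ∫ y, p y * moll r (x - y) := by
    rw [hu, mollify, hν, integral_withDensity_eq_integral_toReal_smul (by fun_prop)
      (Eventually.of_forall fun _ => ENNReal.ofReal_lt_top)]
    refine integral_congr_ae (Eventually.of_forall fun y => ?_)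
    simp [ENNReal.toReal_ofReal (hp0 y)]
  have h3 : ∫ y, moll r (x - y) = 1 := by
    rw [integral_sub_left_eq_self (fun z => moll r z) volume x, integral_moll hr]
  -- The tangent line of v ln v at v = u is integrated against N(x - ·), a probability density; the
  -- linear term drops out since u is the mean of p.
  have key : ∫ y, (u * Real.log u * moll r (x - y) +
      (1 + Real.log u) * (p y * moll r (x - y) - u * moll r (x - y))) ≤
      ∫ y, |p y * Real.log (p y)| * moll r (x - y) := by
    refine integral_mono ((i3.const_mul _).add ((i2.sub (i3.const_mul _)).const_mul _)) i1
      fun y => ?_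
    have hN := (moll_pos hr (x - y)).le
    have hty : u * Real.log u + (1 + Real.log u) * (p y - u) ≤ p y * Real.log (p y) := by
      rcases (hp0 y).eq_or_lt with h0 | h0
      · rw [← h0]; simp; linarith
      · have := Real.log_le_sub_one_of_pos (div_pos hU h0)
        rw [Real.log_div hU.ne' h0.ne', sub_le_iff_le_add] at this
        have h5 := mul_le_mul_of_nonneg_left this h0.le
        have h6 : p y * (u / p y) = u := by field_simp
        nlinarith
    have := mul_le_mul_of_nonneg_right (hty.trans (le_abs_self _)) hN
    simp only
    linarith
  have i5 : Integrable (fun y => p y * moll r (x - y) - u * moll r (x - y)) :=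
    i2.sub (i3.const_mul u)
  rw [integral_add (i3.const_mul _) (i5.const_mul _), integral_const_mul, integral_const_mul, integral_sub i2 (i3.const_mul _), integral_const_mul, h3, ← hue] at key
  linarith

/-- Here u ln(u/h) = u ln u + (d + 2)ℓu: Jensen's inequality bounds the first term by the entropy of
p, the logarithmic moment bounds the second, and neither bound involves r. -/
lemma integral_mollify_mul_logRatio_le (hr : 1 ≤ r) {p : Space d → ℝ} (hp : Measurable p)
    (hp0 : ∀ x, 0 ≤ p x) (hν : ν = volume.withDensity fun x => ENNReal.ofReal (p x))
    (hlog : Integrable fun x => p x * Real.log (p x)) (hl : Integrable (logBracket 1) ν) :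
    ∫ x, mollify r ν x * logRatio r ν x ≤ (∫ x, |p x * Real.log (p x)|) +
      decay d * (momentConst d + ∫ y, logBracket 1 y ∂ν) := by
  have hr0 : 0 < r := by linarith
  have hd := decay_pos d
  have hm : Measurable fun x => |p x * Real.log (p x)| := (hp.mul hp.log).abs
  obtain ⟨h1, h2, h3⟩ := integrable_mollify_mul_logRatio hr hl
  have i4 := (integrable_prod_moll_of_integrable (ν := volume) hr0 hm (fun _ => abs_nonneg _)
    hlog.abs)
  have e4 := integral_prod_moll (ν := volume) hr0 hm (fun _ => abs_nonneg _) hlog.abs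
  rw [integral_prod _ i4] at e4
  calc _ ≤ ∫ x, ((∫ y, |p y * Real.log (p y)| * moll r (x - y)) +
        decay d * ((1 + logBracket 1 x) * mollify r ν x)) := by
        refine integral_mono h3 (i4.integral_prod_left.add (h1.const_mul _)) fun x => ?_
        have h5 := mollify_mul_log_le hr0 hp hp0 hν hlog x
        have h6 := mul_pos hd (mollify_pos (ν := ν) hr0 x)
        simp only [logRatio]
        nlinarith
    _ = _ := by
        rw [integral_add i4.integral_prod_left (h1.const_mul _), e4, integral_const_mul]
    _ ≤ _ := by gcongr

/-- This is ln s ≤ s - 1 at s = h/u. Adding h makes the entropy density nonnegative, so the entropy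
is at least -∫h. -/
lemma sub_weight_le (hr : 0 < r) (x : Space d) :
    mollify r ν x ≤ mollify r ν x * logRatio r ν x + weight x := by
  have hU := mollify_pos (ν := ν) hr x
  have hh := weight_pos x
  have := Real.log_le_sub_one_of_pos (div_pos hh hU)
  rw [Real.log_div hh.ne' hU.ne', log_weight] at this
  have h5 := mul_le_mul_of_nonneg_left this hU.le
  have h6 : mollify r ν x * (weight x / mollify r ν x) = weight x := by field_simp
  simp only [logRatio]
  nlinarith

lemma integral_mollify_eq_one (hr : 0 < r) :
    Integrable (mollify r ν) ∧ ∫ x, mollify r ν x = 1 := by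
  have hi := integrable_prod_moll_of_integrable (ν := ν) hr (w := fun _ => 1) measurable_const
    (fun _ => zero_le_one) (integrable_const 1)
  have h := integral_prod_moll (ν := ν) hr (w := fun _ => 1) measurable_const
    (fun _ => zero_le_one) (integrable_const 1)
  rw [integral_prod _ hi] at h
  have h2 := hi.integral_prod_left
  simp only [one_mul, integral_const, probReal_univ, smul_eq_mul] at h h2
  exact ⟨h2, h⟩

lemma integral_mollify_mul_sq_le (hr : 0 < r) :
    ∫ x, mollify r ν x * ‖logRatioGrad r ν x‖ ^ 2 ≤ (decay d * r + decay d) ^ 2 := by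
  obtain ⟨h1, h2⟩ := integral_mollify_eq_one (ν := ν) hr
  calc _ ≤ ∫ x, mollify r ν x * (decay d * r + decay d) ^ 2 :=
        integral_mono (integral_prod_sq_mul_moll hr).1 (h1.mul_const _) fun x =>
          mul_le_mul_of_nonneg_left (pow_le_pow_left₀ (norm_nonneg _) (norm_logRatioGrad_le hr x) 2)
            (mollify_pos hr x).le
    _ = _ := by rw [integral_mul_const, h2, one_mul]

end StaticEntropy

/-! ### Time slices and logarithmic moments -/

section Slices
variable {d : ℕ} {A : ℝ × Space d → Matrix (Fin d) (Fin d) ℝ} {b : ℝ × Space d → Space d}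
  {κ : Kernel ℝ (Space d)} {M r : ℝ} [IsMarkovKernel κ]

lemma ae_integrable_slice {E : Type*} [NormedAddCommGroup E] {f : ℝ × Space d → E}
    (hf : Integrable f (spaceTime κ)) :
    ∀ᵐ t ∂timeMeasure, Integrable (fun y => f (t, y)) (κ t) :=
  ((Measure.integrable_compProd_iff hf.1).1 hf).1

lemma integral_spaceTime {f : ℝ × Space d → ℝ} (hf : Integrable f (spaceTime κ)) :
    ∫ z, f z ∂(spaceTime κ) = ∫ t, ∫ y, f (t, y) ∂(κ t) ∂timeMeasure :=
  Measure.integral_compProd hf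

lemma lintegral_spaceTime {f : ℝ × Space d → ℝ≥0∞} (hf : Measurable f) :
    ∫⁻ z, f z ∂(spaceTime κ) = ∫⁻ t, ∫⁻ y, f (t, y) ∂(κ t) ∂timeMeasure :=
  Measure.lintegral_compProd hf

lemma measurable_logBracket_snd :
    Measurable (fun z : ℝ × Space d => logBracket 1 z.2) :=
  (continuous_logBracket 1).measurable.comp measurable_snd

/-- The hypotheses Λ ∈ L²(μ) and |b| ∈ L²(μ) meet here: ℓ|b| is dominated by ℓ² + |b|². -/
lemma integrable_logBracket_mul_norm (hE : Evolution A b κ M)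
    (hl : Integrable (fun z => logBracket 1 z.2 ^ 2) (spaceTime κ)) :
    Integrable (fun z => logBracket 1 z.2) (spaceTime κ) ∧
    Integrable (fun z => logBracket 1 z.2 * ‖b z‖) (spaceTime κ) := by
  constructor
  · refine ((integrable_const 1).add hl).mono' measurable_logBracket_snd.aestronglyMeasurable
      (Eventually.of_forall fun z => ?_)
    rw [Real.norm_of_nonneg (logBracket_nonneg _ _)]
    simp only [Pi.add_apply]
    nlinarith [sq_nonneg (logBracket 1 z.2 - 1), logBracket_nonneg 1 z.2]
  · refine (hl.add hE.integrable_sq).mono'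
      (measurable_logBracket_snd.mul hE.measurable_b.norm).aestronglyMeasurable
      (Eventually.of_forall fun z => ?_)
    rw [Real.norm_of_nonneg (mul_nonneg (logBracket_nonneg _ _) (norm_nonneg _))]
    simp only [Pi.add_apply]
    nlinarith [sq_nonneg (logBracket 1 z.2 - ‖b z‖), sq_nonneg (logBracket 1 z.2 + ‖b z‖)]

lemma integrable_of_lintegral_ne_top {ν : Measure (Space d)}
    (h : ∫⁻ x, ENNReal.ofReal (logBracket 1 x) ∂ν ≠ ⊤) : Integrable (logBracket 1) ν :=
  ⟨(continuous_logBracket 1).aestronglyMeasurable,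
    (hasFiniteIntegral_iff_ofReal (Eventually.of_forall (logBracket_nonneg 1))).2 h.lt_top⟩

/-- Some slice has a finite moment because ℓ is μ-integrable. The comparison of moments carries
finiteness back to time 0, and from there uniformly to almost all times. -/
lemma exists_logBracket_moment (hE : Evolution A b κ M)
    (hl : Integrable (fun z => logBracket 1 z.2 ^ 2) (spaceTime κ)) :
    Integrable (logBracket 1) (κ 0) ∧ ∃ L : ℝ, ∀ᵐ t ∂timeMeasure,
      Integrable (logBracket 1) (κ t) ∧ ∫ y, logBracket 1 y ∂(κ t) ≤ L := by
  obtain ⟨D, hD⟩ := exists_moment_bound hE hasBoundedDerivs_logBracket (logBracket_nonneg 1)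
  have hs := ae_integrable_slice (integrable_logBracket_mul_norm hE hl).1
  have h0 : Integrable (logBracket 1) (κ 0) := by
    obtain ⟨t, h1, h2⟩ := (hD.and hs).exists
    refine integrable_of_lintegral_ne_top (ne_top_of_le_ne_top ?_ h1.2)
    refine ENNReal.add_ne_top.2 ⟨?_, ENNReal.coe_ne_top⟩
    exact ((hasFiniteIntegral_iff_ofReal (Eventually.of_forall (logBracket_nonneg 1))).1 h2.2).ne
  refine ⟨h0, ∫ y, logBracket 1 y ∂(κ 0) + D, ?_⟩
  filter_upwards [hD, hs] with t h1 h2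
  refine ⟨h2, ?_⟩
  have h3 := h1.1
  have hn : ∀ ν : Measure (Space d), 0 ≤ ∫ y, logBracket 1 y ∂ν := fun ν =>
    integral_nonneg (logBracket_nonneg 1)
  rw [← ofReal_integral_eq_lintegral_ofReal h2 (Eventually.of_forall (logBracket_nonneg 1)),
    ← ofReal_integral_eq_lintegral_ofReal h0 (Eventually.of_forall (logBracket_nonneg 1)),
    ← ENNReal.ofReal_coe_nnreal, ← ENNReal.ofReal_add (hn (κ 0)) D.coe_nonneg] at h3
  exact (ENNReal.ofReal_le_ofReal_iff (add_nonneg (hn _) D.coe_nonneg)).1 h3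

end Slices


/-! ### Evolution of the entropy of the mollifications -/

section EntropyEvolution
variable {d : ℕ} {A : ℝ × Space d → Matrix (Fin d) (Fin d) ℝ} {b : ℝ × Space d → Space d}
  {κ : Kernel ℝ (Space d)} {M r α lam : ℝ} [IsMarkovKernel κ]

/-- The time derivative of the density of the relative entropy of the mollified measure. -/
noncomputable def entropyRate (A : ℝ × Space d → Matrix (Fin d) (Fin d) ℝ)
    (b : ℝ × Space d → Space d) (κ : Kernel ℝ (Space d)) (r : ℝ) (p : ℝ × Space d) : ℝ :=
  (logRatio r (κ p.1) p.2 + 1) * mollifyRate A b κ r p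

lemma measurable_entropyRate (hE : Evolution A b κ M) : Measurable (entropyRate A b κ r) :=
  ((measurable_logRatio r).add_const 1).mul (measurable_mollifyRate hE)

lemma abs_mollifyRate_le (hE : Evolution A b κ M) (hr : 0 < r) {s : ℝ} (hs : s ∈ Ioo (0 : ℝ) 1)
    (hb : Integrable (fun y => ‖b (s, y)‖) (κ s)) (x : Space d) :
    |mollifyRate A b κ r (s, x)| ≤
      genMollBound d M r * ∫ y, (1 + ‖b (s, y)‖) * moll r (x - y) ∂(κ s) := by
  rw [← integral_const_mul]
  have hle : ∀ y, ‖genMoll r (fun y => A (s, y)) (fun y => b (s, y)) x y‖ ≤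
      genMollBound d M r * ((1 + ‖b (s, y)‖) * moll r (x - y)) := fun y =>
    abs_genMoll_le hr (hE.abs_A_le s hs) x y
  refine norm_integral_le_of_norm_le (Integrable.const_mul ?_ _) (Eventually.of_forall hle)
  refine ((integrable_const 1).add hb).mul_bdd (c := mollMax d r)
    (continuous_moll_sub r x).aestronglyMeasurable (Eventually.of_forall fun y => ?_)
  rw [Real.norm_of_nonneg (moll_pos hr _).le]
  exact moll_le hr _

/-- At fixed r the rate is at most a constant times (1 + ℓ(x)) ∫ (1 + |b|) N(x - y) dμ_t(y).
Integrating in x turns this into ∫ (const + ℓ)(1 + |b|) dμ_t, integrable in time. This justifies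
exchanging dx and dt below. -/
lemma integrable_entropyRate (hE : Evolution A b κ M)
    (hl : Integrable (fun z => logBracket 1 z.2 ^ 2) (spaceTime κ)) (hr : 1 ≤ r) :
    Integrable (entropyRate A b κ r) (timeMeasure.prod volume) := by
  have hr0 : 0 < r := by linarith
  obtain ⟨-, L, hL⟩ := exists_logBracket_moment hE hl
  obtain ⟨hl1, hlb⟩ := integrable_logBracket_mul_norm hE hl
  have hB := hE.integrable_norm
  have hmeas := (measurable_entropyRate (r := r) hE).aestronglyMeasurable
    (μ := timeMeasure.prod (volume : Measure (Space d)))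
  set c := (logRatioBound d r L + 1) * genMollBound d M r with hc
  have hc0 : 0 ≤ c := mul_nonneg (by linarith [logRatioBound_nonneg d r L]) (genMollBound_nonneg hr0)
  have hW : Integrable (fun z : ℝ × Space d => (momentConst d + logBracket 1 z.2) * (1 + ‖b z‖))
      (spaceTime κ) := by
    refine ((((integrable_const (momentConst d)).add hl1)).add
      ((hB.const_mul (momentConst d)).add hlb)).congr (Eventually.of_forall fun z => ?_)
    simp only [Pi.add_apply]; ring
  have hWs := integrableOn_integral hW
  have hslice : ∀ᵐ s ∂timeMeasure, Integrable (fun x => entropyRate A b κ r (s, x)) ∧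
      ∫ x, ‖entropyRate A b κ r (s, x)‖ ≤
        c * ∫ y, (momentConst d + logBracket 1 y) * (1 + ‖b (s, y)‖) ∂(κ s) := by
    filter_upwards [hL, ae_integrable_slice hlb, ae_integrable_slice hB,
      ae_restrict_mem measurableSet_Ioo] with s ⟨hs1, hs2⟩ hs3 hs4 hs
    have hbm : Measurable fun y => b (s, y) := hE.measurable_b.comp (by fun_prop)
    have hw : Measurable fun y => 1 + ‖b (s, y)‖ := measurable_const.add hbm.norm
    obtain ⟨g1, g2⟩ := integral_logBracket_mul_mollify_le (ν := κ s) hr hw (fun y => by positivity)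
      ((integrable_const 1).add hs4)
      ((hs1.add hs3).congr (Eventually.of_forall fun y => by simp only [Pi.add_apply]; ring))
    have hpt : ∀ x, ‖entropyRate A b κ r (s, x)‖ ≤
        c * ((1 + logBracket 1 x) * ∫ y, (1 + ‖b (s, y)‖) * moll r (x - y) ∂(κ s)) := fun x => by
      have h1 := abs_mollifyRate_le hE hr0 hs hs4 x
      have h2 := abs_logRatio_le hr hs1 hs2 x
      have h3 : |logRatio r (κ s) x + 1| ≤ (logRatioBound d r L + 1) * (1 + logBracket 1 x) := by
        have := logBracket_nonneg 1 x
        have h4 := abs_add_le (logRatio r (κ s) x) 1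
        rw [abs_one] at h4
        linarith
      rw [entropyRate, norm_mul, Real.norm_eq_abs, Real.norm_eq_abs]
      refine (mul_le_mul h3 h1 (abs_nonneg _) ((abs_nonneg _).trans h3)).trans (le_of_eq ?_)
      rw [hc]; ring
    have hm : AEStronglyMeasurable (fun x => entropyRate A b κ r (s, x)) :=
      ((measurable_entropyRate hE).comp (by fun_prop : Measurable fun x : Space d => (s, x))
        ).aestronglyMeasurable
    have hi : Integrable (fun x => entropyRate A b κ r (s, x)) :=
      (g1.const_mul c).mono' hm (Eventually.of_forall hpt)
    refine ⟨hi, (integral_mono hi.norm (g1.const_mul c) hpt).trans ?_⟩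
    rw [integral_const_mul]
    exact mul_le_mul_of_nonneg_left g2 hc0
  refine (integrable_prod_iff hmeas).2 ⟨hslice.mono fun s hs => hs.1, ?_⟩
  refine (hWs.const_mul c).mono' hmeas.norm.integral_prod_right' (hslice.mono fun s hs => ?_)
  rw [Real.norm_of_nonneg (integral_nonneg fun _ => norm_nonneg _)]
  exact hs.2

lemma ae_mollify_mul_logRatio_eq (hE : Evolution A b κ M)
    (hl : Integrable (fun z => logBracket 1 z.2 ^ 2) (spaceTime κ)) (hr : 1 ≤ r) :
    ∀ᵐ t ∂timeMeasure, ∀ᵐ x : Space d, mollify r (κ t) x * logRatio r (κ t) x =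
      mollify r (κ 0) x * logRatio r (κ 0) x +
        ∫ s in Iic t, entropyRate A b κ r (s, x) ∂timeMeasure := by
  have hr0 : 0 < r := by linarith
  obtain ⟨-, L, hL⟩ := exists_logBracket_moment hE hl
  -- The variable limit of integration is put into an indicator to make the right-hand side jointly
  -- measurable in (t, x), as the exchange of null sets requires.
  have hind : ∀ t x, ∫ s in Iic t, entropyRate A b κ r (s, x) ∂timeMeasure =
      ∫ s, {q : (ℝ × Space d) × ℝ | q.2 ≤ q.1.1}.indicator
        (fun q => entropyRate A b κ r (q.2, q.1.2)) ((t, x), s) ∂timeMeasure := fun t x => by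
    rw [← integral_indicator measurableSet_Iic]
    rfl
  -- The chain rule gives the identity for each x at almost every t; the entropy needs it at almost
  -- every t for almost every x.
  refine (Measure.ae_ae_comm (μ := timeMeasure) (ν := (volume : Measure (Space d)))
    (p := fun t x => mollify r (κ t) x * logRatio r (κ t) x =
      mollify r (κ 0) x * logRatio r (κ 0) x +
        ∫ s in Iic t, entropyRate A b κ r (s, x) ∂timeMeasure) ?_).2 (Eventually.of_forall fun x => ?_)
  · simp only [hind]
    have hm : Measurable fun p : ℝ × Space d => ∫ s, {q : (ℝ × Space d) × ℝ | q.2 ≤ q.1.1}.indicator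
        (fun q => entropyRate A b κ r (q.2, q.1.2)) (p, s) ∂timeMeasure := by
      refine (StronglyMeasurable.integral_prod_right' (f := {q : (ℝ × Space d) × ℝ |
        q.2 ≤ q.1.1}.indicator (fun q => entropyRate A b κ r (q.2, q.1.2))) ?_).measurable
      refine (Measurable.indicator ?_ ?_).stronglyMeasurable
      · exact (measurable_entropyRate hE).comp (by fun_prop)
      · exact measurableSet_le (by fun_prop) (by fun_prop)
    refine measurableSet_eq_fun ((measurable_mollify r).mul (measurable_logRatio r)) (Measurable.add ?_ hm)
    exact ((continuous_mollify hr0).mul (continuous_logRatio hr0)).measurable.comp measurable_snd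
  · have hw := weight_pos x
    have hml := mollLower_pos (d := d) hr0
    have h := ae_mul_log_eq (c := decay d * logBracket 1 x) (K := mollMax d r)
      (m := mollLower d r * Real.exp (-(decay d * L)) * weight x)
      (integrableOn_mollifyRate hE hr0 x) (by positivity) (ae_mollify_eq hE hr0 x)
      (hL.mono fun t ht => ⟨mollify_ge hr ht.1 ht.2 x, mollify_le hr0 x⟩)
    filter_upwards [h, ae_restrict_mem measurableSet_Ioo] with t ht htm
    simp only [logRatio]
    rw [ht, intervalIntegral.integral_of_le htm.1.le, timeMeasure,
      Measure.restrict_restrict measurableSet_Iic]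
    congr 3
    ext s
    exact ⟨fun h => ⟨h.2, h.1, h.2.trans_lt htm.2⟩, fun h => ⟨h.2.1, h.1⟩⟩

lemma integrable_dissipation (hr : 0 < r) :
    Integrable (fun s => ∫ x, mollify r (κ s) x * ‖logRatioGrad r (κ s) x‖ ^ 2) timeMeasure := by
  have hm : Measurable fun p : ℝ × Space d =>
      mollify r (κ p.1) p.2 * ‖logRatioGrad r (κ p.1) p.2‖ ^ 2 := by
    refine (measurable_mollify r).mul ((Measurable.norm (Measurable.add ?_ ?_)).pow_const 2)
    · exact (measurable_mollify r).inv.smul (measurable_mollifyGrad r)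
    · have hg : Measurable (gradLog 1 : Space d → Space d) :=
        (contDiff_gradLog 1).continuous.measurable
      exact (hg.comp measurable_snd).const_smul (decay d)
  refine (integrable_const ((decay d * r + decay d) ^ 2)).mono'
    hm.stronglyMeasurable.integral_prod_right'.aestronglyMeasurable (Eventually.of_forall fun s => ?_)
  rw [Real.norm_of_nonneg (integral_nonneg fun x => mul_nonneg (mollify_pos hr x).le (sq_nonneg _))]
  exact integral_mollify_mul_sq_le hr

/-- The entropy inequality for the mollified measures. -/
lemma ae_entropy_add_dissipation_le (hE : Evolution A b κ M)
    (hl : Integrable (fun z => logBracket 1 z.2 ^ 2) (spaceTime κ)) (hr : 1 ≤ r) (hα : 0 < α)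
    (hlam : 0 ≤ lam) (hell : ∀ t ∈ Ioo (0 : ℝ) 1, ∀ x, ∀ ξ : Space d,
      α * ‖ξ‖ ^ 2 ≤ ∑ i, ∑ j, A (t, x) i j * ξ i * ξ j)
    (hlip : ∀ t ∈ Ioo (0 : ℝ) 1, ∀ i j x y, |A (t, x) i j - A (t, y) i j| ≤ lam * ‖x - y‖) :
    ∀ᵐ t ∂timeMeasure, (∫ x, mollify r (κ t) x * logRatio r (κ t) x) +
        α / 2 * ∫ s in Iic t, (∫ x, mollify r (κ s) x * ‖logRatioGrad r (κ s) x‖ ^ 2) ∂timeMeasure ≤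
      (∫ x, mollify r (κ 0) x * logRatio r (κ 0) x) +
        α⁻¹ * (dissipationConst d M lam ^ 2 + ∫ z, ‖b z‖ ^ 2 ∂(spaceTime κ)) := by
  have hr0 : 0 < r := by linarith
  obtain ⟨h0, L, hL⟩ := exists_logBracket_moment hE hl
  obtain ⟨hl1, hlb⟩ := integrable_logBracket_mul_norm hE hl
  have hint := integrable_entropyRate hE hl hr
  have hD := integrable_dissipation (κ := κ) hr0
  have hbs := integrableOn_integral hE.integrable_sq
  have hrate : ∀ᵐ s ∂timeMeasure, ∫ x, entropyRate A b κ r (s, x) ≤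
      -(α / 2) * (∫ x, mollify r (κ s) x * ‖logRatioGrad r (κ s) x‖ ^ 2) +
        α⁻¹ * (dissipationConst d M lam ^ 2 + ∫ y, ‖b (s, y)‖ ^ 2 ∂(κ s)) := by
    filter_upwards [hL, ae_integrable_slice hlb, ae_integrable_slice hE.integrable_norm,
      ae_integrable_slice hE.integrable_sq, ae_restrict_mem measurableSet_Ioo]
      with s ⟨hs1, _⟩ hs3 hs4 hs5 hs
    exact integral_logRatio_mul_le (ν := κ s) (a := fun x => A (s, x)) (β := fun x => b (s, x))
      hr hα hlam (fun i j => (hE.measurable_A i j).comp (by fun_prop)) (hE.abs_A_le s hs)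
      (hell s hs) (hlip s hs) (hE.measurable_b.comp (by fun_prop)) hs4 hs5 hs1 hs3
  filter_upwards [ae_mollify_mul_logRatio_eq hE hl hr] with t ht
  have hint' : Integrable (entropyRate A b κ r) ((timeMeasure.restrict (Iic t)).prod volume) := by
    rw [← Measure.restrict_univ (μ := (volume : Measure (Space d))), Measure.prod_restrict]
    exact hint.restrict
  rw [integral_congr_ae ht, integral_add (integrable_mollify_mul_logRatio hr h0).2.2
    hint'.integral_prod_right, ← integral_integral_swap (f := fun s x => entropyRate A b κ r (s, x))
    hint']
  have hbs' : Integrable (fun s => dissipationConst d M lam ^ 2 + ∫ y, ‖b (s, y)‖ ^ 2 ∂(κ s))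
    timeMeasure := (integrable_const _).add hbs
  have h1 : ∫ s in Iic t, (∫ x, entropyRate A b κ r (s, x)) ∂timeMeasure ≤
      ∫ s in Iic t, (-(α / 2) * (∫ x, mollify r (κ s) x * ‖logRatioGrad r (κ s) x‖ ^ 2) +
        α⁻¹ * (dissipationConst d M lam ^ 2 + ∫ y, ‖b (s, y)‖ ^ 2 ∂(κ s))) ∂timeMeasure :=
    integral_mono_ae hint'.integral_prod_left
      ((hD.restrict.const_mul _).add (hbs'.restrict.const_mul _)) (ae_restrict_of_ae hrate)
  rw [integral_add (hD.restrict.const_mul _) (hbs'.restrict.const_mul _), integral_const_mul,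
    integral_const_mul] at h1
  have h2 : ∫ s in Iic t, (dissipationConst d M lam ^ 2 + ∫ y, ‖b (s, y)‖ ^ 2 ∂(κ s)) ∂timeMeasure ≤
      dissipationConst d M lam ^ 2 + ∫ z, ‖b z‖ ^ 2 ∂(spaceTime κ) := by
    refine (setIntegral_le_integral hbs' (Eventually.of_forall fun s => add_nonneg (sq_nonneg _)
      (integral_nonneg fun y => sq_nonneg _))).trans (le_of_eq ?_)
    rw [integral_add (integrable_const _) hbs, integral_spaceTime hE.integrable_sq]
    simp
  have h3 := mul_le_mul_of_nonneg_left h2 (inv_nonneg.2 hα.le)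
  linarith

end EntropyEvolution


/-! ### Bounds uniform in the mollification -/

section UniformBounds
variable {d : ℕ} {A : ℝ × Space d → Matrix (Fin d) (Fin d) ℝ} {b : ℝ × Space d → Space d}
  {κ : Kernel ℝ (Space d)} {M α lam : ℝ} [IsMarkovKernel κ]

/-- The gradients of ln u and ln(u/h) differ by (d + 2)∇ℓ, of norm at most d + 2, and u has unit
mass. -/
lemma lintegral_mollify_mul_logGrad_le {r : ℝ} (hr : 0 < r) (ν : Measure (Space d))
    [IsProbabilityMeasure ν] :
    ∫⁻ x, ENNReal.ofReal (mollify r ν x * ‖mollifyLogGrad r ν x‖ ^ 2) ≤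
      ENNReal.ofReal (2 * (∫ x, mollify r ν x * ‖logRatioGrad r ν x‖ ^ 2) + 2 * decay d ^ 2) := by
  have hd := decay_pos d
  obtain ⟨i1, e1⟩ := integral_mollify_eq_one (ν := ν) hr
  have i2 := (integral_prod_sq_mul_moll (ν := ν) hr).1
  have hi : Integrable (fun x => 2 * (mollify r ν x * ‖logRatioGrad r ν x‖ ^ 2) +
      2 * decay d ^ 2 * mollify r ν x) := (i2.const_mul 2).add (i1.const_mul _)
  have he : ∫ x, (2 * (mollify r ν x * ‖logRatioGrad r ν x‖ ^ 2) +
      2 * decay d ^ 2 * mollify r ν x) =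
      2 * (∫ x, mollify r ν x * ‖logRatioGrad r ν x‖ ^ 2) + 2 * decay d ^ 2 := by
    rw [integral_add (i2.const_mul 2) (i1.const_mul _), integral_const_mul, integral_const_mul, e1,
      mul_one]
  rw [← he, ofReal_integral_eq_lintegral_ofReal hi (Eventually.of_forall fun x => by
    have := mollify_pos (ν := ν) hr x
    positivity)]
  refine lintegral_mono fun x => ENNReal.ofReal_le_ofReal ?_
  have hU := mollify_pos (ν := ν) hr x
  have h1 : ‖mollifyLogGrad r ν x‖ ≤ ‖logRatioGrad r ν x‖ + decay d := by
    have h2 : mollifyLogGrad r ν x = logRatioGrad r ν x - decay d • gradLog 1 x := by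
      simp [logRatioGrad]
    rw [h2]
    refine (norm_sub_le _ _).trans ?_
    rw [norm_smul, Real.norm_of_nonneg hd.le]
    have := mul_le_mul_of_nonneg_left (norm_gradLog_le (zero_le_one) x) hd.le
    linarith
  have h3 : ‖mollifyLogGrad r ν x‖ ^ 2 ≤ 2 * ‖logRatioGrad r ν x‖ ^ 2 + 2 * decay d ^ 2 := by
    refine (pow_le_pow_left₀ (norm_nonneg _) h1 2).trans ?_
    nlinarith [sq_nonneg (‖logRatioGrad r ν x‖ - decay d)]
  have := mul_le_mul_of_nonneg_left h3 hU.le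
  linarith

/-- Bounds of the entropy and of the Fisher information that are uniform in the mollification. -/
theorem exists_entropy_bound (hE : Evolution A b κ M)
    (hl : Integrable (fun z => logBracket 1 z.2 ^ 2) (spaceTime κ)) (hα : 0 < α)
    (hlam : 0 ≤ lam) (hell : ∀ t ∈ Ioo (0 : ℝ) 1, ∀ x, ∀ ξ : Space d,
      α * ‖ξ‖ ^ 2 ≤ ∑ i, ∑ j, A (t, x) i j * ξ i * ξ j)
    (hlip : ∀ t ∈ Ioo (0 : ℝ) 1, ∀ i j x y, |A (t, x) i j - A (t, y) i j| ≤ lam * ‖x - y‖)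
    (hent : HasFiniteEntropy (κ 0)) :
    ∃ C : ℝ, ∀ r : ℝ, 1 ≤ r →
      (∀ᵐ t ∂timeMeasure, ∫⁻ x, ENNReal.ofReal
        (mollify r (κ t) x * logRatio r (κ t) x + weight x) ≤ ENNReal.ofReal C) ∧
      ∫⁻ t, (∫⁻ x, ENNReal.ofReal (mollify r (κ t) x * ‖mollifyLogGrad r (κ t) x‖ ^ 2)) ∂timeMeasure ≤
        ENNReal.ofReal C := by
  obtain ⟨h0, L, hL⟩ := exists_logBracket_moment hE hl
  obtain ⟨p, hp, hp0, hν, hlog⟩ := hent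
  -- Initial entropy plus the drift contribution bounds entropy and dissipation together; the
  -- summand ∫ `weight` compensates for the entropy being bounded below only by -∫ `weight`.
  set R := (∫ x, |p x * Real.log (p x)|) + decay d * (momentConst d + ∫ y, logBracket 1 y ∂(κ 0)) +
    α⁻¹ * (dissipationConst d M lam ^ 2 + ∫ z, ‖b z‖ ^ 2 ∂(spaceTime κ)) +
    ∫ x : Space d, weight x with hR
  set C₂ := 2 * (2 / α * R) + 2 * decay d ^ 2 with hC₂
  refine ⟨max R C₂, fun r hr => ?_⟩
  have hr0 : 0 < r := by linarith
  have hw := integrable_weight (d := d)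
  have hD := integrable_dissipation (κ := κ) hr0
  have hD0 : ∀ s, 0 ≤ ∫ x, mollify r (κ s) x * ‖logRatioGrad r (κ s) x‖ ^ 2 := fun s =>
    integral_nonneg fun x => mul_nonneg (mollify_pos hr0 x).le (sq_nonneg _)
  have hE0 := integral_mollify_mul_logRatio_le (ν := κ 0) hr hp hp0 hν hlog h0
  have hmain := ae_entropy_add_dissipation_le hE hl hr hα hlam hell hlip
  have hlow : ∀ᵐ t ∂timeMeasure,
      Integrable (fun x => mollify r (κ t) x * logRatio r (κ t) x + weight x) ∧
      ∫ x, (mollify r (κ t) x * logRatio r (κ t) x + weight x) =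
        (∫ x, mollify r (κ t) x * logRatio r (κ t) x) + ∫ x : Space d, weight x := by
    filter_upwards [hL] with t ht
    have hi := (integrable_mollify_mul_logRatio hr ht.1).2.2
    exact ⟨hi.add hw, integral_add hi hw⟩
  refine ⟨?_, ?_⟩
  · filter_upwards [hmain, hlow] with t ht hi
    rw [← ofReal_integral_eq_lintegral_ofReal hi.1 (Eventually.of_forall fun x =>
      (mollify_pos (ν := κ t) hr0 x).le.trans (sub_weight_le hr0 x))]
    refine ENNReal.ofReal_le_ofReal (le_max_of_le_left ?_)
    have h2 : 0 ≤ α / 2 * ∫ s in Iic t,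
        (∫ x, mollify r (κ s) x * ‖logRatioGrad r (κ s) x‖ ^ 2) ∂timeMeasure :=
      mul_nonneg (by positivity) (integral_nonneg hD0)
    rw [hi.2, hR]
    linarith
  · have hDI : IntervalIntegrable (fun s => ∫ x, mollify r (κ s) x * ‖logRatioGrad r (κ s) x‖ ^ 2)
      volume 0 1 := (intervalIntegrable_iff_integrableOn_Ioo_of_le zero_le_one).2 hD
    have hcont : ContinuousOn (fun t => ∫ s in (0 : ℝ)..t,
        ∫ x, mollify r (κ s) x * ‖logRatioGrad r (κ s) x‖ ^ 2) (Icc 0 1) := by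
      have h1 := intervalIntegral.continuousOn_primitive_interval' hDI left_mem_uIcc
      rwa [uIcc_of_le zero_le_one] at h1
    -- The entropy inequality bounds the dissipation up to almost every t < 1 by one constant, and
    -- continuity of the primitive carries the bound to t = 1.
    have hb : ∀ᵐ t ∂timeMeasure, ∫ s in (0 : ℝ)..t,
        (∫ x, mollify r (κ s) x * ‖logRatioGrad r (κ s) x‖ ^ 2) ≤ 2 / α * R := by
      filter_upwards [hmain, hlow, ae_restrict_mem measurableSet_Ioo] with t ht hi htm
      have h3 : (0 : ℝ) ≤ ∫ x, (mollify r (κ t) x * logRatio r (κ t) x + weight x) :=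
        integral_nonneg fun x => (mollify_pos (ν := κ t) hr0 x).le.trans (sub_weight_le hr0 x)
      rw [hi.2] at h3
      have e : ∫ s in (0 : ℝ)..t, (∫ x, mollify r (κ s) x * ‖logRatioGrad r (κ s) x‖ ^ 2) =
          ∫ s in Iic t, (∫ x, mollify r (κ s) x * ‖logRatioGrad r (κ s) x‖ ^ 2) ∂timeMeasure := by
        rw [intervalIntegral.integral_of_le htm.1.le, timeMeasure,
          Measure.restrict_restrict measurableSet_Iic]
        congr 2
        ext s
        exact ⟨fun h => ⟨h.2, h.1, h.2.trans_lt htm.2⟩, fun h => ⟨h.2.1, h.1⟩⟩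
      rw [e]
      have h5 : α / 2 * ∫ s in Iic t,
        (∫ x, mollify r (κ s) x * ‖logRatioGrad r (κ s) x‖ ^ 2) ∂timeMeasure ≤ R := by
        rw [hR]; linarith
      calc _ = 2 / α * (α / 2 * ∫ s in Iic t,
            (∫ x, mollify r (κ s) x * ‖logRatioGrad r (κ s) x‖ ^ 2) ∂timeMeasure) := by
            field_simp
        _ ≤ _ := mul_le_mul_of_nonneg_left h5 (by positivity)
    have h1 := le_of_ae_le hcont hb 1 (right_mem_Icc.2 zero_le_one)
    rw [intervalIntegral.integral_of_le zero_le_one, integral_Ioc_eq_integral_Ioo] at h1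
    calc _ ≤ ∫⁻ t, ENNReal.ofReal (2 * (∫ x, mollify r (κ t) x * ‖logRatioGrad r (κ t) x‖ ^ 2) +
          2 * decay d ^ 2) ∂timeMeasure :=
          lintegral_mono fun t => lintegral_mollify_mul_logGrad_le hr0 (κ t)
      _ = ENNReal.ofReal (2 * (∫ t, (∫ x, mollify r (κ t) x * ‖logRatioGrad r (κ t) x‖ ^ 2)
          ∂timeMeasure) + 2 * decay d ^ 2) := by
          have hi2 : Integrable (fun t => 2 * (∫ x, mollify r (κ t) x * ‖logRatioGrad r (κ t) x‖ ^ 2) +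
            2 * decay d ^ 2) timeMeasure := (hD.const_mul 2).add (integrable_const _)
          rw [← ofReal_integral_eq_lintegral_ofReal hi2 (Eventually.of_forall fun t => by
            have := hD0 t
            positivity), integral_add (hD.const_mul 2) (integrable_const _), integral_const_mul]
          simp
      _ ≤ _ := ENNReal.ofReal_le_ofReal (le_max_of_le_right (by rw [hC₂]; linarith))

end UniformBounds


/-! ### Removing the mollification: weak limits and absolute continuity -/

section Mollification
variable {d : ℕ} {r : ℝ} {ν : Measure (Space d)}

/-- The probability measure with density `moll 1`. -/
noncomputable def mollMeasure (d : ℕ) : Measure (Space d) :=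
  volume.withDensity fun z => ENNReal.ofReal (moll 1 z)

lemma measurable_ofReal_moll (r : ℝ) :
    Measurable fun z : Space d => ENNReal.ofReal (moll r z) :=
  (continuous_moll r).measurable.ennreal_ofReal

instance : IsProbabilityMeasure (mollMeasure d) := ⟨by
  rw [mollMeasure, withDensity_apply _ MeasurableSet.univ, Measure.restrict_univ,
    ← ofReal_integral_eq_lintegral_ofReal (integrable_moll one_pos)
      (Eventually.of_forall fun z => (moll_pos one_pos z).le), integral_moll one_pos,
    ENNReal.ofReal_one]⟩

lemma lintegral_mul_moll (hr : 0 < r) {f : Space d → ℝ≥0∞} (hf : Measurable f) :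
    ∫⁻ x, f x * ENNReal.ofReal (moll r x) = ∫⁻ z, f (r⁻¹ • z) ∂(mollMeasure d) := by
  have hf' : Measurable fun z : Space d => f (r⁻¹ • z) := hf.comp (measurable_const_smul _)
  rw [mollMeasure, lintegral_withDensity_eq_lintegral_mul _ (measurable_ofReal_moll 1) hf']
  have h1 : Measurable fun z : Space d => ENNReal.ofReal (moll 1 z) * f (r⁻¹ • z) :=
    (measurable_ofReal_moll 1).mul hf'
  have h := lintegral_map h1 (measurable_const_smul r) (μ := (volume : Measure (Space d)))
  rw [Measure.map_addHaar_smul _ hr.ne', lintegral_smul_measure] at h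
  have hrd : (0 : ℝ) < r ^ d := by positivity
  simp only [finrank_euclideanSpace, Fintype.card_fin] at h
  rw [abs_of_pos (inv_pos.2 hrd)] at h
  have e : ∀ x : Space d, ENNReal.ofReal (moll 1 (r • x)) * f (r⁻¹ • r • x) =
      ENNReal.ofReal (r ^ d)⁻¹ * (f x * ENNReal.ofReal (moll r x)) := fun x => by
    rw [smul_smul, inv_mul_cancel₀ hr.ne', one_smul, mul_left_comm, ← ENNReal.ofReal_mul
      (inv_pos.2 hrd).le, mul_comm]
    congr 2
    rw [moll_eq, moll_eq, one_smul, one_pow]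
    field_simp
  simp only [e] at h
  have hfm : Measurable fun x => f x * ENNReal.ofReal (moll r x) :=
    hf.mul (measurable_ofReal_moll r)
  rw [lintegral_const_mul _ hfm, smul_eq_mul] at h
  exact ((ENNReal.mul_right_inj (by simpa using hrd) ENNReal.ofReal_ne_top).1 h).symm

lemma lintegral_mul_moll_sub (hr : 0 < r) {f : Space d → ℝ≥0∞} (hf : Measurable f) (y : Space d) :
    ∫⁻ x, f x * ENNReal.ofReal (moll r (x - y)) = ∫⁻ z, f (y + r⁻¹ • z) ∂(mollMeasure d) := by
  rw [← lintegral_mul_moll hr (f := fun x => f (y + x)) (hf.comp (measurable_const_add y)),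
    ← lintegral_add_left_eq_self _ y]
  simp

lemma ofReal_mollify [IsProbabilityMeasure ν] (hr : 0 < r) (x : Space d) :
    ENNReal.ofReal (mollify r ν x) = ∫⁻ y, ENNReal.ofReal (moll r (x - y)) ∂ν :=
  ofReal_integral_eq_lintegral_ofReal (integrable_moll_sub hr x)
    (Eventually.of_forall fun _ => (moll_pos hr _).le)

lemma lintegral_mul_lintegral_moll [SFinite ν] (hr : 0 < r) {f : Space d → ℝ≥0∞}
    (hf : Measurable f) {w : Space d → ℝ≥0∞} (hw : Measurable w) :
    ∫⁻ x, f x * ∫⁻ y, w y * ENNReal.ofReal (moll r (x - y)) ∂ν =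
      ∫⁻ y, w y * ∫⁻ z, f (y + r⁻¹ • z) ∂(mollMeasure d) ∂ν := by
  have hm : Measurable fun p : Space d × Space d => ENNReal.ofReal (moll r (p.1 - p.2)) :=
    (measurable_ofReal_moll r).comp (measurable_fst.sub measurable_snd)
  have hx : ∀ x : Space d, Measurable fun y : Space d => w y * ENNReal.ofReal (moll r (x - y)) :=
    fun x => hw.mul ((measurable_ofReal_moll r).comp (measurable_id.const_sub x))
  have hy : ∀ y : Space d, Measurable fun x : Space d => f x * ENNReal.ofReal (moll r (x - y)) :=
    fun y => hf.mul ((measurable_ofReal_moll r).comp (measurable_id.sub_const y))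
  have hF : Measurable fun p : Space d × Space d =>
      f p.1 * (w p.2 * ENNReal.ofReal (moll r (p.1 - p.2))) :=
    (hf.comp measurable_fst).mul ((hw.comp measurable_snd).mul hm)
  have hsw := lintegral_lintegral_swap (μ := volume) (ν := ν)
    (f := fun x y => f x * (w y * ENNReal.ofReal (moll r (x - y)))) hF.aemeasurable
  have hl : ∀ x : Space d, ∫⁻ y, f x * (w y * ENNReal.ofReal (moll r (x - y))) ∂ν =
      f x * ∫⁻ y, w y * ENNReal.ofReal (moll r (x - y)) ∂ν := fun x =>
    lintegral_const_mul (f x) (hx x)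
  have hr' : ∀ y : Space d, ∫⁻ x, f x * (w y * ENNReal.ofReal (moll r (x - y))) =
      w y * ∫⁻ z, f (y + r⁻¹ • z) ∂(mollMeasure d) := fun y => by
    rw [← lintegral_mul_moll_sub hr hf, ← lintegral_const_mul _ (hy y)]
    exact lintegral_congr fun x => by ring
  simp only [hl, hr'] at hsw
  exact hsw

/-- The measure with density `mollify r ν` is the law of `y + r⁻¹ z`. -/
lemma withDensity_mollify [IsProbabilityMeasure ν] (hr : 0 < r) :
    volume.withDensity (fun x => ENNReal.ofReal (mollify r ν x)) =
      (ν.prod (mollMeasure d)).map fun p => p.1 + r⁻¹ • p.2 := by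
  have hs : Measurable fun p : Space d × Space d => p.1 + r⁻¹ • p.2 := by fun_prop
  refine Measure.ext_of_lintegral _ fun f hf => ?_
  rw [lintegral_withDensity_eq_lintegral_mul _ (continuous_mollify hr).measurable.ennreal_ofReal hf,
    lintegral_map hf hs, lintegral_prod (fun p => f (p.1 + r⁻¹ • p.2)) (hf.comp hs).aemeasurable]
  have h := lintegral_mul_lintegral_moll (ν := ν) hr hf (w := fun _ => 1) measurable_const
  simp only [one_mul, ← ofReal_mollify hr] at h
  rw [← h]
  exact lintegral_congr fun x => mul_comm _ _

lemma integral_mul_mollify [IsProbabilityMeasure ν] (hr : 0 < r) {f : Space d → ℝ}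
    (hf : Measurable f) :
    ∫ x, f x * mollify r ν x = ∫ p : Space d × Space d, f (p.1 + r⁻¹ • p.2) ∂(ν.prod (mollMeasure d)) := by
  have hs : Measurable fun p : Space d × Space d => p.1 + r⁻¹ • p.2 := by fun_prop
  rw [← integral_map hs.aemeasurable hf.aestronglyMeasurable, ← withDensity_mollify hr,
    integral_withDensity_eq_integral_toReal_smul
      (continuous_mollify hr).measurable.ennreal_ofReal (Eventually.of_forall fun _ =>
        ENNReal.ofReal_lt_top)]
  refine integral_congr_ae (Eventually.of_forall fun x => ?_)
  simp [ENNReal.toReal_ofReal (mollify_pos (ν := ν) hr x).le, mul_comm]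

/-- The parameters of the approximating mollifications. -/
noncomputable def scale (n : ℕ) : ℝ := n + 1

lemma one_le_scale (n : ℕ) : 1 ≤ scale n := by simp [scale]

lemma scale_pos (n : ℕ) : 0 < scale n := zero_lt_one.trans_le (one_le_scale n)

lemma tendsto_scale_inv_smul (z : Space d) :
    Tendsto (fun n => (scale n)⁻¹ • z) atTop (𝓝 0) := by
  have h : Tendsto (fun n => (scale n)⁻¹) atTop (𝓝 0) := by
    simpa [scale, one_div] using tendsto_one_div_add_atTop_nhds_zero_nat (𝕜 := ℝ)
  simpa using h.smul_const z

/-- As the law of y + z/r, the mollification converges by dominated convergence under a fixed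
product measure. -/
lemma tendsto_integral_mul_mollify [IsProbabilityMeasure ν] {f : Space d → ℝ} {C : ℝ}
    (hf : Continuous f) (hC : ∀ x, |f x| ≤ C) :
    Tendsto (fun n => ∫ x, f x * mollify (scale n) ν x) atTop (𝓝 (∫ x, f x ∂ν)) := by
  have e : ∫ x, f x ∂ν = ∫ p : Space d × Space d, f p.1 ∂(ν.prod (mollMeasure d)) := by
    rw [integral_fun_fst (μ := ν) (ν := mollMeasure d) f]; simp
  rw [e]
  simp only [integral_mul_mollify (scale_pos _) hf.measurable]
  refine tendsto_integral_of_dominated_convergence (fun _ => C)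
    (fun n => (hf.comp (by fun_prop)).aestronglyMeasurable) (integrable_const C)
    (fun n => Eventually.of_forall fun p => hC _) (Eventually.of_forall fun p => ?_)
  refine (hf.tendsto p.1).comp ?_
  simpa using tendsto_const_nhds.add (tendsto_scale_inv_smul p.2)

/-- The portmanteau inequality for open sets: y + z/r eventually lies in O when y does, and Fatou
applies. -/
lemma le_liminf_lintegral_mollify [IsProbabilityMeasure ν] {O : Set (Space d)} (hO : IsOpen O) :
    ν O ≤ liminf (fun n => ∫⁻ x in O, ENNReal.ofReal (mollify (scale n) ν x)) atTop := by
  have hs : ∀ n, Measurable fun p : Space d × Space d => p.1 + (scale n)⁻¹ • p.2 := fun n => by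
    fun_prop
  have e : ∀ n, ∫⁻ x in O, ENNReal.ofReal (mollify (scale n) ν x) =
      ∫⁻ p : Space d × Space d, O.indicator 1 (p.1 + (scale n)⁻¹ • p.2) ∂(ν.prod (mollMeasure d)) :=
    fun n => by
      rw [← withDensity_apply _ hO.measurableSet, withDensity_mollify (scale_pos n),
        ← lintegral_indicator_one hO.measurableSet, lintegral_map _ (hs n)]
      exact measurable_one.indicator hO.measurableSet
  simp only [e]
  refine le_trans ?_ (lintegral_liminf_le fun n =>
    (measurable_one.indicator hO.measurableSet).comp (hs n))
  have h1 : ν O = ∫⁻ p : Space d × Space d, O.indicator 1 p.1 ∂(ν.prod (mollMeasure d)) := by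
    have hm1 : Measurable (O.indicator (1 : Space d → ℝ≥0∞)) :=
      measurable_one.indicator hO.measurableSet
    rw [lintegral_prod (fun p => O.indicator (1 : Space d → ℝ≥0∞) p.1)
      (hm1.comp measurable_fst).aemeasurable]
    simp [lintegral_indicator_one hO.measurableSet]
  rw [h1]
  refine lintegral_mono fun p => ?_
  by_cases hp : p.1 ∈ O
  · refine le_liminf_of_le (by isBoundedDefault) ?_
    have ht : Tendsto (fun n => p.1 + (scale n)⁻¹ • p.2) atTop (𝓝 p.1) := by
      simpa using tendsto_const_nhds.add (tendsto_scale_inv_smul p.2)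
    filter_upwards [ht.eventually (hO.mem_nhds hp)] with n hn
    rw [indicator_of_mem hp, indicator_of_mem (show _ ∈ O from hn)]
    exact le_rfl
  · simp [hp]

/-- A measure whose mollifications have bounded entropy is absolutely continuous. -/
theorem absolutelyContinuous_of_entropy_le [IsProbabilityMeasure ν] {C : ℝ}
    (hC : ∀ n, ∫⁻ x, ENNReal.ofReal (mollify (scale n) ν x * logRatio (scale n) ν x + weight x) ≤
      ENNReal.ofReal C) : ν ≪ volume := by
  -- Split according to whether ln(u/h) ≤ k. If so, u ≤ e^k because h ≤ 1; otherwise u is at most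
  -- 1/k times the entropy density. This is the uniform integrability contained in an entropy bound.
  have hpt : ∀ (n : ℕ) (k : ℝ) (x : Space d), 0 < k → mollify (scale n) ν x ≤ Real.exp k +
      k⁻¹ * (mollify (scale n) ν x * logRatio (scale n) ν x + weight x) := fun n k x hk => by
    have hU := mollify_pos (ν := ν) (scale_pos n) x
    have h1 := sub_weight_le (ν := ν) (scale_pos n) x
    by_cases h2 : logRatio (scale n) ν x ≤ k
    · have h3 : mollify (scale n) ν x ≤ Real.exp k := by
        rw [← Real.log_le_iff_le_exp hU]
        have : 0 ≤ decay d * logBracket 1 x := mul_nonneg (decay_pos d).le (logBracket_nonneg 1 x)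
        simp only [logRatio] at h2
        linarith
      have := mul_nonneg (inv_nonneg.2 hk.le) (hU.le.trans h1)
      linarith
    · have h3 := mul_le_mul_of_nonneg_left (not_le.1 h2).le hU.le
      have h4 := weight_pos x
      have h5 := Real.exp_pos k
      have h6 : mollify (scale n) ν x * k ≤
        mollify (scale n) ν x * logRatio (scale n) ν x + weight x := by linarith
      have h7 := mul_le_mul_of_nonneg_left h6 (inv_nonneg.2 hk.le)
      have h8 : k⁻¹ * (mollify (scale n) ν x * k) = mollify (scale n) ν x := by field_simp
      linarith
  have hopen : ∀ (O : Set (Space d)) (k : ℝ), IsOpen O → 0 < k →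
      ν O ≤ ENNReal.ofReal (Real.exp k) * volume O + ENNReal.ofReal (k⁻¹ * C) := fun O k hO hk => by
    refine (le_liminf_lintegral_mollify hO).trans (liminf_le_of_le (by isBoundedDefault)
      fun b hb => ?_)
    obtain ⟨n, hn⟩ := hb.exists
    refine hn.trans ?_
    calc _ ≤ ∫⁻ x in O, (ENNReal.ofReal (Real.exp k) + ENNReal.ofReal k⁻¹ * ENNReal.ofReal
          (mollify (scale n) ν x * logRatio (scale n) ν x + weight x)) := by
          refine lintegral_mono fun x => ?_
          rw [← ENNReal.ofReal_mul (inv_nonneg.2 hk.le)]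
          exact (ENNReal.ofReal_le_ofReal (hpt n k x hk)).trans ENNReal.ofReal_add_le
      _ ≤ _ := by
          rw [lintegral_add_left measurable_const, lintegral_const,
            Measure.restrict_apply_univ, lintegral_const_mul' _ _ ENNReal.ofReal_ne_top,
            ENNReal.ofReal_mul (inv_nonneg.2 hk.le)]
          gcongr
          exact (setLIntegral_le_lintegral _ _).trans (hC n)
  refine Measure.AbsolutelyContinuous.mk fun s _ hs => ?_
  -- A null set lies in open sets of arbitrarily small volume, which kills the term with e^k; then k
  -- tends to infinity.
  have hk : ∀ k : ℝ, 0 < k → ν s ≤ ENNReal.ofReal (k⁻¹ * C) := fun k hk => by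
    refine ENNReal.le_of_forall_pos_le_add fun ε hε _ => ?_
    have he : ENNReal.ofReal (Real.exp k) ≠ 0 := by simpa using Real.exp_pos k
    obtain ⟨O, hsO, hO, hOv⟩ := s.exists_isOpen_lt_of_lt (μ := volume)
      ((ε : ℝ≥0∞) / ENNReal.ofReal (Real.exp k))
      (by rw [hs]; exact ENNReal.div_pos (by simpa using hε.ne') ENNReal.ofReal_ne_top)
    refine (measure_mono hsO).trans ((hopen O k hO hk).trans ?_)
    rw [add_comm]
    gcongr
    exact (mul_le_mul_right hOv.le _).trans (ENNReal.mul_div_le)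
  have ht : Tendsto (fun k : ℝ => ENNReal.ofReal (k⁻¹ * C)) atTop (𝓝 0) := by
    have := (tendsto_inv_atTop_zero (𝕜 := ℝ)).mul_const C
    rw [zero_mul] at this
    simpa using ENNReal.tendsto_ofReal this
  exact le_antisymm (ge_of_tendsto ht ((eventually_gt_atTop 0).mono fun k h => hk k h)) zero_le

end Mollification

/-! ### Continuity of translations in L¹ -/

section Translation
variable {d : ℕ} {E : Type*} [NormedAddCommGroup E]

/-- The translation action on L¹ is continuous, and the distance of f from its translate is the
integral in question. -/
lemma tendsto_lintegral_translation {f : Space d → E} (hf : Integrable f) :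
    Tendsto (fun v : Space d => ∫⁻ x, ‖f (v + x) - f x‖ₑ) (𝓝 0) (𝓝 0) := by
  have : Fact ((1 : ℝ≥0∞) ≠ ⊤) := ⟨ENNReal.one_ne_top⟩
  have hm : MemLp f 1 (volume : Measure (Space d)) := memLp_one_iff_integrable.2 hf
  have hc : Continuous fun v : Space d => DomAddAct.mk v +ᵥ hm.toLp f :=
    (DomAddAct.continuous_mk).vadd continuous_const
  have h := (hc.tendsto 0).edist (tendsto_const_nhds (x := hm.toLp f))
  simp only [DomAddAct.mk_zero, zero_vadd, edist_self] at h
  refine h.congr fun v => ?_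
  rw [DomAddAct.mk_vadd_toLp, Lp.edist_toLp_toLp, eLpNorm_one_eq_lintegral_enorm]
  rfl

end Translation


/-! ### Riesz representation of functionals bounded through a linear map -/

section Representation

/-- The bound makes l vanish on the kernel of T, so l descends to a bounded functional on the range;
Hahn–Banach extends it to H and Riesz represents it. -/
lemma exists_inner_eq {V H : Type*} [AddCommGroup V] [Module ℝ V] [NormedAddCommGroup H]
    [InnerProductSpace ℝ H] [CompleteSpace H] (T : V →ₗ[ℝ] H) (l : V →ₗ[ℝ] ℝ) (C : ℝ)
    (h : ∀ v, |l v| ≤ C * ‖T v‖) : ∃ w : H, ∀ v, l v = inner ℝ w (T v) := by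
  have hker : T.ker ≤ l.ker := fun v hv => by
    have := h v
    rw [LinearMap.mem_ker.1 hv, norm_zero, mul_zero] at this
    exact LinearMap.mem_ker.2 (abs_nonpos_iff.1 this)
  let g : T.range →ₗ[ℝ] ℝ := (T.ker.liftQ l hker).comp T.quotKerEquivRange.symm.toLinearMap
  have hg : ∀ v, g (T.rangeRestrict v) = l v := fun v => by
    have h1 : T.quotKerEquivRange.symm (T.rangeRestrict v) = T.ker.mkQ v := by
      rw [LinearEquiv.symm_apply_eq]
      rfl
    change T.ker.liftQ l hker (T.quotKerEquivRange.symm (T.rangeRestrict v)) = _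
    rw [h1]
    rfl
  have hb : ∀ y, ‖g y‖ ≤ C * ‖y‖ := by
    rintro ⟨_, v, rfl⟩
    have h1 := h v
    rw [← hg] at h1
    exact h1
  obtain ⟨G, hG, -⟩ := exists_extension_norm_eq T.range (g.mkContinuous C hb)
  refine ⟨(InnerProductSpace.toDual ℝ H).symm G, fun v => ?_⟩
  rw [InnerProductSpace.toDual_symm_apply]
  exact (hg v).symm.trans (hG (T.rangeRestrict v)).symm

lemma exists_memLp_two_rep {X V : Type*} [MeasurableSpace X] {P : Measure X} [AddCommGroup V]
    [Module ℝ V] (φ : V →ₗ[ℝ] (X → ℝ)) (l : V →ₗ[ℝ] ℝ) (hφ : ∀ v, MemLp (φ v) 2 P) (C : ℝ)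
    (h : ∀ v, |l v| ≤ C * √(∫ x, φ v x ^ 2 ∂P)) :
    ∃ g : X → ℝ, Measurable g ∧ MemLp g 2 P ∧ ∀ v, l v = ∫ x, g x * φ v x ∂P := by
  let T : V →ₗ[ℝ] Lp ℝ 2 P :=
    { toFun := fun v => (hφ v).toLp (φ v)
      map_add' := fun v w => by
        rw [← MemLp.toLp_add]; congr 1; exact map_add φ v w
      map_smul' := fun c v => by
        rw [RingHom.id_apply, ← MemLp.toLp_const_smul]; congr 1; exact map_smul φ c v }
  have hT : ∀ v, ‖T v‖ = √(∫ x, φ v x ^ 2 ∂P) := fun v => by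
    rw [← Real.sqrt_sq (norm_nonneg (T v)), ← real_inner_self_eq_norm_sq, L2.inner_def]
    congr 1
    refine integral_congr_ae ((hφ v).coeFn_toLp.mono fun x hx => ?_)
    change inner ℝ ((hφ v).toLp (φ v) x) ((hφ v).toLp (φ v) x) = _
    rw [hx]
    simp [sq]
  obtain ⟨w, hw⟩ := exists_inner_eq T l C fun v => by rw [hT]; exact h v
  refine ⟨w, (Lp.stronglyMeasurable w).measurable, Lp.memLp w, fun v => ?_⟩
  rw [hw, L2.inner_def]
  refine integral_congr_ae ((hφ v).coeFn_toLp.mono fun x hx => ?_)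
  change inner ℝ (w x) ((hφ v).toLp (φ v) x) = _
  rw [hx]
  simp [mul_comm]

/-- The discriminant of a nonnegative quadratic in ε. Cauchy–Schwarz is used in this form because
the inequality with fixed ε involves only plain integrals. -/
lemma le_sqrt_mul_sqrt {a X C : ℝ} (hX : 0 ≤ X) (hC : 0 ≤ C)
    (h : ∀ ε : ℝ, 0 < ε → |a| ≤ ε / 2 * X + 1 / (2 * ε) * C) : |a| ≤ √C * √X := by
  have h1 : ∀ ε : ℝ, 0 ≤ X * (ε * ε) + (-2 * |a|) * ε + C := fun ε => by
    rcases le_or_gt ε 0 with h0 | h0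
    · have h2 := mul_nonneg hX (mul_self_nonneg ε)
      have h3 := mul_nonneg (abs_nonneg a) (neg_nonneg.2 h0)
      linarith
    · have h2 := mul_le_mul_of_nonneg_left (h ε h0) (mul_pos two_pos h0).le
      have h3 : 2 * ε * (ε / 2 * X + 1 / (2 * ε) * C) = X * (ε * ε) + C := by field_simp
      linarith
  have h4 := discrim_le_zero h1
  rw [← Real.sqrt_mul hC]
  refine Real.le_sqrt_of_sq_le ?_
  simp only [discrim] at h4
  nlinarith

end Representation

/-! ### A jointly measurable density -/

section Density
variable {d : ℕ} {κ : Kernel ℝ (Space d)} [IsMarkovKernel κ]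

/-- A jointly measurable density of an absolutely continuous kernel. -/
lemma exists_density (h : ∀ᵐ t ∂timeMeasure, κ t ≪ volume) :
    ∃ ρ : ℝ × Space d → ℝ, Measurable ρ ∧ (∀ z, 0 ≤ ρ z) ∧ ∀ᵐ t ∂timeMeasure,
      κ t = volume.withDensity fun x => ENNReal.ofReal (ρ (t, x)) := by
  have hwm : Measurable fun x : Space d => ENNReal.ofReal (weight x) :=
    continuous_weight.measurable.ennreal_ofReal
  -- The finite measure `weight` dx has the same null sets as Lebesgue measure and is a suitable
  -- reference for the kernel Radon–Nikodym derivative; the weight is multiplied back afterwards.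
  set wm : Measure (Space d) := volume.withDensity fun x => ENNReal.ofReal (weight x) with hwmd
  have hfin : IsFiniteMeasure wm := by
    refine isFiniteMeasure_withDensity_ofReal ?_
    exact integrable_weight.2
  have hac : (volume : Measure (Space d)) ≪ wm :=
    withDensity_absolutelyContinuous' hwm.aemeasurable
      (Eventually.of_forall fun x => by simpa using weight_pos x)
  set η : Kernel ℝ (Space d) := Kernel.const ℝ wm with hη
  have hm := Kernel.measurable_rnDeriv κ η
  refine ⟨fun z => (κ.rnDeriv η z.1 z.2).toReal * weight z.2, ?_, fun z =>
    mul_nonneg ENNReal.toReal_nonneg (weight_pos _).le, ?_⟩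
  · exact hm.ennreal_toReal.mul (continuous_weight.measurable.comp measurable_snd)
  · filter_upwards [h] with t ht
    have h1 : κ t ≪ η t := ht.trans hac
    have hmt : Measurable fun x => κ.rnDeriv η t x :=
      hm.comp (by fun_prop : Measurable fun x : Space d => (t, x))
    rw [← Kernel.withDensity_rnDeriv_eq h1, Kernel.withDensity_apply _ hm, hη, Kernel.const_apply,
      hwmd, ← withDensity_mul _ hwm hmt]
    refine withDensity_congr_ae ?_
    have h2 : ∀ᵐ x : Space d, κ.rnDeriv η t x ≠ ⊤ := hac.ae_le (Kernel.rnDeriv_ne_top κ η (a := t))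
    filter_upwards [h2] with x hx
    rw [ENNReal.ofReal_mul ENNReal.toReal_nonneg, ENNReal.ofReal_toReal hx, Pi.mul_apply, mul_comm]

end Density

/-! ### The Fisher bound as a bound of a functional on test functions -/

section LogarithmicGradient
variable {d : ℕ} {κ : Kernel ℝ (Space d)}

/-- Bounded functions on the space-time, continuous in space, with the second one the derivative
of the first one in the `i`-th spatial direction. -/
structure IsTestPair (i : Fin d) (φ ψ : ℝ × Space d → ℝ) : Prop where
  measurable_left : Measurable φ
  measurable_right : Measurable ψ
  bounded : ∃ C : ℝ, ∀ z, |φ z| ≤ C ∧ |ψ z| ≤ C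
  continuous_left : ∀ t, Continuous fun x => φ (t, x)
  continuous_right : ∀ t, Continuous fun x => ψ (t, x)
  hasLineDerivAt : ∀ t x, HasLineDerivAt ℝ (fun x => φ (t, x)) (ψ (t, x)) x (EuclideanSpace.single i 1)

/-- The space of test pairs. -/
def testPairs (i : Fin d) : Submodule ℝ ((ℝ × Space d → ℝ) × (ℝ × Space d → ℝ)) where
  carrier := {p | IsTestPair i p.1 p.2}
  add_mem' {p q} hp hq := by
    obtain ⟨C, hC⟩ := hp.bounded
    obtain ⟨D, hD⟩ := hq.bounded
    exact ⟨hp.1.add hq.1, hp.2.add hq.2, ⟨C + D, fun z => ⟨(abs_add_le _ _).trans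
      (add_le_add (hC z).1 (hD z).1), (abs_add_le _ _).trans (add_le_add (hC z).2 (hD z).2)⟩⟩,
      fun t => (hp.4 t).add (hq.4 t), fun t => (hp.5 t).add (hq.5 t),
      fun t x => (hp.6 t x).fun_add (hq.6 t x)⟩
  zero_mem' := ⟨measurable_const, measurable_const, ⟨0, fun z => by simp⟩,
    fun t => continuous_const, fun t => continuous_const, fun t x => by
      simpa [HasLineDerivAt] using hasDerivAt_const (0 : ℝ) (0 : ℝ)⟩
  smul_mem' c p hp := by
    obtain ⟨C, hC⟩ := hp.bounded
    exact ⟨hp.1.const_smul c, hp.2.const_smul c, ⟨|c| * C, fun z => by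
      simp only [Prod.smul_fst, Prod.smul_snd, Pi.smul_apply, smul_eq_mul, abs_mul]
      exact ⟨mul_le_mul_of_nonneg_left (hC z).1 (abs_nonneg c),
        mul_le_mul_of_nonneg_left (hC z).2 (abs_nonneg c)⟩⟩,
      fun t => (hp.4 t).const_smul c, fun t => (hp.5 t).const_smul c,
      fun t x => (hp.6 t x).fun_const_smul c⟩

variable [IsMarkovKernel κ]

lemma integrable_mollify_prod {r : ℝ} (hr : 0 < r) :
    Integrable (fun p : ℝ × Space d => mollify r (κ p.1) p.2) (timeMeasure.prod volume) := by
  refine (integrable_prod_iff (measurable_mollify r).aestronglyMeasurable).2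
    ⟨Eventually.of_forall fun t => (integral_mollify_eq_one (ν := κ t) hr).1, ?_⟩
  have : ∀ t, ∫ x, ‖mollify r (κ t) x‖ = 1 := fun t => by
    rw [← (integral_mollify_eq_one (ν := κ t) hr).2]
    exact integral_congr_ae (Eventually.of_forall fun x =>
      Real.norm_of_nonneg (mollify_pos hr x).le)
  simp only [this]
  exact integrable_const 1

lemma integrable_mul_mollify_prod {r : ℝ} (hr : 0 < r) {f : ℝ × Space d → ℝ} (hf : Measurable f)
    {C : ℝ} (hC : ∀ z, |f z| ≤ C) :
    Integrable (fun p : ℝ × Space d => f p * mollify r (κ p.1) p.2) (timeMeasure.prod volume) :=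
  (integrable_mollify_prod hr).bdd_mul hf.aestronglyMeasurable (Eventually.of_forall hC)

lemma tendsto_integral_mul_mollify_prod {f : ℝ × Space d → ℝ} (hf : Measurable f) {C : ℝ}
    (hC : ∀ z, |f z| ≤ C) (hc : ∀ t, Continuous fun x => f (t, x)) :
    Tendsto (fun n => ∫ p, f p * mollify (scale n) (κ p.1) p.2 ∂(timeMeasure.prod volume)) atTop
      (𝓝 (∫ z, f z ∂(spaceTime κ))) := by
  have hi : Integrable f (spaceTime κ) :=
    (integrable_const C).mono' hf.aestronglyMeasurable (Eventually.of_forall hC)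
  rw [integral_spaceTime hi]
  have e : ∀ n, ∫ p, f p * mollify (scale n) (κ p.1) p.2 ∂(timeMeasure.prod volume) =
      ∫ t, (∫ x, f (t, x) * mollify (scale n) (κ t) x) ∂timeMeasure := fun n =>
    integral_prod _ (integrable_mul_mollify_prod (scale_pos n) hf hC)
  simp only [e]
  refine tendsto_integral_of_dominated_convergence (fun _ => C)
    (fun n => (integrable_mul_mollify_prod (scale_pos n) hf hC).integral_prod_left.1)
    (integrable_const C) (fun n => Eventually.of_forall fun t => ?_)
    (Eventually.of_forall fun t => tendsto_integral_mul_mollify (hc t) fun x => hC _)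
  obtain ⟨h1, h2⟩ := integral_mollify_eq_one (ν := κ t) (scale_pos n)
  calc _ ≤ ∫ x, C * mollify (scale n) (κ t) x :=
        norm_integral_le_of_norm_le (h1.const_mul C) (Eventually.of_forall fun x => by
          rw [norm_mul, Real.norm_of_nonneg (mollify_pos (scale_pos n) x).le]
          exact mul_le_mul_of_nonneg_right (hC _) (mollify_pos (scale_pos n) x).le)
    _ = C := by rw [integral_const_mul, h2, mul_one]

/-- Boundedness of f and its derivative suffices, without compact support, because u and its
gradient are integrable. -/
lemma integral_mul_mollify_eq_neg {r : ℝ} (hr : 0 < r) {ν : Measure (Space d)}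
    [IsProbabilityMeasure ν] {i : Fin d} {f g : Space d → ℝ} {C : ℝ} (hf : Continuous f)
    (hg : Continuous g) (hC : ∀ x, |f x| ≤ C ∧ |g x| ≤ C)
    (hfg : ∀ x, HasLineDerivAt ℝ f (g x) x (EuclideanSpace.single i 1)) :
    ∫ x, g x * mollify r ν x = -∫ x, f x * mollifyGrad r ν x i := by
  have hU := (integral_mollify_eq_one (ν := ν) hr).1
  have hGi : Integrable (fun x => mollifyGrad r ν x i) :=
    (hU.const_mul (decay d * r)).mono' ((EuclideanSpace.proj (𝕜 := ℝ) i :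
      Space d →L[ℝ] ℝ).continuous.comp (continuous_mollifyGrad hr)).aestronglyMeasurable
      (Eventually.of_forall fun x => (abs_apply_le_norm _ i).trans (norm_mollifyGrad_le hr x))
  have h := integral_bilinear_hasLineDerivAt_right_eq_neg_left_of_integrable
    (B := ContinuousLinearMap.mul ℝ ℝ) (μ := (volume : Measure (Space d)))
    (f := mollify r ν) (f' := fun x => mollifyGrad r ν x i) (g := f) (g' := g)
    (v := EuclideanSpace.single i 1)
    (by simpa using hGi.mul_bdd (c := C) hf.aestronglyMeasurable (Eventually.of_forall fun x => (hC x).1))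
    (by simpa using hU.mul_bdd (c := C) hg.aestronglyMeasurable (Eventually.of_forall fun x => (hC x).2))
    (by simpa using hU.mul_bdd (c := C) hf.aestronglyMeasurable (Eventually.of_forall fun x => (hC x).1))
    (fun x _ => by
      simpa [EuclideanSpace.inner_single_right] using
        (hasFDerivAt_mollify (ν := ν) hr x).hasLineDerivAt (EuclideanSpace.single i 1))
    (fun x _ => hfg x)
  simp only [ContinuousLinearMap.mul_apply'] at h
  simp only [mul_comm (g _), mul_comm (f _)]
  exact h

/-- After mollification ∫ψu = -∫φ ∂_i u, at most (ε/2)∫φ²u + (1/2ε)∫u|∇ln u|² in absolute value. The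
last integral is bounded uniformly, the others converge, and ε is optimized at the end. -/
lemma abs_integral_testPair_le {C : ℝ} (hC0 : 0 ≤ C)
    (hC : ∀ n, ∫⁻ t, (∫⁻ x, ENNReal.ofReal (mollify (scale n) (κ t) x *
      ‖mollifyLogGrad (scale n) (κ t) x‖ ^ 2)) ∂timeMeasure ≤ ENNReal.ofReal C)
    {i : Fin d} {φ ψ : ℝ × Space d → ℝ} (h : IsTestPair i φ ψ) :
    |∫ z, ψ z ∂(spaceTime κ)| ≤ √C * √(∫ z, φ z ^ 2 ∂(spaceTime κ)) := by
  obtain ⟨D, hD⟩ := h.bounded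
  have hsq : ∀ z, |φ z ^ 2| ≤ D ^ 2 := fun z => by
    rw [abs_pow]; exact pow_le_pow_left₀ (abs_nonneg _) (hD z).1 2
  refine le_sqrt_mul_sqrt (integral_nonneg fun z => sq_nonneg _) hC0 fun ε hε => ?_
  have hlim1 := (tendsto_integral_mul_mollify_prod (κ := κ) h.measurable_right (fun z => (hD z).2)
    h.continuous_right).abs
  have hlim2 := ((tendsto_integral_mul_mollify_prod (κ := κ) (f := fun z => φ z ^ 2)
    (h.measurable_left.pow_const 2) hsq
    (fun t => (h.continuous_left t).pow 2)).const_mul (ε / 2)).add_const (1 / (2 * ε) * C)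
  refine le_of_tendsto_of_tendsto' hlim1 hlim2 fun n => ?_
  have hr := scale_pos n
  have hGm : Measurable fun p : ℝ × Space d => mollifyLogGrad (scale n) (κ p.1) p.2 :=
    (measurable_mollify _).inv.smul (measurable_mollifyGrad _)
  have hIm : Measurable fun p : ℝ × Space d =>
    mollify (scale n) (κ p.1) p.2 * ‖mollifyLogGrad (scale n) (κ p.1) p.2‖ ^ 2 :=
    (measurable_mollify _).mul (hGm.norm.pow_const 2)
  have hI0 : ∀ p : ℝ × Space d,
    0 ≤ mollify (scale n) (κ p.1) p.2 * ‖mollifyLogGrad (scale n) (κ p.1) p.2‖ ^ 2 := fun p =>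
    mul_nonneg (mollify_pos hr _).le (sq_nonneg _)
  have hIl : ∫⁻ p : ℝ × Space d, ENNReal.ofReal (mollify (scale n) (κ p.1) p.2 *
      ‖mollifyLogGrad (scale n) (κ p.1) p.2‖ ^ 2) ∂(timeMeasure.prod volume) ≤ ENNReal.ofReal C := by
    rw [lintegral_prod _ hIm.ennreal_ofReal.aemeasurable]
    exact hC n
  have hIi : Integrable (fun p : ℝ × Space d => mollify (scale n) (κ p.1) p.2 *
      ‖mollifyLogGrad (scale n) (κ p.1) p.2‖ ^ 2) (timeMeasure.prod volume) :=
    ⟨hIm.aestronglyMeasurable, (hasFiniteIntegral_iff_ofReal (Eventually.of_forall hI0)).2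
      (hIl.trans_lt ENNReal.ofReal_lt_top)⟩
  have hIC : ∫ p : ℝ × Space d, mollify (scale n) (κ p.1) p.2 *
      ‖mollifyLogGrad (scale n) (κ p.1) p.2‖ ^ 2 ∂(timeMeasure.prod volume) ≤ C := by
    rw [← ofReal_integral_eq_lintegral_ofReal hIi (Eventually.of_forall hI0)] at hIl
    exact (ENNReal.ofReal_le_ofReal_iff hC0).1 hIl
  have hφi := integrable_mul_mollify_prod (κ := κ) hr (f := fun z => φ z ^ 2)
    (h.measurable_left.pow_const 2) hsq
  have hψi := integrable_mul_mollify_prod (κ := κ) hr h.measurable_right fun z => (hD z).2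
  have hpt : ∀ p : ℝ × Space d, |φ p * mollifyGrad (scale n) (κ p.1) p.2 i| ≤
      ε / 2 * (φ p ^ 2 * mollify (scale n) (κ p.1) p.2) + 1 / (2 * ε) *
        (mollify (scale n) (κ p.1) p.2 * ‖mollifyLogGrad (scale n) (κ p.1) p.2‖ ^ 2) := fun p => by
    have hU := mollify_pos (ν := κ p.1) hr p.2
    set U := mollify (scale n) (κ p.1) p.2 with hUd
    set G := mollifyLogGrad (scale n) (κ p.1) p.2 with hGd
    have e1 : mollifyGrad (scale n) (κ p.1) p.2 = U • G := by
      rw [hGd, mollifyLogGrad, ← hUd, smul_smul, mul_inv_cancel₀ hU.ne', one_smul]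
    have e2 : |φ p * mollifyGrad (scale n) (κ p.1) p.2 i| ≤ U * (|φ p| * ‖G‖) := by
      rw [e1, PiLp.smul_apply, smul_eq_mul, abs_mul, abs_mul, abs_of_pos hU]
      have := mul_le_mul_of_nonneg_left (abs_apply_le_norm G i) (mul_nonneg hU.le (abs_nonneg (φ p)))
      linarith
    have e3 : |φ p| * ‖G‖ ≤ ε / 2 * φ p ^ 2 + 1 / (2 * ε) * ‖G‖ ^ 2 := by
      have h1 := two_mul_le_add_sq (ε * |φ p|) ‖G‖
      have h2 := mul_le_mul_of_nonneg_left h1 (by positivity : 0 ≤ 1 / (2 * ε))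
      rw [mul_pow, sq_abs] at h2
      have h3 : 1 / (2 * ε) * (2 * (ε * |φ p|) * ‖G‖) = |φ p| * ‖G‖ := by field_simp
      have h4 : 1 / (2 * ε) * (ε ^ 2 * φ p ^ 2 + ‖G‖ ^ 2) =
        ε / 2 * φ p ^ 2 + 1 / (2 * ε) * ‖G‖ ^ 2 := by field_simp
      linarith
    have := mul_le_mul_of_nonneg_left e3 hU.le
    linarith
  have hRi := (hφi.const_mul (ε / 2)).add (hIi.const_mul (1 / (2 * ε)))
  have hLi : Integrable (fun p : ℝ × Space d => φ p * mollifyGrad (scale n) (κ p.1) p.2 i)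
      (timeMeasure.prod volume) := by
    refine hRi.mono' (h.measurable_left.mul ?_).aestronglyMeasurable (Eventually.of_forall hpt)
    have := measurable_mollifyGrad (κ := κ) (scale n)
    fun_prop
  rw [integral_prod _ hψi]
  simp only [fun t => integral_mul_mollify_eq_neg (ν := κ t) hr (h.continuous_left t)
    (h.continuous_right t) (fun x => hD (t, x)) (h.hasLineDerivAt t), integral_neg, abs_neg]
  rw [← integral_prod _ hLi]
  refine (norm_integral_le_of_norm_le
    (f := fun p : ℝ × Space d => φ p * mollifyGrad (scale n) (κ p.1) p.2 i) hRi
    (Eventually.of_forall hpt)).trans ?_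
  simp only [Pi.add_apply]
  rw [integral_add (hφi.const_mul (ε / 2)) (hIi.const_mul (1 / (2 * ε))), integral_const_mul,
    integral_const_mul]
  gcongr

end LogarithmicGradient


/-! ### Existence of the logarithmic gradient and its time slices -/

section LogarithmicGradient
variable {d : ℕ} {κ : Kernel ℝ (Space d)} [IsMarkovKernel κ]

lemma IsTestPair.memLp {i : Fin d} {φ ψ : ℝ × Space d → ℝ} (h : IsTestPair i φ ψ)
    {p : ℝ≥0∞} : MemLp φ p (spaceTime κ) := by
  obtain ⟨C, hC⟩ := h.bounded
  exact MemLp.of_bound h.measurable_left.aestronglyMeasurable C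
    (Eventually.of_forall fun z => (hC z).1)

lemma IsTestPair.integrable_right {i : Fin d} {φ ψ : ℝ × Space d → ℝ} (h : IsTestPair i φ ψ) :
    Integrable ψ (spaceTime κ) := by
  obtain ⟨C, hC⟩ := h.bounded
  exact (integrable_const C).mono' h.measurable_right.aestronglyMeasurable
    (Eventually.of_forall fun z => (hC z).2)

/-- The logarithmic gradient of the space-time measure. -/
theorem exists_logarithmic_gradient {C : ℝ} (hC0 : 0 ≤ C)
    (hC : ∀ n, ∫⁻ t, (∫⁻ x, ENNReal.ofReal (mollify (scale n) (κ t) x *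
      ‖mollifyLogGrad (scale n) (κ t) x‖ ^ 2)) ∂timeMeasure ≤ ENNReal.ofReal C) :
    ∃ β : ℝ × Space d → Space d, Measurable β ∧ Integrable (fun z => ‖β z‖ ^ 2) (spaceTime κ) ∧
      ∀ i φ ψ, IsTestPair i φ ψ →
        ∫ z, ψ z ∂(spaceTime κ) = -∫ z, β z i * φ z ∂(spaceTime κ) := by
  -- For each direction the functional (φ, ψ) ↦ -∫ψ dμ is bounded by the L²(μ)-norm of φ, so an
  -- element of L²(μ) represents it.
  have key : ∀ i : Fin d, ∃ g : ℝ × Space d → ℝ, Measurable g ∧ MemLp g 2 (spaceTime κ) ∧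
      ∀ v : testPairs i, -∫ z, v.1.2 z ∂(spaceTime κ) = ∫ z, g z * v.1.1 z ∂(spaceTime κ) := fun i => by
    let l : testPairs (d := d) i →ₗ[ℝ] ℝ :=
      { toFun := fun v => -∫ z, v.1.2 z ∂(spaceTime κ)
        map_add' := fun v w => by
          have := integral_add (IsTestPair.integrable_right (κ := κ) v.2)
            (IsTestPair.integrable_right (κ := κ) w.2)
          simp only [Submodule.coe_add, Prod.snd_add, Pi.add_apply]
          rw [this]; ring
        map_smul' := fun c v => by
          simp only [SetLike.val_smul, Prod.smul_snd, Pi.smul_apply, smul_eq_mul,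
            integral_const_mul, RingHom.id_apply]
          ring }
    refine exists_memLp_two_rep ((LinearMap.fst ℝ _ _).comp (testPairs (d := d) i).subtype) l
      (fun v => IsTestPair.memLp v.2) (√C) fun v => ?_
    change |-∫ z, v.1.2 z ∂(spaceTime κ)| ≤ _
    rw [abs_neg]
    exact abs_integral_testPair_le hC0 hC v.2
  choose g hgm hg2 hg using key
  refine ⟨fun z => WithLp.toLp 2 fun i => g i z, ?_, ?_, fun i φ ψ h => ?_⟩
  · have : Measurable fun z => fun i => g i z := measurable_pi_iff.2 hgm
    fun_prop
  · simp only [EuclideanSpace.norm_sq_eq, Real.norm_eq_abs, sq_abs]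
    exact integrable_finsetSum _ fun i _ => (hg2 i).integrable_sq
  · rw [← hg i ⟨(φ, ψ), h⟩, neg_neg]

/-- The arbitrary time set B localizes the space-time identity for β to individual slices. -/
lemma isTestPair_moll {r : ℝ} (hr : 0 < r) (i : Fin d) (x : Space d) {B : Set ℝ}
    (hB : MeasurableSet B) :
    IsTestPair i (fun z => B.indicator 1 z.1 * moll r (x - z.2))
      (fun z => B.indicator 1 z.1 * -gradMoll r (x - z.2) i) := by
  have hB1 : ∀ s, |B.indicator (1 : ℝ → ℝ) s| ≤ 1 := fun s => by
    by_cases h : s ∈ B <;> simp [h]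
  have hm : Measurable fun z : ℝ × Space d => B.indicator (1 : ℝ → ℝ) z.1 :=
    (measurable_one.indicator hB).comp measurable_fst
  have hM := mollMax_pos (d := d) hr
  have hd := decay_pos d
  refine ⟨hm.mul ((continuous_moll_sub r x).measurable.comp measurable_snd), hm.mul ?_,
    ⟨mollMax d r + decay d * r * mollMax d r, fun z => ⟨?_, ?_⟩⟩,
    fun t => ?_, fun t => ?_,
    fun t y => ?_⟩
  · exact ((continuous_gradMoll_apply r i).measurable.comp
      (measurable_snd.const_sub x)).neg
  · rw [abs_mul, abs_of_pos (moll_pos hr _)]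
    calc _ ≤ 1 * mollMax d r :=
          mul_le_mul (hB1 _) (moll_le hr _) (moll_pos hr _).le zero_le_one
      _ ≤ _ := by
          have : 0 ≤ decay d * r * mollMax d r := by positivity
          linarith
  · rw [abs_mul, abs_neg]
    calc _ ≤ 1 * (decay d * r * mollMax d r) :=
          mul_le_mul (hB1 _) ((abs_apply_le_norm _ i).trans (norm_gradMoll_le_const hr _))
            (abs_nonneg _) zero_le_one
      _ ≤ _ := by linarith
  · exact (continuous_moll_sub r x).const_mul (B.indicator 1 t)
  · have hg : Continuous fun y => gradMoll r (x - y) i :=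
      (continuous_gradMoll_apply r i).comp (continuous_const.sub continuous_id)
    exact hg.neg.const_mul (B.indicator 1 t)
  · have hd : Differentiable ℝ fun y : Space d => moll r (x - y) :=
      ((contDiff_moll r).comp (contDiff_const.sub contDiff_id)).differentiable (by simp)
    have h1 := ((hd y).hasFDerivAt.const_mul (B.indicator (1 : ℝ → ℝ) t)).hasLineDerivAt
      (EuclideanSpace.single i 1)
    have h2 := pd_moll_sub r x i y
    rw [pd] at h2
    rw [_root_.smul_apply, h2, smul_eq_mul] at h1
    exact h1

/-- Mollifying β μ_t gives ∇(N * μ_t): for fixed x the two sides have equal integrals over every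
time set, hence agree at almost every time. The null sets are then exchanged between t and x. -/
lemma ae_mollifyGrad_eq {β : ℝ × Space d → Space d} (hβm : Measurable β)
    (hβ2 : Integrable (fun z => ‖β z‖ ^ 2) (spaceTime κ))
    (hβ : ∀ i φ ψ, IsTestPair i φ ψ →
      ∫ z, ψ z ∂(spaceTime κ) = -∫ z, β z i * φ z ∂(spaceTime κ)) :
    ∀ᵐ t ∂timeMeasure, ∀ n, ∀ᵐ x : Space d, ∀ i, mollifyGrad (scale n) (κ t) x i =
      ∫ y, β (t, y) i * moll (scale n) (x - y) ∂(κ t) := by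
  have hβi : ∀ i, Measurable fun z => β z i := fun i => by fun_prop
  have hβ1 : ∀ i, Integrable (fun z => β z i) (spaceTime κ) := fun i => by
    refine ((integrable_const 1).add hβ2).mono' (hβi i).aestronglyMeasurable
      (Eventually.of_forall fun z => (abs_apply_le_norm _ i).trans ?_)
    simp only [Pi.add_apply]
    nlinarith [sq_nonneg (‖β z‖ - 1), norm_nonneg (β z)]
  rw [ae_all_iff]
  intro n
  have hr := scale_pos n
  have hmL : ∀ i, Measurable fun p : ℝ × Space d => mollifyGrad (scale n) (κ p.1) p.2 i := fun i => by
    have := measurable_mollifyGrad (κ := κ) (scale n)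
    fun_prop
  have hmR : ∀ i, Measurable fun p : ℝ × Space d =>
      ∫ y, β (p.1, y) i * moll (scale n) (p.2 - y) ∂(κ p.1) := fun i => by
    have h : StronglyMeasurable (fun q : (ℝ × Space d) × Space d =>
        β (q.1.1, q.2) i * moll (scale n) (q.1.2 - q.2)) := by
      refine Measurable.stronglyMeasurable (((hβi i).comp (by fun_prop :
        Measurable fun q : (ℝ × Space d) × Space d => (q.1.1, q.2))).mul ?_)
      exact ((continuous_moll _).comp (by fun_prop :
        Continuous fun q : (ℝ × Space d) × Space d => q.1.2 - q.2)).measurable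
    exact (h.integral_kernel_prod_right' (κ := κ.comap Prod.fst measurable_fst)).measurable
  refine (Measure.ae_ae_comm (μ := timeMeasure) (ν := (volume : Measure (Space d)))
    (p := fun t x => ∀ i, mollifyGrad (scale n) (κ t) x i =
      ∫ y, β (t, y) i * moll (scale n) (x - y) ∂(κ t)) ?_).2 (Eventually.of_forall fun x => ?_)
  · have e : {p : ℝ × Space d | ∀ i, mollifyGrad (scale n) (κ p.1) p.2 i =
        ∫ y, β (p.1, y) i * moll (scale n) (p.2 - y) ∂(κ p.1)} =
        ⋂ i, {p : ℝ × Space d | mollifyGrad (scale n) (κ p.1) p.2 i =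
          ∫ y, β (p.1, y) i * moll (scale n) (p.2 - y) ∂(κ p.1)} := by
      ext p; simp
    rw [e]
    exact MeasurableSet.iInter fun i => measurableSet_eq_fun (hmL i) (hmR i)
  rw [ae_all_iff]
  intro i
  have hbd : ∀ z : ℝ × Space d, ‖moll (scale n) (x - z.2)‖ ≤ mollMax d (scale n) := fun z => by
    rw [Real.norm_of_nonneg (moll_pos hr _).le]; exact moll_le hr _
  have hgi : Integrable (fun z : ℝ × Space d => gradMoll (scale n) (x - z.2) i) (spaceTime κ) :=
    (integrable_const (decay d * scale n * mollMax d (scale n))).mono'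
      ((continuous_gradMoll_apply _ i).measurable.comp
        (measurable_snd.const_sub x)).aestronglyMeasurable
      (Eventually.of_forall fun z => (abs_apply_le_norm _ i).trans (norm_gradMoll_le_const hr _))
  have hmi : Integrable (fun z : ℝ × Space d => β z i * moll (scale n) (x - z.2)) (spaceTime κ) :=
    (hβ1 i).mul_bdd (c := mollMax d (scale n))
      ((continuous_moll_sub _ x).measurable.comp measurable_snd).aestronglyMeasurable
      (Eventually.of_forall hbd)
  have e1 : ∀ t, mollifyGrad (scale n) (κ t) x i = ∫ y, gradMoll (scale n) (x - y) i ∂(κ t) :=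
    fun t => mollifyGrad_apply hr x i
  simp only [e1]
  refine Integrable.ae_eq_of_forall_setIntegral_eq _ _ (integrableOn_integral hgi)
    (integrableOn_integral hmi) fun B hB _ => ?_
  have hset : ∀ {f : ℝ × Space d → ℝ}, Integrable f (spaceTime κ) →
      ∫ z, B.indicator (1 : ℝ → ℝ) z.1 * f z ∂(spaceTime κ) =
        ∫ t in B, (∫ y, f (t, y) ∂(κ t)) ∂timeMeasure := fun {f} hf => by
    have hi : Integrable (fun z : ℝ × Space d => B.indicator (1 : ℝ → ℝ) z.1 * f z) (spaceTime κ) :=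
      hf.bdd_mul (c := 1) ((measurable_one.indicator hB).comp measurable_fst).aestronglyMeasurable
        (Eventually.of_forall fun z => by by_cases h : z.1 ∈ B <;> simp [h])
    rw [integral_spaceTime hi, ← integral_indicator hB]
    refine integral_congr_ae (Eventually.of_forall fun t => ?_)
    by_cases h : t ∈ B <;> simp [h]
  have h := hβ i _ _ (isTestPair_moll hr i x hB)
  rw [← hset hgi, ← hset hmi]
  simp only [mul_neg, integral_neg, neg_inj, mul_left_comm (β _ i)] at h
  exact h

end LogarithmicGradient


/-! ### Convergence of mollifications in L¹ -/

section Convergence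
variable {d : ℕ}

/-- The convolution of a function with the mollifying kernel. -/
noncomputable def mollifyFun (r : ℝ) (f : Space d → ℝ) (x : Space d) : ℝ :=
  ∫ y, f y * moll r (x - y)

lemma integrable_mul_moll_sub {r : ℝ} (hr : 0 < r) {f : Space d → ℝ} (hf : Integrable f)
    (x : Space d) : Integrable fun y => f y * moll r (x - y) :=
  hf.mul_bdd (c := mollMax d r) (continuous_moll_sub r x).aestronglyMeasurable
    (Eventually.of_forall fun y => by
      rw [Real.norm_of_nonneg (moll_pos hr _).le]; exact moll_le hr _)

lemma integral_mollMeasure (g : Space d → ℝ) :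
    ∫ z, g z ∂(mollMeasure d) = ∫ z, g z * moll 1 z := by
  rw [mollMeasure, integral_withDensity_eq_integral_toReal_smul (measurable_ofReal_moll 1)
    (Eventually.of_forall fun _ => ENNReal.ofReal_lt_top)]
  refine integral_congr_ae (Eventually.of_forall fun z => ?_)
  simp [ENNReal.toReal_ofReal (moll_pos one_pos z).le, mul_comm]

lemma integrable_mollMeasure_iff (g : Space d → ℝ) :
    Integrable g (mollMeasure d) ↔ Integrable fun z => g z * moll 1 z := by
  rw [mollMeasure, integrable_withDensity_iff_integrable_smul' (measurable_ofReal_moll 1)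
    (Eventually.of_forall fun _ => ENNReal.ofReal_lt_top)]
  refine integrable_congr (Eventually.of_forall fun z => ?_)
  simp [ENNReal.toReal_ofReal (moll_pos one_pos z).le, mul_comm]

lemma mollifyFun_eq {r : ℝ} (hr : 0 < r) {f : Space d → ℝ} (hf : Integrable f) (x : Space d) :
    Integrable (fun z => f (r⁻¹ • z + x)) (mollMeasure d) ∧
      mollifyFun r f x = ∫ z, f (r⁻¹ • z + x) ∂(mollMeasure d) := by
  have e : ∀ z, f z * moll r (x - z) = (fun y => f (y + x) * moll r y) (z - x) := fun z => by
    simp only [sub_add_cancel]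
    rw [← moll_neg, neg_sub]
  constructor
  · rw [integrable_mollMeasure_iff, ← integrable_mul_moll_iff hr (fun y => f (y + x))]
    have h := (integrable_mul_moll_sub hr hf x).comp_add_right x
    refine h.congr (Eventually.of_forall fun y => ?_)
    simp [moll_neg]
  · rw [integral_mollMeasure, ← integral_mul_moll hr (fun y => f (y + x)), mollifyFun]
    simp only [e]
    exact integral_sub_right_eq_self (fun y => f (y + x) * moll r y) x

/-- The L¹ error is at most an average over z of the distance of f from its translate by z/r. Each
distance tends to zero and is at most 2‖f‖. -/
lemma tendsto_lintegral_mollifyFun_sub {f : Space d → ℝ} (hfm : Measurable f) (hf : Integrable f) :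
    Tendsto (fun n => ∫⁻ x, ‖mollifyFun (scale n) f x - f x‖ₑ) atTop (𝓝 0) := by
  have hle : ∀ n, ∫⁻ x, ‖mollifyFun (scale n) f x - f x‖ₑ ≤
      ∫⁻ z, (∫⁻ x, ‖f ((scale n)⁻¹ • z + x) - f x‖ₑ) ∂(mollMeasure d) := fun n => by
    have hm : Measurable fun p : Space d × Space d => ‖f ((scale n)⁻¹ • p.2 + p.1) - f p.1‖ₑ := by
      fun_prop
    have hsw := lintegral_lintegral_swap (μ := volume) (ν := mollMeasure d)
      (f := fun x z => ‖f ((scale n)⁻¹ • z + x) - f x‖ₑ) hm.aemeasurable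
    rw [← hsw]
    refine lintegral_mono fun x => ?_
    obtain ⟨h1, h2⟩ := mollifyFun_eq (scale_pos n) hf x
    have h3 : mollifyFun (scale n) f x - f x =
        ∫ z, (f ((scale n)⁻¹ • z + x) - f x) ∂(mollMeasure d) := by
      rw [integral_sub h1 (integrable_const _), h2]
      simp
    rw [h3]
    exact enorm_integral_le_lintegral_enorm _
  refine tendsto_of_tendsto_of_tendsto_of_le_of_le tendsto_const_nhds ?_ (fun _ => zero_le) hle
  have htr := tendsto_lintegral_translation hf
  have h0 : (0 : ℝ≥0∞) = ∫⁻ _ : Space d, 0 ∂(mollMeasure d) := by simp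
  rw [h0]
  refine tendsto_lintegral_of_dominated_convergence (fun _ => 2 * ∫⁻ x, ‖f x‖ₑ) (fun n => ?_)
    (fun n => Eventually.of_forall fun z => ?_) ?_ (Eventually.of_forall fun z => ?_)
  · have hm : Measurable fun p : Space d × Space d => ‖f ((scale n)⁻¹ • p.1 + p.2) - f p.2‖ₑ := by
      fun_prop
    exact hm.lintegral_prod_right'
  · calc _ ≤ ∫⁻ x, (‖f ((scale n)⁻¹ • z + x)‖ₑ + ‖f x‖ₑ) :=
          lintegral_mono fun x => enorm_sub_le
      _ = _ := by
          rw [lintegral_add_right _ hfm.enorm,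
            lintegral_add_left_eq_self (fun x => ‖f x‖ₑ) ((scale n)⁻¹ • z), two_mul]
  · rw [lintegral_const, measure_univ, mul_one]
    exact ENNReal.mul_ne_top (by simp) hf.2.ne
  · exact htr.comp (tendsto_scale_inv_smul z)

/-- Split F_n h_n as (F_n - f)h_n + f h_n: the first term is small in L¹, the second converges to fg
by domination. -/
lemma tendsto_integral_mul_of_tendsto_lintegral {F h : ℕ → Space d → ℝ} {f g : Space d → ℝ} {K : ℝ}
    (hF : ∀ n, Integrable (F n)) (hf : Integrable f)
    (hFf : Tendsto (fun n => ∫⁻ x, ‖F n x - f x‖ₑ) atTop (𝓝 0))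
    (hm : ∀ n, AEStronglyMeasurable (h n)) (hK : ∀ n x, |h n x| ≤ K)
    (hg : ∀ᵐ x, Tendsto (fun n => h n x) atTop (𝓝 (g x))) :
    Tendsto (fun n => ∫ x, F n x * h n x) atTop (𝓝 (∫ x, f x * g x)) := by
  have i1 : ∀ n, Integrable fun x => F n x * h n x := fun n =>
    (hF n).mul_bdd (hm n) (Eventually.of_forall (hK n))
  have i2 : ∀ n, Integrable fun x => f x * h n x := fun n =>
    hf.mul_bdd (hm n) (Eventually.of_forall (hK n))
  have h1 : Tendsto (fun n => ∫ x, f x * h n x) atTop (𝓝 (∫ x, f x * g x)) := by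
    refine tendsto_integral_of_dominated_convergence (fun x => ‖f x‖ * K) (fun n => (i2 n).1)
      (hf.norm.mul_const K) (fun n => Eventually.of_forall fun x => ?_) ?_
    · rw [norm_mul]; exact mul_le_mul_of_nonneg_left (hK n x) (norm_nonneg _)
    · filter_upwards [hg] with x hx
      exact hx.const_mul _
  have h2 : Tendsto (fun n => ∫ x, (F n x - f x) * h n x) atTop (𝓝 (∫ _ : Space d, (0 : ℝ))) := by
    refine tendsto_integral_of_L1 _ aestronglyMeasurable_const (Eventually.of_forall fun n =>
      ((hF n).sub hf).mul_bdd (hm n) (Eventually.of_forall (hK n))) ?_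
    have h3 : Tendsto (fun n => ENNReal.ofReal K * ∫⁻ x, ‖F n x - f x‖ₑ) atTop (𝓝 0) := by
      have := ENNReal.Tendsto.const_mul (a := ENNReal.ofReal K) hFf (Or.inr ENNReal.ofReal_ne_top)
      rwa [mul_zero] at this
    refine tendsto_of_tendsto_of_tendsto_of_le_of_le tendsto_const_nhds h3 (fun _ => zero_le)
      fun n => ?_
    change ∫⁻ x, ‖(F n x - f x) * h n x - 0‖ₑ ≤ _
    rw [← lintegral_const_mul' _ _ ENNReal.ofReal_ne_top]
    refine lintegral_mono fun x => ?_
    rw [sub_zero, enorm_mul, mul_comm]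
    refine mul_le_mul_left ?_ _
    rw [← ofReal_norm]
    exact ENNReal.ofReal_le_ofReal (hK n x)
  have h4 := h2.add h1
  rw [integral_zero, zero_add] at h4
  refine h4.congr fun n => ?_
  have i0 : Integrable fun x => (F n x - f x) * h n x :=
    ((hF n).sub hf).mul_bdd (hm n) (Eventually.of_forall (hK n))
  rw [← integral_add i0 (i2 n)]
  exact integral_congr_ae (Eventually.of_forall fun x => by ring)

end Convergence

/-! ### Densities with a square integrable logarithmic gradient -/

section LogGradient
variable {d : ℕ}

/-- A probability measure with density `ρ` whose mollifications have the gradients predicted by the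
logarithmic gradient `β ∈ L²(ν)`. -/
structure HasLogGradient (ν : Measure (Space d)) (ρ : Space d → ℝ) (β : Space d → Space d) :
    Prop where
  measurable_density : Measurable ρ
  density_nonneg : ∀ x, 0 ≤ ρ x
  eq_withDensity : ν = volume.withDensity fun x => ENNReal.ofReal (ρ x)
  measurable_grad : Measurable β
  integrable_sq : Integrable (fun x => ‖β x‖ ^ 2) ν
  mollifyGrad_eq : ∀ n, ∀ᵐ x : Space d, ∀ i, mollifyGrad (scale n) ν x i =
    ∫ y, β y i * moll (scale n) (x - y) ∂ν

variable {ν : Measure (Space d)} {ρ : Space d → ℝ} {β : Space d → Space d}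

lemma HasLogGradient.integrable_iff (h : HasLogGradient ν ρ β) {g : Space d → ℝ} :
    Integrable g ν ↔ Integrable fun x => ρ x * g x := by
  rw [h.eq_withDensity, integrable_withDensity_iff_integrable_smul'
    h.measurable_density.ennreal_ofReal (Eventually.of_forall fun _ => ENNReal.ofReal_lt_top)]
  refine integrable_congr (Eventually.of_forall fun x => ?_)
  simp [ENNReal.toReal_ofReal (h.density_nonneg x)]

lemma HasLogGradient.integral_eq (h : HasLogGradient ν ρ β) (g : Space d → ℝ) :
    ∫ x, g x ∂ν = ∫ x, ρ x * g x := by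
  rw [h.eq_withDensity, integral_withDensity_eq_integral_toReal_smul
    h.measurable_density.ennreal_ofReal (Eventually.of_forall fun _ => ENNReal.ofReal_lt_top)]
  refine integral_congr_ae (Eventually.of_forall fun x => ?_)
  simp [ENNReal.toReal_ofReal (h.density_nonneg x)]

lemma HasLogGradient.measurable_grad_apply (h : HasLogGradient ν ρ β) (i : Fin d) :
    Measurable fun x => β x i := by
  have := h.measurable_grad
  fun_prop

lemma HasLogGradient.integrable_mul_sq (h : HasLogGradient ν ρ β) :
    Integrable fun x => ρ x * ‖β x‖ ^ 2 := h.integrable_iff.1 h.integrable_sq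

lemma HasLogGradient.mollify_eq (h : HasLogGradient ν ρ β) (r : ℝ) (x : Space d) :
    mollify r ν x = mollifyFun r ρ x := h.integral_eq _

lemma HasLogGradient.mollifyGrad_ae_eq (h : HasLogGradient ν ρ β) (n : ℕ) (i : Fin d) :
    ∀ᵐ x : Space d, mollifyGrad (scale n) ν x i = mollifyFun (scale n) (fun x => ρ x * β x i) x := by
  filter_upwards [h.mollifyGrad_eq n] with x hx
  rw [hx, h.integral_eq, mollifyFun]
  simp only [mul_assoc]

variable [IsProbabilityMeasure ν]

lemma HasLogGradient.integrable_density (h : HasLogGradient ν ρ β) : Integrable ρ := by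
  simpa using h.integrable_iff.1 (integrable_const (1 : ℝ))

lemma HasLogGradient.integral_density (h : HasLogGradient ν ρ β) : ∫ x, ρ x = 1 := by
  have := h.integral_eq fun _ => 1
  simpa using this.symm

lemma HasLogGradient.integrable_norm (h : HasLogGradient ν ρ β) : Integrable (fun x => ‖β x‖) ν := by
  refine ((integrable_const 1).add h.integrable_sq).mono' h.measurable_grad.norm.aestronglyMeasurable
    (Eventually.of_forall fun x => ?_)
  rw [norm_norm]
  simp only [Pi.add_apply]
  nlinarith [sq_nonneg (‖β x‖ - 1), norm_nonneg (β x)]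

lemma HasLogGradient.integrable_grad (h : HasLogGradient ν ρ β) (i : Fin d) :
    Integrable fun x => ρ x * β x i :=
  h.integrable_iff.1 (h.integrable_norm.mono' (h.measurable_grad_apply i).aestronglyMeasurable
    (Eventually.of_forall fun _ => abs_apply_le_norm _ i))

lemma HasLogGradient.tendsto_mollify (h : HasLogGradient ν ρ β) :
    Tendsto (fun n => ∫⁻ x, ‖mollify (scale n) ν x - ρ x‖ₑ) atTop (𝓝 0) := by
  simp only [h.mollify_eq]
  exact tendsto_lintegral_mollifyFun_sub h.measurable_density h.integrable_density

lemma HasLogGradient.tendsto_mollifyGrad (h : HasLogGradient ν ρ β) (i : Fin d) :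
    Tendsto (fun n => ∫⁻ x, ‖mollifyGrad (scale n) ν x i - ρ x * β x i‖ₑ) atTop (𝓝 0) := by
  refine (tendsto_lintegral_mollifyFun_sub (h.measurable_density.mul (h.measurable_grad_apply i))
    (h.integrable_grad i)).congr fun n => lintegral_congr_ae ?_
  filter_upwards [h.mollifyGrad_ae_eq n i] with x hx
  rw [hx]
  rfl

/-- A subsequence of the mollifications converges almost everywhere. -/
lemma HasLogGradient.exists_subseq (h : HasLogGradient ν ρ β) : ∃ ns : ℕ → ℕ, StrictMono ns ∧
    ∀ᵐ x, Tendsto (fun k => mollify (scale (ns k)) ν x) atTop (𝓝 (ρ x)) := by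
  refine (tendstoInMeasure_of_tendsto_eLpNorm one_ne_zero (fun n =>
    (continuous_mollify (scale_pos n)).aestronglyMeasurable)
    h.measurable_density.aestronglyMeasurable ?_).exists_seq_tendsto_ae
  simp only [eLpNorm_one_eq_lintegral_enorm]
  exact h.tendsto_mollify

lemma integrable_mollifyGrad_apply {r : ℝ} (hr : 0 < r) (i : Fin d) :
    Integrable fun x => mollifyGrad r ν x i :=
  ((integral_mollify_eq_one (ν := ν) hr).1.const_mul (decay d * r)).mono'
    ((EuclideanSpace.proj (𝕜 := ℝ) i :
      Space d →L[ℝ] ℝ).continuous.comp (continuous_mollifyGrad hr)).aestronglyMeasurable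
    (Eventually.of_forall fun x => (abs_apply_le_norm _ i).trans (norm_mollifyGrad_le hr x))

lemma locallyIntegrable_of_norm_le_sq {g : Space d → Space d} (hg : Measurable g) {G : Space d → ℝ}
    (hG : Integrable G) (h : ∀ x, ‖g x‖ ≤ 1 + G x) : LocallyIntegrable g volume :=
  ((locallyIntegrable_const (1 : ℝ)).add hG.locallyIntegrable).mono hg.aestronglyMeasurable
    (Eventually.of_forall fun x => (h x).trans (le_abs_self _))

/-- The density has a generalized gradient. -/
theorem HasLogGradient.hasWeakGradient (h : HasLogGradient ν ρ β) :
    HasWeakGradient ρ fun x => ρ x • β x where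
  locallyIntegrable := h.integrable_density.locallyIntegrable
  locallyIntegrable_grad := by
    have hn : Integrable fun x => ρ x • β x := by
      refine (h.integrable_iff.1 h.integrable_norm).mono'
        (h.measurable_density.smul h.measurable_grad).aestronglyMeasurable
        (Eventually.of_forall fun x => ?_)
      rw [norm_smul, Real.norm_of_nonneg (h.density_nonneg x)]
    exact hn.locallyIntegrable
  integral_eq φ hφ hs i := by
    obtain ⟨C, hC, hC0⟩ := exists_hasBoundedDerivs hφ hs
    have hφc : Continuous (pd i φ) := (contDiff_pd hφ i).continuous
    have h1 : ∀ n, ∫ x, mollify (scale n) ν x * pd i φ x =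
        -∫ x, mollifyGrad (scale n) ν x i * φ x := fun n => by
      have := integral_mul_mollify_eq_neg (ν := ν) (scale_pos n) (f := φ) (g := pd i φ) (C := C)
        hφ.continuous hφc (fun x => ⟨hC0 x, hC.abs_pd_le i x⟩) fun x =>
          ((hφ.differentiable (by simp)) x).hasFDerivAt.hasLineDerivAt (EuclideanSpace.single i 1)
      simpa only [mul_comm] using this
    have l1 := tendsto_integral_mul_of_tendsto_lintegral (h := fun _ => pd i φ) (g := pd i φ)
      (fun n => (integral_mollify_eq_one (ν := ν) (scale_pos n)).1) h.integrable_density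
      h.tendsto_mollify (fun _ => hφc.aestronglyMeasurable) (fun _ => hC.abs_pd_le i)
      (Eventually.of_forall fun x => tendsto_const_nhds)
    have l2 := tendsto_integral_mul_of_tendsto_lintegral (h := fun _ => φ) (g := φ)
      (fun n => integrable_mollifyGrad_apply (ν := ν) (scale_pos n) i) (h.integrable_grad i)
      (h.tendsto_mollifyGrad i) (fun _ => hφ.continuous.aestronglyMeasurable) (fun _ => hC0)
      (Eventually.of_forall fun x => tendsto_const_nhds)
    simp only [h1] at l1
    exact tendsto_nhds_unique l1 l2.neg

end LogGradient


/-! ### The generalized gradient of the square root of the density -/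

section Sqrt

lemma abs_sqrt_sub_sqrt_le {a b δ : ℝ} (hδ : 0 < δ) (ha : δ ≤ a) (hb : δ ≤ b) :
    |√a - √b| ≤ (√δ)⁻¹ * |a - b| := by
  have h0 := Real.sqrt_pos.2 hδ
  have h1 := Real.sqrt_le_sqrt ha
  have h2 := Real.sqrt_nonneg b
  have e : a - b = (√a - √b) * (√a + √b) := by
    ring_nf
    rw [Real.sq_sqrt (hδ.le.trans ha), Real.sq_sqrt (hδ.le.trans hb)]
  rw [e, abs_mul, abs_of_pos (by linarith : 0 < √a + √b), inv_mul_eq_div, le_div_iff₀ h0]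
  exact mul_le_mul_of_nonneg_left (by linarith) (abs_nonneg _)

variable {d : ℕ} {ν : Measure (Space d)} {ρ : Space d → ℝ} {β : Space d → Space d}
  [IsProbabilityMeasure ν]

/-- Adding δ under the root makes it Lipschitz uniformly in the mollification; subtracting √δ makes
the function integrable on the whole space. -/
lemma integral_sqrt_mollify_mul_pd {r δ C : ℝ} (hr : 0 < r) (hδ : 0 < δ) {φ : Space d → ℝ}
    (hφ : ContDiff ℝ ∞ φ) (i : Fin d) (hφ0 : ∀ x, |φ x| ≤ C) (hφ1 : ∀ x, |pd i φ x| ≤ C) :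
    ∫ x, (√(mollify r ν x + δ) - √δ) * pd i φ x =
      -∫ x, mollifyGrad r ν x i * (φ x / (2 * √(mollify r ν x + δ))) := by
  have hδ0 := Real.sqrt_pos.2 hδ
  have hUc := continuous_mollify (ν := ν) hr
  have hUi := (integral_mollify_eq_one (ν := ν) hr).1
  have hpos : ∀ x, 0 < mollify r ν x + δ := fun x => add_pos (mollify_pos hr x) hδ
  have hder : ∀ x, HasFDerivAt (fun x => √(mollify r ν x + δ) - √δ)
      ((1 / (2 * √(mollify r ν x + δ))) • innerSL ℝ (mollifyGrad r ν x)) x := fun x =>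
    (((hasFDerivAt_mollify hr x).add_const δ).sqrt (hpos x).ne').sub_const (√δ)
  have hcF : Continuous fun x => √(mollify r ν x + δ) - √δ := by fun_prop
  have hFi : Integrable fun x => √(mollify r ν x + δ) - √δ := by
    refine (hUi.const_mul (√δ)⁻¹).mono' hcF.aestronglyMeasurable (Eventually.of_forall fun x => ?_)
    have hU := (mollify_pos (ν := ν) hr x).le
    refine (abs_sqrt_sub_sqrt_le hδ (by linarith) le_rfl).trans (le_of_eq ?_)
    rw [add_sub_cancel_right, abs_of_nonneg hU]
  have hhc : Continuous fun x => φ x / (2 * √(mollify r ν x + δ)) :=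
    hφ.continuous.div (by fun_prop) fun x => by have := Real.sqrt_pos.2 (hpos x); positivity
  have hhb : ∀ x, ‖φ x / (2 * √(mollify r ν x + δ))‖ ≤ C * (√δ)⁻¹ := fun x => by
    rw [norm_div, div_eq_mul_inv]
    have h1 : √δ ≤ ‖2 * √(mollify r ν x + δ)‖ := by
      have h2 := Real.sqrt_le_sqrt (by linarith [mollify_pos (ν := ν) hr x] : δ ≤ mollify r ν x + δ)
      rw [Real.norm_of_nonneg (by positivity)]
      linarith
    exact mul_le_mul (hφ0 x) (inv_anti₀ hδ0 h1) (by positivity) ((abs_nonneg _).trans (hφ0 x))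
  have e1 : ∀ x, fderiv ℝ (fun x => √(mollify r ν x + δ) - √δ) x (EuclideanSpace.single i 1) * φ x =
      mollifyGrad r ν x i * (φ x / (2 * √(mollify r ν x + δ))) := fun x => by
    rw [(hder x).fderiv]
    simp [EuclideanSpace.inner_single_right]
    ring
  have h := integral_mul_fderiv_eq_neg_fderiv_mul_of_integrable (𝕜 := ℝ)
    (μ := (volume : Measure (Space d))) (f := fun x => √(mollify r ν x + δ) - √δ) (g := φ)
    (v := EuclideanSpace.single i 1) ?_ ?_ ?_ (fun x _ => (hder x).differentiableAt)
    (fun x _ => (hφ.differentiable (by simp)) x)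
  · simp only [e1] at h
    exact h
  · simp only [e1]
    exact (integrable_mollifyGrad_apply hr i).mul_bdd hhc.aestronglyMeasurable
      (Eventually.of_forall hhb)
  · exact hFi.mul_bdd (c := C) (contDiff_pd hφ i).continuous.aestronglyMeasurable
      (Eventually.of_forall hφ1)
  · exact hFi.mul_bdd (c := C) hφ.continuous.aestronglyMeasurable (Eventually.of_forall hφ0)

/-- The roots and gradients converge in L¹, while the denominators converge almost everywhere along
a subsequence and stay at least 2√δ. -/
lemma HasLogGradient.integral_sqrt_add_mul_pd (h : HasLogGradient ν ρ β) {δ C : ℝ} (hδ : 0 < δ)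
    {φ : Space d → ℝ} (hφ : ContDiff ℝ ∞ φ) (i : Fin d) (hφ0 : ∀ x, |φ x| ≤ C)
    (hφ1 : ∀ x, |pd i φ x| ≤ C) :
    ∫ x, (√(ρ x + δ) - √δ) * pd i φ x = -∫ x, ρ x * β x i * (φ x / (2 * √(ρ x + δ))) := by
  have hδ0 := Real.sqrt_pos.2 hδ
  obtain ⟨ns, hns, hae⟩ := h.exists_subseq
  have hr := fun k => scale_pos (ns k)
  have hcF : ∀ k, Continuous fun x => √(mollify (scale (ns k)) ν x + δ) - √δ := fun k => by
    have := continuous_mollify (ν := ν) (hr k)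
    fun_prop
  have hFi : ∀ k, Integrable fun x => √(mollify (scale (ns k)) ν x + δ) - √δ := fun k => by
    refine ((integral_mollify_eq_one (ν := ν) (hr k)).1.const_mul (√δ)⁻¹).mono'
      (hcF k).aestronglyMeasurable (Eventually.of_forall fun x => ?_)
    have hU := (mollify_pos (ν := ν) (hr k) x).le
    refine (abs_sqrt_sub_sqrt_le hδ (by linarith) le_rfl).trans (le_of_eq ?_)
    rw [add_sub_cancel_right, abs_of_nonneg hU]
  have hρm := h.measurable_density
  have hfi : Integrable fun x => √(ρ x + δ) - √δ := by
    refine (h.integrable_density.const_mul (√δ)⁻¹).mono'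
      (by fun_prop) (Eventually.of_forall fun x => ?_)
    have hU := h.density_nonneg x
    refine (abs_sqrt_sub_sqrt_le hδ (by linarith) le_rfl).trans (le_of_eq ?_)
    rw [add_sub_cancel_right, abs_of_nonneg hU]
  have hFf : Tendsto (fun k => ∫⁻ x, ‖(√(mollify (scale (ns k)) ν x + δ) - √δ) -
      (√(ρ x + δ) - √δ)‖ₑ) atTop (𝓝 0) := by
    have h1 := ENNReal.Tendsto.const_mul (a := ENNReal.ofReal (√δ)⁻¹)
      (h.tendsto_mollify.comp hns.tendsto_atTop) (Or.inr ENNReal.ofReal_ne_top)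
    rw [mul_zero] at h1
    refine tendsto_of_tendsto_of_tendsto_of_le_of_le tendsto_const_nhds h1 (fun _ => zero_le)
      fun k => ?_
    simp only [Function.comp_apply]
    rw [← lintegral_const_mul' _ _ ENNReal.ofReal_ne_top]
    refine lintegral_mono fun x => ?_
    rw [sub_sub_sub_cancel_right, ← ofReal_norm, ← ofReal_norm, ← ENNReal.ofReal_mul (by positivity)]
    refine ENNReal.ofReal_le_ofReal ?_
    have h2 := abs_sqrt_sub_sqrt_le hδ (a := mollify (scale (ns k)) ν x + δ) (b := ρ x + δ)
      (by linarith [mollify_pos (ν := ν) (hr k) x]) (by linarith [h.density_nonneg x])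
    rwa [add_sub_add_right_eq_sub] at h2
  have l1 := tendsto_integral_mul_of_tendsto_lintegral (h := fun _ => pd i φ) (g := pd i φ) hFi hfi
    hFf (fun _ => (contDiff_pd hφ i).continuous.aestronglyMeasurable) (fun _ => hφ1)
    (Eventually.of_forall fun x => tendsto_const_nhds)
  have l2 := tendsto_integral_mul_of_tendsto_lintegral (K := C * (√δ)⁻¹)
    (F := fun k x => mollifyGrad (scale (ns k)) ν x i) (f := fun x => ρ x * β x i)
    (h := fun k x => φ x / (2 * √(mollify (scale (ns k)) ν x + δ)))
    (g := fun x => φ x / (2 * √(ρ x + δ)))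
    (fun k => integrable_mollifyGrad_apply (ν := ν) (hr k) i) (h.integrable_grad i)
    ((h.tendsto_mollifyGrad i).comp hns.tendsto_atTop) (fun k => ?_) (fun k x => ?_) ?_
  · simp only [integral_sqrt_mollify_mul_pd (ν := ν) (hr _) hδ hφ i hφ0 hφ1] at l1
    exact tendsto_nhds_unique l1 l2.neg
  · have := continuous_mollify (ν := ν) (hr k)
    have := hφ.continuous
    exact Measurable.aestronglyMeasurable (by fun_prop)
  · have hU := mollify_pos (ν := ν) (hr k) x
    rw [abs_div, div_eq_mul_inv]
    have h1 : √δ ≤ |2 * √(mollify (scale (ns k)) ν x + δ)| := by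
      have h2 := Real.sqrt_le_sqrt (by linarith : δ ≤ mollify (scale (ns k)) ν x + δ)
      rw [abs_of_nonneg (by positivity)]
      linarith
    exact mul_le_mul (hφ0 x) (inv_anti₀ hδ0 h1) (by positivity) ((abs_nonneg _).trans (hφ0 x))
  · filter_upwards [hae] with x hx
    have hpos : 0 < √(ρ x + δ) := Real.sqrt_pos.2 (by linarith [h.density_nonneg x])
    exact tendsto_const_nhds.div ((hx.add_const δ).sqrt.const_mul 2) (by positivity)

/-- The square root of the density has a generalized gradient. -/
theorem HasLogGradient.hasWeakGradient_sqrt (h : HasLogGradient ν ρ β) :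
    HasWeakGradient (fun x => √(ρ x)) fun x => (√(ρ x) / 2) • β x := by
  have hρm := h.measurable_density
  have hβm := h.measurable_grad
  have hs1 : ∀ x, √(ρ x) ≤ 1 + ρ x := fun x => by
    have h1 := Real.sq_sqrt (h.density_nonneg x)
    nlinarith [sq_nonneg (√(ρ x) - 1), Real.sqrt_nonneg (ρ x)]
  have hs2 : ∀ x, √(ρ x) / 2 * ‖β x‖ ≤ 1 + ρ x * ‖β x‖ ^ 2 := fun x => by
    have h1 := Real.sq_sqrt (h.density_nonneg x)
    have h2 : ρ x * ‖β x‖ ^ 2 = (√(ρ x) * ‖β x‖) ^ 2 := by rw [mul_pow, h1]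
    rw [h2]
    nlinarith [sq_nonneg (√(ρ x) * ‖β x‖ - 1), mul_nonneg (Real.sqrt_nonneg (ρ x)) (norm_nonneg (β x))]
  refine ⟨?_, ?_, fun φ hφ hs i => ?_⟩
  · refine ((locallyIntegrable_const (1 : ℝ)).add h.integrable_density.locallyIntegrable).mono
      (by fun_prop) (Eventually.of_forall fun x => ?_)
    rw [Real.norm_of_nonneg (Real.sqrt_nonneg _)]
    exact (hs1 x).trans (le_abs_self _)
  · refine locallyIntegrable_of_norm_le_sq ((hρm.sqrt.div_const 2).smul hβm) h.integrable_mul_sq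
      fun x => ?_
    rw [norm_smul, Real.norm_of_nonneg (by positivity)]
    exact hs2 x
  obtain ⟨C, hC, hC0⟩ := exists_hasBoundedDerivs hφ hs
  have hφ1 := hC.abs_pd_le i
  have hβi := h.measurable_grad_apply i
  have hcφ := hφ.continuous
  have hcp := (contDiff_pd hφ i).continuous
  have hpi : Integrable fun x => ‖pd i φ x‖ :=
    (hcp.integrable_of_hasCompactSupport (HasCompactSupport.pd hs i)).norm
  have hφi : Integrable fun x => ‖φ x‖ := (hcφ.integrable_of_hasCompactSupport hs).norm
  -- Now δ tends to zero. The majorants are integrable multiples of φ and its derivative that no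
  -- longer involve δ.
  set δ : ℕ → ℝ := fun k => (scale k)⁻¹ with hδd
  have hδ : ∀ k, 0 < δ k := fun k => inv_pos.2 (scale_pos k)
  have hδ0 : Tendsto δ atTop (𝓝 0) := by
    simpa [hδd, scale, one_div] using tendsto_one_div_add_atTop_nhds_zero_nat (𝕜 := ℝ)
  have l1 : Tendsto (fun k => ∫ x, (√(ρ x + δ k) - √(δ k)) * pd i φ x) atTop
      (𝓝 (∫ x, √(ρ x) * pd i φ x)) := by
    refine tendsto_integral_of_dominated_convergence (fun x => (1 + ρ x) * ‖pd i φ x‖)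
      (fun k => Measurable.aestronglyMeasurable (by fun_prop)) ?_
      (fun k => Eventually.of_forall fun x => ?_) (Eventually.of_forall fun x => ?_)
    · refine (hpi.add (h.integrable_density.mul_bdd (c := C) hcp.norm.aestronglyMeasurable
        (Eventually.of_forall fun x => by rw [norm_norm]; exact hφ1 x))).congr
        (Eventually.of_forall fun x => ?_)
      simp only [Pi.add_apply]; ring
    · rw [norm_mul]
      refine mul_le_mul_of_nonneg_right (le_trans ?_ (hs1 x)) (norm_nonneg _)
      have h1 := Real.sqrt_le_sqrt (by linarith [h.density_nonneg x] : δ k ≤ ρ x + δ k)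
      rw [Real.norm_of_nonneg (by linarith)]
      have h2 : √(ρ x + δ k) ≤ √(ρ x) + √(δ k) := by
        rw [Real.sqrt_le_left (by positivity), add_sq, Real.sq_sqrt (h.density_nonneg x),
          Real.sq_sqrt (hδ k).le]
        have : 0 ≤ 2 * √(ρ x) * √(δ k) := by positivity
        linarith
      linarith
    · have h1 : Tendsto (fun k => √(ρ x + δ k) - √(δ k)) atTop (𝓝 (√(ρ x + 0) - √0)) :=
        (hδ0.const_add _).sqrt.sub hδ0.sqrt
      simpa using h1.mul_const (pd i φ x)
  have l2 : Tendsto (fun k => ∫ x, ρ x * β x i * (φ x / (2 * √(ρ x + δ k)))) atTop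
      (𝓝 (∫ x, ((√(ρ x) / 2) • β x) i * φ x)) := by
    -- The factor 1/√(ρ + δ) is unbounded as δ tends to 0, but multiplied by ρ it is at most √ρ.
    have hle : ∀ k x, ρ x / (2 * √(ρ x + δ k)) ≤ √(ρ x) / 2 := fun k x => by
      have hp := h.density_nonneg x
      have h1 := Real.sqrt_le_sqrt (by linarith [hδ k] : ρ x ≤ ρ x + δ k)
      have h2 : 0 < √(ρ x + δ k) := Real.sqrt_pos.2 (by linarith [hδ k])
      rw [div_le_div_iff₀ (by positivity) two_pos]
      nlinarith [Real.sq_sqrt hp, mul_le_mul_of_nonneg_left h1 (Real.sqrt_nonneg (ρ x))]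
    refine tendsto_integral_of_dominated_convergence (fun x => (1 + ρ x * ‖β x‖ ^ 2) * ‖φ x‖)
      (fun k => Measurable.aestronglyMeasurable (by fun_prop)) ?_
      (fun k => Eventually.of_forall fun x => ?_) (Eventually.of_forall fun x => ?_)
    · refine (hφi.add (h.integrable_mul_sq.mul_bdd (c := C) hcφ.norm.aestronglyMeasurable
        (Eventually.of_forall fun x => by rw [norm_norm]; exact hC0 x))).congr
        (Eventually.of_forall fun x => ?_)
      simp only [Pi.add_apply]; ring
    · have e : ρ x * β x i * (φ x / (2 * √(ρ x + δ k))) =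
          ρ x / (2 * √(ρ x + δ k)) * β x i * φ x := by ring
      have hp := h.density_nonneg x
      rw [e, norm_mul, norm_mul, Real.norm_of_nonneg (by positivity)]
      refine mul_le_mul_of_nonneg_right (le_trans ?_ (hs2 x)) (norm_nonneg _)
      exact mul_le_mul (hle k x) (abs_apply_le_norm _ i) (abs_nonneg _) (by positivity)
    · rcases (h.density_nonneg x).eq_or_lt with h0 | h0
      · simp [← h0]
      · have h1 : Tendsto (fun k => ρ x * β x i * (φ x / (2 * √(ρ x + δ k)))) atTop
            (𝓝 (ρ x * β x i * (φ x / (2 * √(ρ x + 0))))) :=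
          (tendsto_const_nhds.div ((hδ0.const_add _).sqrt.const_mul 2)
            (by rw [add_zero]; have := Real.sqrt_pos.2 h0; positivity)).const_mul _
        convert h1 using 2
        have h2 := Real.sqrt_pos.2 h0
        rw [add_zero, PiLp.smul_apply, smul_eq_mul]
        field_simp
        rw [Real.sq_sqrt h0.le]
        ring
  simp only [h.integral_sqrt_add_mul_pd (hδ _) hφ i hC0 hφ1] at l1
  exact tendsto_nhds_unique l1 l2.neg

end Sqrt


/-! ### Sobolev inequalities without compact support -/

section Sobolev
variable {d : ℕ}

lemma norm_fderiv_le_of_abs_pd_le {f : Space d → ℝ} {K : ℝ} (x : Space d)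
    (h : ∀ i, |pd i f x| ≤ K) (hK : 0 ≤ K) : ‖fderiv ℝ f x‖ ≤ d * K := by
  refine ContinuousLinearMap.opNorm_le_bound _ (by positivity) fun y => ?_
  have hy : fderiv ℝ f x y = ∑ i, y i * pd i f x := by
    conv_lhs => rw [← (EuclideanSpace.basisFun (Fin d) ℝ).sum_repr y]
    simp [pd]
  rw [hy]
  refine (norm_sum_le _ _).trans ?_
  calc ∑ i, ‖y i * pd i f x‖ ≤ ∑ _i : Fin d, ‖y‖ * K := Finset.sum_le_sum fun i _ => by
        rw [norm_mul]
        exact mul_le_mul (abs_apply_le_norm y i) (h i) (norm_nonneg _) (norm_nonneg _)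
    _ = d * K * ‖y‖ := by simp; ring

/-- An inequality for compactly supported functions extends to functions that need not vanish at
infinity, at the cost of a lower order term. -/
lemma exists_eLpNorm_le_of_compactSupport (d : ℕ) : ∃ K : ℝ≥0, ∀ (p q : ℝ≥0∞) (C : ℝ≥0∞), 1 ≤ p →
    (∀ u : Space d → ℝ, ContDiff ℝ 1 u → HasCompactSupport u →
      eLpNorm u q volume ≤ C * eLpNorm (fderiv ℝ u) p volume) →
    ∀ w : Space d → ℝ, ContDiff ℝ 1 w →
      eLpNorm w q volume ≤ C * (eLpNorm (fderiv ℝ w) p volume + K * eLpNorm w p volume) := by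
  obtain ⟨K, η, hK, hη, hηs, b0, b1, -, l0, -⟩ := exists_cutoff d
  refine ⟨(d * K).toNNReal, fun p q C hp hC w hw => ?_⟩
  have hw' : Continuous (fderiv ℝ w) := hw.continuous_fderiv (by simp)
  -- The inequality is applied to cutoffs η_n w and passes to w by lower semicontinuity; the bounded
  -- gradients of η_n produce the lower order term.
  refine Lp.eLpNorm_le_of_ae_tendsto (u := atTop) (f := fun n x => η n x * w x)
    (Eventually.of_forall fun n => ?_)
    (fun n => ((hη n).continuous.mul hw.continuous).aestronglyMeasurable)
    (Eventually.of_forall fun x => by simpa using (l0 x).mul_const (w x))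
  have hη1 : ContDiff ℝ 1 (η n) := (hη n).of_le (by simp)
  have hη' : Continuous (fderiv ℝ (η n)) := hη1.continuous_fderiv (by simp)
  refine (hC _ (hη1.mul hw) ((hηs n).mul_right)).trans (mul_le_mul_right ?_ C)
  have e : fderiv ℝ (fun x => η n x * w x) =
      (fun x => η n x • fderiv ℝ w x) + fun x => w x • fderiv ℝ (η n) x := funext fun x =>
    fderiv_fun_mul (hη1.differentiable (by simp) x) (hw.differentiable (by simp) x)
  rw [e]
  refine (eLpNorm_add_le (hη1.continuous.smul hw').aestronglyMeasurable
    (hw.continuous.smul hη').aestronglyMeasurable hp).trans (add_le_add ?_ ?_)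
  · refine eLpNorm_mono fun x => ?_
    rw [Pi.smul_apply', norm_smul]
    exact mul_le_of_le_one_left (norm_nonneg _) (b0 n x)
  · refine eLpNorm_le_nnreal_smul_eLpNorm_of_ae_le_mul (Eventually.of_forall fun x => ?_) p
    rw [← NNReal.coe_le_coe, NNReal.coe_mul, coe_nnnorm, coe_nnnorm, Pi.smul_apply',
      norm_smul, mul_comm,
      Real.coe_toNNReal _ (by positivity)]
    exact mul_le_mul_of_nonneg_right (norm_fderiv_le_of_abs_pd_le x (fun i => b1 n i x) hK)
      (norm_nonneg _)

end Sobolev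

/-! ### The square root of a mollification and the case d > 2 -/

section Sqrt
variable {d : ℕ} {ν : Measure (Space d)} {ρ : Space d → ℝ} {β : Space d → Space d}
  [IsProbabilityMeasure ν]

lemma contDiff_sqrt_mollify {r : ℝ} (hr : 0 < r) :
    ContDiff ℝ 1 fun x : Space d => √(mollify r ν x) :=
  (contDiff_mollify hr).sqrt fun x => (mollify_pos hr x).ne'

lemma eLpNorm_sqrt_mollify {r : ℝ} (hr : 0 < r) :
    eLpNorm (fun x : Space d => √(mollify r ν x)) 2 volume = 1 := by
  refine ENNReal.rpow_left_injective (x := 2) two_ne_zero (Eq.trans ?_ (ENNReal.one_rpow 2).symm)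
  beta_reduce
  obtain ⟨hi, h1⟩ := integral_mollify_eq_one (ν := ν) hr
  have := eLpNorm_nnreal_pow_eq_lintegral (p := 2) (μ := volume)
    (f := fun x : Space d => √(mollify r ν x)) (by simp)
  rw [show ((2 : ℝ≥0) : ℝ≥0∞) = 2 from rfl, show ((2 : ℝ≥0) : ℝ) = 2 from rfl] at this
  rw [this, ← ENNReal.ofReal_one, ← h1,
    ofReal_integral_eq_lintegral_ofReal hi (Eventually.of_forall fun x => (mollify_pos hr x).le)]
  refine lintegral_congr fun x => ?_
  rw [← ofReal_norm, ENNReal.ofReal_rpow_of_nonneg (norm_nonneg _) zero_le_two,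
    Real.norm_of_nonneg (Real.sqrt_nonneg _), Real.rpow_two,
    Real.sq_sqrt (mollify_pos hr x).le]

/-- Cauchy's inequality for the gradient of a mollification. -/
lemma HasLogGradient.norm_mollifyGrad_le (h : HasLogGradient ν ρ β) (n : ℕ) :
    ∀ᵐ x : Space d, ‖mollifyGrad (scale n) ν x‖ ≤
      √(mollify (scale n) ν x) * √(∫ y, ‖β y‖ ^ 2 * moll (scale n) (x - y) ∂ν) := by
  filter_upwards [h.mollifyGrad_eq n] with x hx
  have hr := scale_pos n
  have hm := (continuous_moll_sub (scale n) x).aestronglyMeasurable (μ := ν)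
  have hb : ∀ᵐ y ∂ν, ‖moll (scale n) (x - y)‖ ≤ mollMax d (scale n) :=
    Eventually.of_forall fun y => by
      rw [Real.norm_of_nonneg (moll_pos hr _).le]; exact moll_le hr _
  have i1 : Integrable (fun y => ‖β y‖ * moll (scale n) (x - y)) ν := h.integrable_norm.mul_bdd hm hb
  have i2 : Integrable (fun y => ‖β y‖ ^ 2 * moll (scale n) (x - y)) ν :=
    h.integrable_sq.mul_bdd hm hb
  have i0 : Integrable (fun y => moll (scale n) (x - y) • β y) ν := by
    refine i1.mono' (hm.smul h.measurable_grad.aestronglyMeasurable)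
      (Eventually.of_forall fun y => ?_)
    rw [norm_smul, Real.norm_of_nonneg (moll_pos hr _).le, mul_comm]
  have e : mollifyGrad (scale n) ν x = ∫ y, moll (scale n) (x - y) • β y ∂ν := by
    ext i
    rw [hx i]
    refine Eq.trans ?_ ((EuclideanSpace.proj (𝕜 := ℝ) i : Space d →L[ℝ] ℝ).integral_comp_comm i0)
    exact integral_congr_ae (Eventually.of_forall fun y => by simp [mul_comm])
  have hle : ‖mollifyGrad (scale n) ν x‖ ≤ ∫ y, ‖β y‖ * moll (scale n) (x - y) ∂ν := by
    rw [e]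
    refine (norm_integral_le_integral_norm _).trans (le_of_eq (integral_congr_ae
      (Eventually.of_forall fun y => ?_)))
    simp only [norm_smul, Real.norm_of_nonneg (moll_pos hr _).le, mul_comm]
  refine (le_abs_self _).trans (le_sqrt_mul_sqrt (integral_nonneg fun y =>
    mul_nonneg (sq_nonneg _) (moll_pos hr _).le) (mollify_pos hr x).le fun ε hε => ?_)
  rw [abs_norm]
  refine hle.trans ?_
  rw [mollify, ← integral_const_mul, ← integral_const_mul,
    ← integral_add (i2.const_mul _) ((integrable_moll_sub hr x).const_mul _)]
  refine integral_mono i1 ((i2.const_mul _).add ((integrable_moll_sub hr x).const_mul _)) fun y => ?_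
  have h1 : ‖β y‖ ≤ ε / 2 * ‖β y‖ ^ 2 + 1 / (2 * ε) := by
    have : ε / 2 * ‖β y‖ ^ 2 + 1 / (2 * ε) - ‖β y‖ = (ε * ‖β y‖ - 1) ^ 2 / (2 * ε) := by
      field_simp; ring
    have : 0 ≤ (ε * ‖β y‖ - 1) ^ 2 / (2 * ε) := by positivity
    linarith
  have := mul_le_mul_of_nonneg_right h1 (moll_pos hr (x - y)).le
  linarith

/-- By Cauchy's inequality |∇√u|² = |∇u|²/(4u) is at most ∫|β|² N(x - y) dν(y), and the kernel has
unit mass in x. The bound is free of r. -/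
lemma HasLogGradient.eLpNorm_fderiv_sqrt_mollify_le (h : HasLogGradient ν ρ β) (n : ℕ) :
    eLpNorm (fderiv ℝ fun x => √(mollify (scale n) ν x)) 2 volume ^ (2 : ℝ) ≤
      ENNReal.ofReal (∫ x, ‖β x‖ ^ 2 ∂ν) := by
  have hr := scale_pos n
  have hw : Measurable fun x => ‖β x‖ ^ 2 := h.measurable_grad.norm.pow_const 2
  have hpi := integrable_prod_moll_of_integrable (ν := ν) hr hw (fun _ => sq_nonneg _)
    h.integrable_sq
  have := eLpNorm_nnreal_pow_eq_lintegral (p := 2) (μ := volume)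
    (f := fderiv ℝ fun x : Space d => √(mollify (scale n) ν x)) (by simp)
  rw [show ((2 : ℝ≥0) : ℝ≥0∞) = 2 from rfl, show ((2 : ℝ≥0) : ℝ) = 2 from rfl] at this
  rw [this, ← integral_prod_moll (ν := ν) hr hw (fun _ => sq_nonneg _) h.integrable_sq,
    integral_prod _ hpi, ofReal_integral_eq_lintegral_ofReal hpi.integral_prod_left
      (Eventually.of_forall fun x => integral_nonneg fun y =>
        mul_nonneg (sq_nonneg _) (moll_pos hr _).le)]
  refine lintegral_mono_ae ?_
  filter_upwards [h.norm_mollifyGrad_le n] with x hx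
  rw [← ofReal_norm, ENNReal.ofReal_rpow_of_nonneg (norm_nonneg _) zero_le_two, Real.rpow_two]
  refine ENNReal.ofReal_le_ofReal ?_
  have hU := Real.sqrt_pos.2 (mollify_pos (ν := ν) hr x)
  have hX : 0 ≤ ∫ y, ‖β y‖ ^ 2 * moll (scale n) (x - y) ∂ν :=
    integral_nonneg fun y => mul_nonneg (sq_nonneg _) (moll_pos hr _).le
  have hd : ‖fderiv ℝ (fun x => √(mollify (scale n) ν x)) x‖ =
      ‖mollifyGrad (scale n) ν x‖ / (2 * √(mollify (scale n) ν x)) := by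
    rw [((hasFDerivAt_mollify hr x).sqrt (mollify_pos hr x).ne').fderiv, norm_smul, innerSL_apply_norm,
      Real.norm_of_nonneg (by positivity)]
    ring
  have h2 : ‖fderiv ℝ (fun x => √(mollify (scale n) ν x)) x‖ ≤
      √(∫ y, ‖β y‖ ^ 2 * moll (scale n) (x - y) ∂ν) := by
    rw [hd, div_le_iff₀ (by positivity)]
    nlinarith [mul_nonneg hU.le (Real.sqrt_nonneg
      (∫ y, ‖β y‖ ^ 2 * moll (scale n) (x - y) ∂ν))]
  calc _ ≤ √(∫ y, ‖β y‖ ^ 2 * moll (scale n) (x - y) ∂ν) ^ 2 :=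
        pow_le_pow_left₀ (norm_nonneg _) h2 2
    _ = _ := Real.sq_sqrt hX

/-- A bound for the mollifications passes to the density. -/
lemma HasLogGradient.eLpNorm_density_le (h : HasLogGradient ν ρ β) {p B : ℝ≥0∞}
    (hB : ∀ n, eLpNorm (mollify (scale n) ν) p volume ≤ B) : eLpNorm ρ p volume ≤ B := by
  obtain ⟨ns, -, hns⟩ := h.exists_subseq
  exact Lp.eLpNorm_le_of_ae_tendsto (u := atTop) (f := fun k => mollify (scale (ns k)) ν)
    (Eventually.of_forall fun k => hB _)
    (fun k => (continuous_mollify (scale_pos _)).aestronglyMeasurable) hns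

/-- Brings squared Sobolev bounds into a form linear in F, which for the Fisher information is
integrable in time. -/
lemma add_sq_le_mul_one_add {a b F : ℝ≥0∞} (ha : a ^ (2 : ℝ) ≤ F) :
    (a + b) ^ (2 : ℝ) ≤ 2 * (1 + b ^ (2 : ℝ)) * (1 + F) := by
  have h := ENNReal.rpow_add_le_mul_rpow_add_rpow a b (p := 2) one_le_two
  rw [show (2 : ℝ) - 1 = 1 by norm_num, ENNReal.rpow_one] at h
  refine h.trans ?_
  rw [mul_assoc]
  refine mul_le_mul_right ((add_le_add_left ha _).trans ?_) 2
  calc F + b ^ (2 : ℝ) ≤ F + b ^ (2 : ℝ) + (1 + b ^ (2 : ℝ) * F) := le_self_add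
    _ = _ := by ring

/-- The Sobolev bound for the density in dimension `d > 2`. -/
theorem exists_eLpNorm_density_le_of_two_lt (hd : 2 < d) : ∃ C : ℝ≥0,
    ∀ (ν : Measure (Space d)) [IsProbabilityMeasure ν] (ρ : Space d → ℝ) (β : Space d → Space d),
      HasLogGradient ν ρ β → eLpNorm ρ (ENNReal.ofReal ((d : ℝ) / ((d : ℝ) - 2))) volume ≤
        C * (1 + ENNReal.ofReal (∫ x, ‖β x‖ ^ 2 ∂ν)) := by
  have hd' : (2 : ℝ) < d := by exact_mod_cast hd
  obtain ⟨K, hK⟩ := exists_eLpNorm_le_of_compactSupport d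
  -- The Sobolev exponent 2d/(d - 2) conjugate to 2; the square of the norm of √u in it is the norm
  -- of u in the exponent d/(d - 2).
  set p' : ℝ≥0 := (2 * ((d : ℝ) / ((d : ℝ) - 2))).toNNReal with hp'
  have hpos : 0 < (d : ℝ) / ((d : ℝ) - 2) := div_pos (by linarith) (by linarith)
  have hp'c : (p' : ℝ) = 2 * ((d : ℝ) / ((d : ℝ) - 2)) := Real.coe_toNNReal _ (by positivity)
  set C := SNormLESNormFDerivOfEqConst ℝ (volume : Measure (Space d)) 2 with hC
  have hGNS : ∀ u : Space d → ℝ, ContDiff ℝ 1 u → HasCompactSupport u →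
      eLpNorm u p' volume ≤ C * eLpNorm (fderiv ℝ u) 2 volume := fun u hu hs => by
    refine eLpNorm_le_eLpNorm_fderiv_of_eq volume hu hs (p := 2) (p' := p') (by norm_num)
      (by simp; omega) ?_
    rw [hp'c, finrank_euclideanSpace_fin]
    have : (d : ℝ) - 2 ≠ 0 := by linarith
    have : (d : ℝ) ≠ 0 := by linarith
    simp only [NNReal.coe_inv, NNReal.coe_ofNat]
    field_simp
  refine ⟨C ^ 2 * (2 * (1 + K ^ 2)), fun ν _ ρ β h => h.eLpNorm_density_le fun n => ?_⟩
  have hr := scale_pos n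
  have h1 := hK 2 p' C (by norm_num) hGNS _ (contDiff_sqrt_mollify (ν := ν) hr)
  rw [eLpNorm_sqrt_mollify hr, mul_one] at h1
  have h2 : eLpNorm (mollify (scale n) ν) (ENNReal.ofReal ((d : ℝ) / ((d : ℝ) - 2))) volume =
      eLpNorm (fun x => √(mollify (scale n) ν x)) p' volume ^ (2 : ℝ) := by
    have e : mollify (scale n) ν = fun x => ‖√(mollify (scale n) ν x)‖ ^ (2 : ℝ) := funext fun x => by
      rw [Real.norm_of_nonneg (Real.sqrt_nonneg _), Real.rpow_two,
        Real.sq_sqrt (mollify_pos hr x).le]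
    have e2 : (p' : ℝ≥0∞) = ENNReal.ofReal ((d : ℝ) / ((d : ℝ) - 2)) * ENNReal.ofReal 2 := by
      rw [← ENNReal.ofReal_mul hpos.le, mul_comm, ENNReal.ofReal, hp']
    conv_lhs => rw [e]
    rw [eLpNorm_norm_rpow _ two_pos, e2]
  rw [h2]
  calc _ ≤ (C * (eLpNorm (fderiv ℝ fun x => √(mollify (scale n) ν x)) 2 volume + K)) ^ (2 : ℝ) :=
        ENNReal.rpow_le_rpow h1 zero_le_two
    _ ≤ C ^ (2 : ℝ) * (2 * (1 + K ^ (2 : ℝ)) * (1 + ENNReal.ofReal (∫ x, ‖β x‖ ^ 2 ∂ν))) := by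
        rw [ENNReal.mul_rpow_of_nonneg _ _ zero_le_two]
        gcongr
        exact add_sq_le_mul_one_add (h.eLpNorm_fderiv_sqrt_mollify_le n)
    _ = _ := by
        simp only [ENNReal.rpow_two]
        push_cast
        ring

end Sqrt


/-! ### The case d = 2 -/

section Plane
variable {d : ℕ}

/-- Induction on the power through the planar embedding of W^{1,1} in L². The gradient of w^(m+2) is
(m + 2)w^(m+1)∇w, so by Cauchy–Schwarz its L¹ norm is controlled by the previous power times ‖∇w‖;
the lower order term uses ‖w‖ = 1 in L². -/
lemma exists_eLpNorm_pow_le (hd : d = 2) (m : ℕ) : ∃ C : ℝ≥0, ∀ w : Space d → ℝ, ContDiff ℝ 1 w →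
    eLpNorm w 2 volume = 1 →
    eLpNorm (fun x => w x ^ (m + 1)) 2 volume ≤ C * (1 + eLpNorm (fderiv ℝ w) 2 volume) ^ m := by
  induction m with
  | zero => exact ⟨1, fun w _ h => by simp [h]⟩
  | succ m ih =>
    obtain ⟨C, hC⟩ := ih
    obtain ⟨K, hK⟩ := exists_eLpNorm_le_of_compactSupport d
    set C₁ := eLpNormLESNormFDerivOneConst (volume : Measure (Space d)) (2 : ℝ≥0)
    have hconj : NNReal.HolderConjugate (Module.finrank ℝ (Space d)) 2 := by
      rw [finrank_euclideanSpace_fin, hd]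
      exact_mod_cast NNReal.HolderConjugate.two_two
    refine ⟨C₁ * (m + 2 + K) * C, fun w hw h1 => ?_⟩
    have hwm := (hw.pow (m + 1)).continuous.aestronglyMeasurable (μ := volume)
    have hw' : Continuous (fderiv ℝ w) := hw.continuous_fderiv (by simp)
    set F := eLpNorm (fderiv ℝ w) 2 volume
    set X := eLpNorm (fun x => w x ^ (m + 1)) 2 volume
    have e1 : eLpNorm (fderiv ℝ fun x => w x ^ (m + 1 + 1)) 1 volume ≤ (m + 2 : ℝ≥0) * (X * F) := by
      have e : fderiv ℝ (fun x => w x ^ (m + 1 + 1)) =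
          (m + 2 : ℝ) • ((fun x => w x ^ (m + 1)) • fderiv ℝ w) := funext fun x => by
        rw [fderiv_fun_pow _ (hw.differentiable (by simp) x)]
        simp [smul_smul]
        ring_nf
      rw [e, eLpNorm_const_smul (m + 2 : ℝ) ((fun x => w x ^ (m + 1)) • fderiv ℝ w) 1 volume]
      refine mul_le_mul' (le_of_eq ?_)
        (eLpNorm_smul_le_mul_eLpNorm hw'.aestronglyMeasurable hwm)
      rw [← ofReal_norm, Real.norm_of_nonneg (by positivity), ENNReal.ofReal]
      congr 1
      exact NNReal.coe_injective (by rw [Real.coe_toNNReal _ (by positivity)]; push_cast; rfl)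
    have e2 : eLpNorm (fun x => w x ^ (m + 1 + 1)) 1 volume ≤ X := by
      have := eLpNorm_smul_le_mul_eLpNorm (r := 1) (p := 2) (q := 2)
        hw.continuous.aestronglyMeasurable hwm
      rw [h1, mul_one] at this
      exact this
    have e3 := hK 1 (2 : ℝ≥0) C₁ le_rfl
      (fun u hu hs => eLpNorm_le_eLpNorm_fderiv_one volume hu hs hconj) _ (hw.pow (m + 1 + 1))
    refine e3.trans ?_
    calc C₁ * (eLpNorm (fderiv ℝ fun x => w x ^ (m + 1 + 1)) 1 volume +
          K * eLpNorm (fun x => w x ^ (m + 1 + 1)) 1 volume)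
        ≤ C₁ * ((m + 2 : ℝ≥0) * (X * F) + K * X) := by gcongr
      _ ≤ C₁ * ((m + 2 : ℝ≥0) * (X * F) + K * X + ((m + 2 : ℝ≥0) * X + K * (X * F))) := by
          exact mul_le_mul_right le_self_add _
      _ = C₁ * (m + 2 + K : ℝ≥0) * X * (1 + F) := by push_cast; ring
      _ ≤ C₁ * (m + 2 + K : ℝ≥0) * (C * (1 + F) ^ m) * (1 + F) := by gcongr; exact hC w hw h1
      _ = _ := by push_cast; ring

lemma rpow_le_add_pow {u s : ℝ} {m : ℕ} (hu : 0 < u) (h1 : 1 ≤ s) (hs : s ≤ m) :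
    u ^ s ≤ u + u ^ m := by
  rcases le_total u 1 with h | h
  · have := Real.rpow_le_rpow_of_exponent_ge hu h h1
    rw [Real.rpow_one] at this
    linarith [pow_pos hu m]
  · have := Real.rpow_le_rpow_of_exponent_le h hs
    rw [Real.rpow_natCast] at this
    linarith

/-- The integrability bound for the density in dimension `d = 2`. -/
theorem exists_eLpNorm_density_le_of_eq_two (hd : d = 2) {s : ℝ} (hs : 1 ≤ s) : ∃ C : ℝ≥0,
    ∀ (ν : Measure (Space d)) [IsProbabilityMeasure ν] (ρ : Space d → ℝ) (β : Space d → Space d),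
      HasLogGradient ν ρ β → eLpNorm ρ (ENNReal.ofReal s) volume ≤
        C * (1 + ENNReal.ofReal (∫ x, ‖β x‖ ^ 2 ∂ν)) := by
  have hs0 : 0 < s := by linarith
  -- Here m + 1 = ⌈s⌉, so that m ≤ s ≤ m + 1: the upper bound interpolates u^s between u and
  -- u^(m+1), the lower one limits the power of the gradient.
  obtain ⟨m, hm⟩ := Nat.exists_eq_succ_of_ne_zero (Nat.ceil_pos.2 hs0).ne'
  have hsm : s ≤ (m + 1 : ℕ) := by rw [← Nat.succ_eq_add_one, ← hm]; exact Nat.le_ceil s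
  have hms : (m : ℝ) ≤ s := by
    have := Nat.ceil_lt_add_one hs0.le
    rw [hm] at this
    push_cast at this
    linarith
  obtain ⟨C, hC⟩ := exists_eLpNorm_pow_le hd m
  refine ⟨(1 + C ^ 2) * 4, fun ν _ ρ β h => h.eLpNorm_density_le fun n => ?_⟩
  have hr := scale_pos n
  have hw := contDiff_sqrt_mollify (ν := ν) hr
  have hX := hC _ hw (eLpNorm_sqrt_mollify (ν := ν) hr)
  have hF := add_sq_le_mul_one_add (b := 1) (h.eLpNorm_fderiv_sqrt_mollify_le n)
  set F := eLpNorm (fderiv ℝ fun x => √(mollify (scale n) ν x)) 2 volume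
  set X := eLpNorm (fun x => √(mollify (scale n) ν x) ^ (m + 1)) 2 volume with hXdef
  obtain ⟨hi, hi1⟩ := integral_mollify_eq_one (ν := ν) hr
  have hX2 : X ^ 2 = ∫⁻ x, ENNReal.ofReal (mollify (scale n) ν x ^ (m + 1)) := by
    have := eLpNorm_nnreal_pow_eq_lintegral (p := 2) (μ := volume)
      (f := fun x => √(mollify (scale n) ν x) ^ (m + 1)) (by simp)
    rw [show ((2 : ℝ≥0) : ℝ≥0∞) = 2 from rfl, show ((2 : ℝ≥0) : ℝ) = 2 from rfl, ← hXdef,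
      ENNReal.rpow_two] at this
    rw [this]
    refine lintegral_congr fun x => ?_
    rw [← ofReal_norm, ENNReal.ofReal_rpow_of_nonneg (norm_nonneg _) zero_le_two,
      Real.norm_of_nonneg (by positivity), Real.rpow_two, ← pow_mul, mul_comm (m + 1), pow_mul,
      Real.sq_sqrt (mollify_pos hr x).le]
  have hU1 : ∫⁻ x, ENNReal.ofReal (mollify (scale n) ν x) = 1 := by
    rw [← ofReal_integral_eq_lintegral_ofReal hi
      (Eventually.of_forall fun x => (mollify_pos hr x).le), hi1, ENNReal.ofReal_one]
  have hUs : eLpNorm (mollify (scale n) ν) (ENNReal.ofReal s) volume ^ s ≤ 1 + X ^ 2 := by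
    have := eLpNorm_nnreal_pow_eq_lintegral (p := s.toNNReal) (μ := volume)
      (f := mollify (scale n) ν) (by simpa using hs0)
    rw [Real.coe_toNNReal s hs0.le] at this
    rw [ENNReal.ofReal, this, hX2, ← hU1, ← lintegral_add_left
      (continuous_mollify hr).measurable.ennreal_ofReal]
    refine lintegral_mono fun x => ?_
    have hp := mollify_pos (ν := ν) hr x
    rw [← ofReal_norm, ENNReal.ofReal_rpow_of_nonneg (norm_nonneg _) hs0.le,
      Real.norm_of_nonneg hp.le, ← ENNReal.ofReal_add hp.le (by positivity)]
    exact ENNReal.ofReal_le_ofReal (rpow_le_add_pow hp hs hsm)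
  have hone : (1 : ℝ≥0∞) ≤ 1 + F := le_self_add
  have h1 : eLpNorm (mollify (scale n) ν) (ENNReal.ofReal s) volume ≤ (1 + C ^ 2) * (1 + F) ^ 2 := by
    rw [← ENNReal.rpow_le_rpow_iff hs0]
    refine hUs.trans ?_
    calc 1 + X ^ 2 ≤ 1 + (C * (1 + F) ^ m) ^ 2 := by gcongr
      _ ≤ (1 + F) ^ (2 * m) + C ^ 2 * (1 + F) ^ (2 * m) := by
          rw [mul_pow, ← pow_mul, mul_comm m]
          gcongr
          exact one_le_pow₀ hone
      _ = (1 + C ^ 2) * ((1 + F) ^ 2) ^ (m : ℝ) := by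
          rw [ENNReal.rpow_natCast, ← pow_mul]; ring
      -- Since m ≤ s, 1 ≤ s and both bases are at least 1, the s-th root leaves (1 + F)², which is
      -- linear in ∫|β|² dν and so integrable in time.
      _ ≤ (1 + C ^ 2) ^ s * ((1 + F) ^ 2) ^ s := by
          refine mul_le_mul' ?_ (ENNReal.rpow_le_rpow_of_exponent_le (one_le_pow₀ hone) hms)
          conv_lhs => rw [← ENNReal.rpow_one (1 + (C : ℝ≥0∞) ^ 2)]
          exact ENNReal.rpow_le_rpow_of_exponent_le le_self_add hs
      _ = _ := (ENNReal.mul_rpow_of_nonneg _ _ hs0.le).symm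
  refine h1.trans ?_
  rw [ENNReal.rpow_two, ENNReal.one_rpow, add_comm F 1] at hF
  calc _ ≤ (1 + (C : ℝ≥0∞) ^ 2) * (2 * (1 + 1) * (1 + ENNReal.ofReal (∫ x, ‖β x‖ ^ 2 ∂ν))) := by
        gcongr
    _ = _ := by push_cast; ring

end Plane


/-! ### Assembly of the theorem -/

section Final
variable {d : ℕ} {A : ℝ × Space d → Matrix (Fin d) (Fin d) ℝ} {b : ℝ × Space d → Space d}
  {κ : Kernel ℝ (Space d)} {M α lam : ℝ}

/-- The drift is only almost everywhere measurable; a measurable representative changes neither L u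
μ-almost everywhere nor the L²-norm. -/
lemma IsSolution.exists_evolution (h : IsSolution A b κ) (hA : ∀ i j, Measurable fun z => A z i j)
    (hi : HasInitialCondition κ (κ 0)) (hM : ∀ t ∈ Ioo (0 : ℝ) 1, ∀ x i j, |A (t, x) i j| ≤ M)
    (hb : MemLp b 2 (spaceTime κ)) : ∃ b', Evolution A b' κ M := by
  have hbm : AEStronglyMeasurable b (spaceTime κ) := hb.1
  refine ⟨hbm.mk b, hA, hbm.stronglyMeasurable_mk.measurable, hM, ?_, fun u hu hs ht => ?_, hi⟩
  · exact (memLp_two_iff_integrable_sq_norm hbm.stronglyMeasurable_mk.aestronglyMeasurable).1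
      ((memLp_congr_ae hbm.ae_eq_mk).1 hb)
  · rw [← h.integral_eq_zero u hu hs ht]
    refine integral_congr_ae ?_
    filter_upwards [hbm.ae_eq_mk] with z hz
    simp only [opL, hz]

lemma continuous_logMax : Continuous (logMax : Space d → ℝ) := by
  unfold logMax
  exact (continuous_norm.max continuous_const).log fun x => by positivity

lemma memLp_logMax_iff {Y : Type*} [MeasurableSpace Y] {ν : Measure Y} [IsFiniteMeasure ν]
    {f : Y → Space d} (hf : Measurable f) :
    MemLp (fun y => logMax (f y)) 2 ν ↔ Integrable (fun y => logBracket 1 (f y) ^ 2) ν := by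
  have hm : AEStronglyMeasurable (fun y => logMax (f y)) ν :=
    (continuous_logMax.measurable.comp hf).aestronglyMeasurable
  have hm' : Measurable fun y => logBracket 1 (f y) := (continuous_logBracket 1).measurable.comp hf
  rw [memLp_two_iff_integrable_sq_norm hm]
  constructor <;> intro h
  · have h2 : Integrable (fun y => 8 * ‖logMax (f y)‖ ^ 2 + 2 * Real.log 2 ^ 2) ν :=
      (h.const_mul 8).add (integrable_const _)
    refine h2.mono' (hm'.pow_const 2).aestronglyMeasurable (Eventually.of_forall fun y => ?_)
    rw [Real.norm_of_nonneg (sq_nonneg _), Real.norm_of_nonneg (logMax_nonneg _)]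
    have h3 := logBracket_le_logMax (f y)
    have h4 := logBracket_nonneg 1 (f y)
    nlinarith [sq_nonneg (2 * logMax (f y) - Real.log 2)]
  · refine h.mono' (hm.norm.pow 2) (Eventually.of_forall fun y => ?_)
    rw [Real.norm_of_nonneg (sq_nonneg _), Real.norm_of_nonneg (logMax_nonneg _)]
    exact pow_le_pow_left₀ (logMax_nonneg _) (logMax_le_logBracket _) 2

variable [IsMarkovKernel κ]

/-- The moments of ℓ² at almost all times exceed the one at time 0 by at most a constant, and the
time interval has length one. -/
theorem memLp_logMax_spaceTime (hE : Evolution A b κ M)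
    (h0 : MemLp (fun x : Space d => logMax x) 2 (κ 0)) :
    MemLp (fun z : ℝ × Space d => logMax z.2) 2 (spaceTime κ) := by
  have h1 := (memLp_logMax_iff measurable_id).1 h0
  rw [memLp_logMax_iff measurable_snd]
  have hm : Measurable fun z : ℝ × Space d => logBracket 1 z.2 ^ 2 :=
    measurable_logBracket_snd.pow_const 2
  refine ⟨hm.aestronglyMeasurable,
    (hasFiniteIntegral_iff_ofReal (Eventually.of_forall fun z => sq_nonneg _)).2 ?_⟩
  obtain ⟨D, hD⟩ := exists_moment_bound hE hasBoundedDerivs_logBracket_sq fun x => sq_nonneg _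
  have hfin := (hasFiniteIntegral_iff_ofReal (Eventually.of_forall fun z => sq_nonneg _)).1 h1.2
  rw [lintegral_spaceTime hm.ennreal_ofReal]
  refine (lintegral_mono_ae (hD.mono fun t ht => ht.1)).trans_lt ?_
  rw [lintegral_const, measure_univ, mul_one]
  exact ENNReal.add_lt_top.2 ⟨hfin, ENNReal.coe_lt_top⟩

/-- The solution has densities with square integrable logarithmic gradients. -/
theorem exists_hasLogGradient (hE : Evolution A b κ M)
    (hl : Integrable (fun z => logBracket 1 z.2 ^ 2) (spaceTime κ)) (hα : 0 < α)
    (hlam : 0 ≤ lam) (hell : ∀ t ∈ Ioo (0 : ℝ) 1, ∀ x, ∀ ξ : Space d,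
      α * ‖ξ‖ ^ 2 ≤ ∑ i, ∑ j, A (t, x) i j * ξ i * ξ j)
    (hlip : ∀ t ∈ Ioo (0 : ℝ) 1, ∀ i j x y, |A (t, x) i j - A (t, y) i j| ≤ lam * ‖x - y‖)
    (hent : HasFiniteEntropy (κ 0)) :
    ∃ (ρ : ℝ × Space d → ℝ) (β : ℝ × Space d → Space d), Measurable ρ ∧ Measurable β ∧
      (∀ z, 0 ≤ ρ z) ∧ Integrable (fun z => ‖β z‖ ^ 2) (spaceTime κ) ∧
      ∀ᵐ t ∂timeMeasure, HasLogGradient (κ t) (fun x => ρ (t, x)) fun x => β (t, x) := by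
  obtain ⟨C, hC⟩ := exists_entropy_bound hE hl hα hlam hell hlip hent
  have hac : ∀ᵐ t ∂timeMeasure, κ t ≪ volume := by
    filter_upwards [ae_all_iff.2 fun n => (hC _ (one_le_scale n)).1] with t ht
    exact absolutelyContinuous_of_entropy_le ht
  obtain ⟨ρ, hρ, hρ0, hκ⟩ := exists_density hac
  obtain ⟨β, hβ, hβ2, hibp⟩ := exists_logarithmic_gradient (κ := κ) (le_max_right C 0) fun n =>
    (hC _ (one_le_scale n)).2.trans (ENNReal.ofReal_le_ofReal (le_max_left _ _))
  refine ⟨ρ, β, hρ, hβ, hρ0, hβ2, ?_⟩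
  filter_upwards [hκ, ae_integrable_slice hβ2, ae_mollifyGrad_eq hβ hβ2 hibp] with t h1 h2 h3
  exact ⟨hρ.comp measurable_prodMk_left, fun x => hρ0 _, h1, hβ.comp measurable_prodMk_left, h2, h3⟩

lemma restrict_Icc_le_timeMeasure {τ : ℝ} (hτ : τ ≤ 1) :
    volume.restrict (Icc 0 τ) ≤ timeMeasure := by
  rw [timeMeasure, Measure.restrict_congr_set Ioo_ae_eq_Icc]
  exact Measure.restrict_mono (Icc_subset_Icc_right hτ) le_rfl

lemma lintegral_integral_sq_lt_top {β : ℝ × Space d → Space d} (hβ : Measurable β)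
    (hβ2 : Integrable (fun z => ‖β z‖ ^ 2) (spaceTime κ)) :
    ∫⁻ t, ENNReal.ofReal (∫ x, ‖β (t, x)‖ ^ 2 ∂(κ t)) ∂timeMeasure < ⊤ := by
  have h := (hasFiniteIntegral_iff_ofReal (Eventually.of_forall fun z => sq_nonneg _)).1 hβ2.2
  rw [lintegral_spaceTime (hβ.norm.pow_const 2).ennreal_ofReal] at h
  refine (lintegral_mono_ae ?_).trans_lt h
  filter_upwards [ae_integrable_slice hβ2] with t ht
  rw [ofReal_integral_eq_lintegral_ofReal ht (Eventually.of_forall fun x => sq_nonneg _)]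

/-- Functions of time dominated by the slices of the Fisher information have finite integrals. -/
lemma lintegral_Icc_rpow_lt_top {β : ℝ × Space d → Space d} (hβ : Measurable β)
    (hβ2 : Integrable (fun z => ‖β z‖ ^ 2) (spaceTime κ)) {τ q : ℝ} (hτ : τ ≤ 1) (hq : 0 ≤ q)
    {f : ℝ → ℝ≥0∞} {C : ℝ≥0} (hf : ∀ᵐ t ∂timeMeasure,
      f t ≤ C * (1 + ENNReal.ofReal (∫ x, ‖β (t, x)‖ ^ 2 ∂(κ t)))) :
    (∫⁻ t in Icc 0 τ, f t) ^ q < ⊤ := by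
  refine ENNReal.rpow_lt_top_of_nonneg hq (ne_of_lt ?_)
  refine (lintegral_mono' (restrict_Icc_le_timeMeasure hτ) le_rfl).trans_lt
    ((lintegral_mono_ae hf).trans_lt ?_)
  rw [lintegral_const_mul' _ _ ENNReal.coe_ne_top, lintegral_add_left measurable_const]
  refine ENNReal.mul_lt_top ENNReal.coe_lt_top
    (ENNReal.add_lt_top.2 ⟨?_, lintegral_integral_sq_lt_top hβ hβ2⟩)
  simp

section Slice
variable {ν : Measure (Space d)} {ρ : Space d → ℝ} {β : Space d → Space d}

lemma HasLogGradient.lintegral_mul_sq (h : HasLogGradient ν ρ β) :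
    ∫⁻ x, ENNReal.ofReal (ρ x * ‖β x‖ ^ 2) = ENNReal.ofReal (∫ x, ‖β x‖ ^ 2 ∂ν) := by
  rw [h.integral_eq, ofReal_integral_eq_lintegral_ofReal h.integrable_mul_sq
    (Eventually.of_forall fun x => mul_nonneg (h.density_nonneg x) (sq_nonneg _))]

/-- With ∇ρ = ρβ the quotient |∇ρ|²/ρ is ρ|β|²; where ρ = 0 both vanish under the convention for
division by zero. -/
lemma HasLogGradient.lintegral_fisher (h : HasLogGradient ν ρ β) :
    ∫⁻ x, ENNReal.ofReal (‖ρ x • β x‖ ^ 2 / ρ x) = ENNReal.ofReal (∫ x, ‖β x‖ ^ 2 ∂ν) := by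
  rw [← h.lintegral_mul_sq]
  refine lintegral_congr fun x => ?_
  rw [norm_smul, Real.norm_of_nonneg (h.density_nonneg x)]
  rcases eq_or_ne (ρ x) 0 with h0 | h0
  · simp [h0]
  · congr 1
    field_simp

variable [IsProbabilityMeasure ν]

/-- The root has unit L²-norm as ρ has unit mass, and its gradient √ρ β/2 is controlled by ∫|β|² dν;
the constant 4 is 2(1 + 1²). -/
lemma HasLogGradient.sobolev_norm_sqrt_le (h : HasLogGradient ν ρ β) :
    (eLpNorm (fun x => √(ρ x)) 2 volume +
      eLpNorm (fun x => (√(ρ x) / 2) • β x) 2 volume) ^ (2 : ℝ) ≤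
      (4 : ℝ≥0) * (1 + ENNReal.ofReal (∫ x, ‖β x‖ ^ 2 ∂ν)) := by
  have h1 : eLpNorm (fun x => √(ρ x)) 2 volume = 1 := by
    refine ENNReal.rpow_left_injective (x := 2) two_ne_zero (Eq.trans ?_ (ENNReal.one_rpow 2).symm)
    beta_reduce
    have := eLpNorm_nnreal_pow_eq_lintegral (p := 2) (μ := volume) (f := fun x => √(ρ x)) (by simp)
    rw [show ((2 : ℝ≥0) : ℝ≥0∞) = 2 from rfl, show ((2 : ℝ≥0) : ℝ) = 2 from rfl] at this
    rw [this, ← ENNReal.ofReal_one, ← h.integral_density,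
      ofReal_integral_eq_lintegral_ofReal h.integrable_density
        (Eventually.of_forall h.density_nonneg)]
    refine lintegral_congr fun x => ?_
    rw [← ofReal_norm, ENNReal.ofReal_rpow_of_nonneg (norm_nonneg _) zero_le_two,
      Real.norm_of_nonneg (Real.sqrt_nonneg _), Real.rpow_two, Real.sq_sqrt (h.density_nonneg x)]
  have h2 : eLpNorm (fun x => (√(ρ x) / 2) • β x) 2 volume ^ (2 : ℝ) ≤
      ENNReal.ofReal (∫ x, ‖β x‖ ^ 2 ∂ν) := by
    have := eLpNorm_nnreal_pow_eq_lintegral (p := 2) (μ := volume)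
      (f := fun x => (√(ρ x) / 2) • β x) (by simp)
    rw [show ((2 : ℝ≥0) : ℝ≥0∞) = 2 from rfl, show ((2 : ℝ≥0) : ℝ) = 2 from rfl] at this
    rw [this, ← h.lintegral_mul_sq]
    refine lintegral_mono fun x => ?_
    rw [← ofReal_norm, ENNReal.ofReal_rpow_of_nonneg (norm_nonneg _) zero_le_two, Real.rpow_two]
    refine ENNReal.ofReal_le_ofReal ?_
    have h0 := h.density_nonneg x
    rw [norm_smul, Real.norm_of_nonneg (by positivity), mul_pow, div_pow, Real.sq_sqrt h0]
    nlinarith [mul_nonneg h0 (sq_nonneg ‖β x‖)]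
  refine (le_of_eq (by rw [h1, add_comm])).trans ((add_sq_le_mul_one_add (b := 1) h2).trans_eq ?_)
  rw [ENNReal.one_rpow]
  norm_num

end Slice

end Final

end ParabolicMeasure

theorem theorem2p1 {d : ℕ}
    (A : ℝ × Space d → Matrix (Fin d) (Fin d) ℝ) (b : ℝ × Space d → Space d)
    -- the family of probability measures `μ_t`; only `0 ≤ t < 1` matters
    (μ : Kernel ℝ (Space d)) [IsMarkovKernel μ]
    (hA_meas : ∀ i j, Measurable (fun z => A z i j))
    (h_sol : IsSolution A b μ) (h_init : HasInitialCondition μ (μ 0))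
    (M : ℝ) (hA_bdd : ∀ t ∈ Ioo (0 : ℝ) 1, ∀ x i j, |A (t, x) i j| ≤ M)
    (α : ℝ) (hα : 0 < α)
    (hA_ell : ∀ t ∈ Ioo (0 : ℝ) 1, ∀ x, ∀ ξ : Space d,
      α * ‖ξ‖ ^ 2 ≤ ∑ i, ∑ j, A (t, x) i j * ξ i * ξ j)
    (lam : ℝ≥0)
    (hA_lip : ∀ t ∈ Ioo (0 : ℝ) 1, ∀ i j, LipschitzWith lam (fun x => A (t, x) i j))
    (hb : MemLp b 2 (spaceTime μ)) :
    -- a sufficient condition for `Λ ∈ L²(μ)`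
    ((∃ C₁ C₂ : ℝ, ∀ᵐ z ∂(spaceTime μ),
        inner ℝ (b z) z.2 ≤ C₁ * ‖z.2‖ ^ 2 * logMax z.2 + C₂) →
      MemLp (fun x : Space d => logMax x) 2 (μ 0) →
      MemLp (fun z : ℝ × Space d => logMax z.2) 2 (spaceTime μ)) ∧
    -- the main assertion
    (MemLp (fun z : ℝ × Space d => logMax z.2) 2 (spaceTime μ) → HasFiniteEntropy (μ 0) →
      ∃ (ρ : ℝ × Space d → ℝ) (G : ℝ × Space d → Space d),
        Measurable ρ ∧ Measurable G ∧ (∀ z, 0 ≤ ρ z) ∧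
        (∀ᵐ t ∂(volume.restrict (Ioo (0 : ℝ) 1)),
          μ t = volume.withDensity (fun x => ENNReal.ofReal (ρ (t, x))) ∧
          HasWeakGradient (fun x => ρ (t, x)) (fun x => G (t, x))) ∧
        (∀ τ : ℝ, 0 < τ → τ < 1 →
          fisher ρ G τ < ⊤ ∧
          MemMixedSobolev 2 2 τ (fun z => √(ρ z)) ∧
          (2 < d → MemMixedLp ((d : ℝ) / ((d : ℝ) - 2)) 1 τ ρ) ∧
          (d = 2 → ∀ s : ℝ, 1 ≤ s → MemMixedLp s 1 τ ρ)) ∧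
        (LogMomentsBounded ρ → fisher ρ G 1 < ⊤) ∧
        -- a sufficient condition for the boundedness of `∫ ρ(t, x) Λ(x) dx` as `t → 1`
        ((∃ C₁ C₂ : ℝ, ∀ᵐ z ∂(spaceTime μ), inner ℝ (b z) z.2 ≤ C₁ * ‖z.2‖ ^ 2 + C₂) →
          Integrable (fun x : Space d => logMax x) (μ 0) →
          LogMomentsBounded ρ)) := by
  obtain ⟨b', hE⟩ := h_sol.exists_evolution hA_meas h_init hA_bdd hb
  refine ⟨fun _ h0 => memLp_logMax_spaceTime hE h0, fun hl hent => ?_⟩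
  replace hl := (memLp_logMax_iff measurable_snd).1 hl
  obtain ⟨ρ, β, hρ, hβ, hρ0, hβ2, hG⟩ := exists_hasLogGradient hE hl hα lam.coe_nonneg hA_ell
    (fun t ht i j x y => by
      have := (hA_lip t ht i j).dist_le_mul x y
      rwa [Real.dist_eq, dist_eq_norm] at this) hent
  -- For G = ρβ the Fisher information is an integral of |β|² against μ, finite over all of (0,1),
  -- so the endpoint τ = 1 is included.
  have hfisher : ∀ τ ≤ 1, fisher ρ (fun z => ρ z • β z) τ < ⊤ := fun τ hτ => by
    have h := lintegral_Icc_rpow_lt_top hβ hβ2 hτ zero_le_one (C := 1)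
      (f := fun t => ∫⁻ x, ENNReal.ofReal (‖ρ (t, x) • β (t, x)‖ ^ 2 / ρ (t, x))) <| by
        filter_upwards [hG] with t ht
        rw [ht.lintegral_fisher, ENNReal.coe_one, one_mul]
        exact le_add_self
    rwa [ENNReal.rpow_one] at h
  have hmixed : ∀ p τ : ℝ, τ < 1 → (∃ C : ℝ≥0,
      ∀ (ν : Measure (Space d)) [IsProbabilityMeasure ν] (ρ : Space d → ℝ) (β : Space d → Space d),
        HasLogGradient ν ρ β → eLpNorm ρ (ENNReal.ofReal p) volume ≤
          C * (1 + ENNReal.ofReal (∫ x, ‖β x‖ ^ 2 ∂ν))) → MemMixedLp p 1 τ ρ :=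
    fun p τ hτ ⟨C, hC⟩ => ⟨hρ.aestronglyMeasurable,
      lintegral_Icc_rpow_lt_top hβ hβ2 hτ.le (by norm_num) (C := C) <| by
        filter_upwards [hG] with t ht
        rw [ENNReal.rpow_one]
        exact hC _ _ _ ht⟩
  refine ⟨ρ, fun z => ρ z • β z, hρ, hρ.smul hβ, hρ0, ?_, fun τ _ hτ => ⟨hfisher τ hτ.le, ?_, ?_, ?_⟩,
    fun _ => hfisher 1 le_rfl, fun _ _ => ?_⟩
  · filter_upwards [hG] with t ht
    exact ⟨ht.eq_withDensity, ht.hasWeakGradient⟩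
  · refine ⟨hρ.sqrt.aestronglyMeasurable, fun z => (√(ρ z) / 2) • β z,
      ((hρ.sqrt.div_const 2).smul hβ).aestronglyMeasurable,
      ae_mono (restrict_Icc_le_timeMeasure hτ.le) (hG.mono fun t ht => ht.hasWeakGradient_sqrt), ?_⟩
    refine lintegral_Icc_rpow_lt_top hβ hβ2 hτ.le (by norm_num) (C := 4) ?_
    filter_upwards [hG] with t ht
    rw [ENNReal.ofReal_ofNat]
    exact ht.sobolev_norm_sqrt_le
  · exact fun hd => hmixed _ _ hτ (exists_eLpNorm_density_le_of_two_lt hd)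
  · exact fun hd s hs => hmixed _ _ hτ (exists_eLpNorm_density_le_of_eq_two hd hs)
  · obtain ⟨-, L, hL⟩ := exists_logBracket_moment hE hl
    -- The logarithmic moments are bounded for almost all t in (0,1), so the left neighbourhood of 1
    -- can be the whole interval.
    refine ⟨L.toNNReal, 0, one_pos, ?_⟩
    filter_upwards [hG, hL] with t h1 h2
    have hi := h1.integrable_iff.1 h2.1
    calc ∫⁻ x, ENNReal.ofReal (ρ (t, x) * logMax x)
        ≤ ∫⁻ x, ENNReal.ofReal (ρ (t, x) * logBracket 1 x) := lintegral_mono fun x =>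
          ENNReal.ofReal_le_ofReal (mul_le_mul_of_nonneg_left (logMax_le_logBracket x) (hρ0 _))
      _ = ENNReal.ofReal (∫ x, logBracket 1 x ∂(μ t)) := by
          rw [h1.integral_eq, ofReal_integral_eq_lintegral_ofReal hi
            (Eventually.of_forall fun x => mul_nonneg (hρ0 _) (logBracket_nonneg _ _))]
      _ ≤ L.toNNReal := ENNReal.ofReal_le_ofReal h2.2
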